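/- Let $Z$ be a compact (Hausdorff) smooth manifold and let $\mathcal A\to Z$ be a star Azumaya bundle of degree $N\ge 1$, i.e. a smooth complex vector bundle whose fibres are unital star algebras and which is locally smoothly isomorphic, as a bundle of star algebras, to the trivial bundle with fibre $M_N(\mathbb C)$. Let $\pi:\mathcal P\to Z$ be its principal $\mathrm{PU}(N)$-bundle of trivializations: a point $p\in\mathcal P$ over $z$ is a star-algebra isomorphism $\mathcal A_z\to M_N(\mathbb C)$, and $\mathrm{SU}(N)$ acts on $\mathcal P$ through $\mathrm{PU}(N)$ by conjugation. *Definitions.* An *equivariant bundle* is a smooth complex vector bundle $\tilde V$ over $\mathcal P$ with a smooth, fibrewise linear action of $\mathrm{SU}(N)$ covering the action on $\mathcal P$, for which the centre acts on the fibres by scalars. A *representing bundle* for $\mathcal A$ is an equivariant bundle $\tilde V$ with an isomorphism of bundles of algebras of $\mathcal A$ and $\hom(\tilde V)$ as a bundle over $Z$; that is, with a smooth, $\mathrm{SU}(N)$-invariant family of algebra isomorphisms $\mathcal A_{\pi(p)}\cong\hom(\tilde V_p)$, $p\in\mathcal P$. The *standard* representing bundle is $\tilde E=\mathcal P\times\mathbb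 C^N$ with the standard action of $\mathrm{SU}(N)$, where $\mathcal A_{\pi(p)}$ acts on $\tilde E_p=\mathbb C^N$ through $p$. Two representing bundles are *equivalent* if there is a smooth bundle isomorphism between them which intertwines the $\mathrm{SU}(N)$ actions and the isomorphisms with $\mathcal A$. For an equivariant bundle $\tilde V$, let $\mathrm{Hom}(\tilde V)=\tilde V\boxtimes\tilde V'$ be the bundle over $\mathcal P\times\mathcal P$ with fibre $\hom(\tilde V_{p'},\tilde V_p)$ at $(p,p')$; for a line bundle $\tilde L$ it is $\tilde L\boxtimes\tilde L^{-1}$. A *descent* of $\mathrm{Hom}(\tilde V)$ consists of a smooth vector bundle $B$ over a neighbourhood $U$ of the diagonal in $Z^2$; a neighbourhood $W$ of the diagonal in $\mathcal P\times\mathcal P$ with $(\pi\times\pi)(W)=U$, and a neighbourhood $O$ of the identity in $\mathrm{SU}(N)$ such that any two points of $W$ over the same point of $U$ are related by some $(g,g')\in\mathrm{SU}(N)^2$ with $g'g^{-1}\in O$; a smooth lifting of $B$ to $\mathrm{Hom}(\tilde V)$ over $W$, that is, isomorphisms $B_{(\pi(p),\pi(p'))}\cong\hom(\tilde V_{p'},\tilde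 V_p)$ for $(p,p')\in W$, compatible with the conjugation action of every $(g,g')$ with $g'g^{-1}\in O$ which maps $(p,p')$ into $W$; and smooth bilinear composition maps $$B_{(x,y)}\times B_{(y,z)}\longrightarrow B_{(x,z)},\qquad (x,y),(y,z),(x,z)\in U,$$ which are associative (wherever all the compositions are defined) and lift to the composition of homomorphisms. If $\tilde V$ is a representing bundle, an *extension of $\mathcal A$ given by $\tilde V$*, denoted $\hat{\mathcal A}_{\tilde V}$, is a descent of $\mathrm{Hom}(\tilde V)$ together with a smooth isomorphism of bundles of algebras between $\mathcal A$ and the restriction of the descended bundle to the diagonal $\{(z,z)\}\cong Z$, which lifts to the given isomorphism $\mathcal A_{\pi(p)}\cong\hom(\tilde V_p)$ at every $(p,p)$. The *canonical extension* $\hat{\mathcal A}$ is the extension given by $\tilde E$, and for an equivariant line bundle $\tilde L$ the line bundle $\hat L$ near the diagonal of $Z^2$ is the descent of $\tilde L\boxtimes\tilde L^{-1}$. **Proposition.** Let $\tilde V$ be a representing bundle for $\mathcal A$. 1. There is an extension $\hat{\mathcal A}_{\tilde V}$ of $\mathcal A$ given by $\tilde V$: a vector bundle defined in a neighbourhood of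 the diagonal of $Z^2$, extending $\mathcal A=\hom(\tilde V)$ from the diagonal, with the composition property, and lifting canonically to $\mathrm{Hom}(\tilde V)$ over a neighbourhood of the diagonal in $\mathcal P\times\mathcal P$. 2. There is an equivariant line bundle $\tilde L$ over $\mathcal P$ such that $\tilde V$ is equivalent, as a representing bundle, to $\tilde L\otimes\tilde E$ with the tensor product action. 3. For every equivariant line bundle $\tilde L$ and every equivalence $\tilde V\cong\tilde L\otimes\tilde E$, the canonical extension $\hat{\mathcal A}$ and the line bundle $\hat L$ exist, and every extension $\hat{\mathcal A}_{\tilde V}$ is isomorphic, with its composition maps, to $\hat{\mathcal A}\otimes\hat L$, whichever realizations of $\hat{\mathcal A}$ and $\hat L$ are taken: there is a smooth isomorphism of vector bundles over a neighbourhood of the diagonal of $Z^2$ which intertwines the composition maps, and which lifts, over a neighbourhood of the diagonal of $\mathcal P\times\mathcal P$, to the natural isomorphism $\mathrm{Hom}(\tilde V)\cong\mathrm{Hom}(\tilde E)\otimes\mathrm{Hom}(\tilde L)$. -/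

import Mathlib

open Bundle Set Filter
open scoped Manifold Topology ContDiff TensorProduct

universe u v w

noncomputable section

/-- `ℂⁿ` with its Hermitian structure. -/
abbrev Cvec (n : ℕ) : Type := EuclideanSpace ℂ (Fin n)

/-- The star algebra of complex `n × n` matrices, as the algebra of endomorphisms of `ℂⁿ`. -/
def MatAlg (n : ℕ) : Type := Cvec n →L[ℂ] Cvec n

namespace MatAlg

instance (n : ℕ) : CStarAlgebra (MatAlg n) := inferInstanceAs (CStarAlgebra (Cvec n →L[ℂ] Cvec n))

instance (n : ℕ) : FiniteDimensional ℂ (MatAlg n) :=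
  inferInstanceAs (FiniteDimensional ℂ (Cvec n →L[ℂ] Cvec n))

instance (n : ℕ) : FunLike (MatAlg n) (Cvec n) (Cvec n) :=
  inferInstanceAs (FunLike (Cvec n →L[ℂ] Cvec n) (Cvec n) (Cvec n))

section basics

variable {n : ℕ}

theorem ext {a b : MatAlg n} (h : ∀ v, a v = b v) : a = b := ContinuousLinearMap.ext h
theorem add_apply (a b : MatAlg n) (v : Cvec n) : (a + b) v = a v + b v := rfl
theorem sub_apply (a b : MatAlg n) (v : Cvec n) : (a - b) v = a v - b v := rfl
theorem neg_apply (a : MatAlg n) (v : Cvec n) : (-a) v = -(a v) := rfl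
theorem zero_apply (v : Cvec n) : (0 : MatAlg n) v = 0 := rfl
theorem smul_apply (c : ℂ) (a : MatAlg n) (v : Cvec n) : (c • a) v = c • a v := rfl
theorem mul_apply (a b : MatAlg n) (v : Cvec n) : (a * b) v = a (b v) := rfl
theorem one_apply (v : Cvec n) : (1 : MatAlg n) v = v := rfl
theorem map_add' (a : MatAlg n) (v w : Cvec n) : a (v + w) = a v + a w :=
  ContinuousLinearMap.map_add (a : Cvec n →L[ℂ] Cvec n) v w
theorem map_smul' (a : MatAlg n) (c : ℂ) (v : Cvec n) : a (c • v) = c • a v :=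
  ContinuousLinearMap.map_smul (a : Cvec n →L[ℂ] Cvec n) c v
theorem inner_star_right (a : MatAlg n) (v w : Cvec n) :
    inner ℂ v (star a w) = inner ℂ (a v) w :=
  ContinuousLinearMap.adjoint_inner_right (a : Cvec n →L[ℂ] Cvec n) v w
theorem sum_apply {ι : Type*} (s : Finset ι) (f : ι → MatAlg n) (v : Cvec n) :
    (∑ i ∈ s, f i) v = ∑ i ∈ s, f i v := by
  classical
  induction s using Finset.induction_on with
  | empty => rfl
  | insert a s ha ih => rw [Finset.sum_insert ha, Finset.sum_insert ha, add_apply, ih]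

/-- Evaluation at a vector, as a linear map. -/
def evalL (v : Cvec n) : MatAlg n →ₗ[ℂ] Cvec n where
  toFun a := a v
  map_add' _ _ := rfl
  map_smul' _ _ := rfl

/-- The rank one matrix `v ⊗ w*`, linear in `v`. -/
def rankOneL (w : Cvec n) : Cvec n →ₗ[ℂ] MatAlg n where
  toFun v := InnerProductSpace.rankOne ℂ v w
  map_add' x y := by
    apply ext; intro z
    exact (smul_add (inner ℂ w z) x y)
  map_smul' c x := by
    apply ext; intro z
    exact smul_comm (inner ℂ w z) c x

theorem rankOneL_apply (v w z : Cvec n) : rankOneL w v z = inner ℂ w z • v := rfl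

end basics

local instance (n : ℕ) : NormedAlgebra ℚ (MatAlg n) := NormedAlgebra.restrictScalars ℚ ℝ (MatAlg n)

open NormedSpace in
theorem exists_log (N : ℕ) : ∃ (T S : Set (MatAlg N)) (lg : MatAlg N → MatAlg N),
    IsOpen T ∧ IsOpen S ∧ (1 : MatAlg N) ∈ T ∧ (0 : MatAlg N) ∈ S ∧ ContDiffOn ℝ ∞ lg T ∧
    (∀ u ∈ T, lg u ∈ S ∧ exp (lg u) = u) ∧ ∀ Y ∈ S, exp Y ∈ T ∧ lg (exp Y) = Y := by
  have hana : ∀ x : MatAlg N, ContDiffAt ℝ ω (exp : MatAlg N → MatAlg N) x :=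
    fun x => (exp_analytic (𝕂 := ℝ) x).contDiffAt
  have hder : HasFDerivAt (exp : MatAlg N → MatAlg N)
      ((ContinuousLinearEquiv.refl ℝ (MatAlg N) : MatAlg N ≃L[ℝ] MatAlg N) :
        MatAlg N →L[ℝ] MatAlg N) 0 :=
    (hasStrictFDerivAt_exp_zero (𝕂 := ℝ) (𝔸 := MatAlg N)).hasFDerivAt
  have hn : (ω : WithTop ℕ∞) ≠ 0 := by simp
  let h := (hana 0).toOpenPartialHomeomorph exp hder hn
  have h0 : (0 : MatAlg N) ∈ h.source := (hana 0).mem_toOpenPartialHomeomorph_source hder hn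
  have hcoe : ∀ Y, h Y = exp Y := fun Y => rfl
  have h1 : (1 : MatAlg N) ∈ h.target := by
    have := h.map_source h0
    rwa [hcoe, exp_zero] at this
  have hsymm1 : h.symm 1 = 0 := by
    have := h.left_inv h0
    rwa [hcoe, exp_zero] at this
  have hc : ContDiffAt ℝ ω h.symm 1 := by
    apply h.contDiffAt_symm h1 (f₀' := ContinuousLinearEquiv.refl ℝ (MatAlg N))
    · rw [hsymm1]; exact hder
    · rw [hsymm1]; exact hana 0
  obtain ⟨V, hV, hVo, hV1⟩ := eventually_nhds_iff.1 (hc.eventually (by simp))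
  refine ⟨h.target ∩ V, h.source ∩ h ⁻¹' V, h.symm, h.open_target.inter hVo,
    h.isOpen_inter_preimage hVo, ⟨h1, hV1⟩, ⟨h0, ?_⟩, ?_, ?_, ?_⟩
  · change exp 0 ∈ V
    rwa [exp_zero]
  · intro u hu
    exact ((hV u hu.2).of_le le_top).contDiffWithinAt
  · rintro u ⟨hu1, hu2⟩
    refine ⟨⟨h.map_target hu1, ?_⟩, h.right_inv hu1⟩
    change h (h.symm u) ∈ V
    rwa [h.right_inv hu1]
  · rintro Y ⟨hY1, hY2⟩
    exact ⟨⟨h.map_source hY1, hY2⟩, h.left_inv hY1⟩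

theorem exp_add_scalar {N : ℕ} (X : MatAlg N) (c : ℂ) :
    NormedSpace.exp (X + c • (1 : MatAlg N)) = Complex.exp c • NormedSpace.exp X := by
  rw [NormedSpace.exp_add_of_commute ((Commute.one_right X).smul_right c)]
  have : NormedSpace.exp (c • (1 : MatAlg N)) = Complex.exp c • 1 := by
    rw [← Algebra.algebraMap_eq_smul_one, ← Algebra.algebraMap_eq_smul_one,
      Complex.exp_eq_exp_ℂ, NormedSpace.algebraMap_exp_comm]
  rw [this, mul_smul_comm, mul_one]

variable {N : ℕ} [NeZero N]

/-- The first basis vector of `ℂᴺ`. -/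
def e0 (N : ℕ) [NeZero N] : Cvec N := EuclideanSpace.single 0 1

theorem inner_e0 : inner ℂ (e0 N) (e0 N) = 1 := by
  rw [inner_self_eq_norm_sq_to_K]; simp [e0]

/-- The rank one matrix `v ⊗ e₀*`. -/
def col : Cvec N →ₗ[ℂ] MatAlg N := rankOneL (e0 N)

theorem col_e0 (v : Cvec N) : col v (e0 N) = v := by
  rw [col, rankOneL_apply, inner_e0, one_smul]

theorem mul_col (a : MatAlg N) (v : Cvec N) : a * col v = col (a v) := by
  apply ext; intro w
  rw [mul_apply, col, rankOneL_apply, rankOneL_apply, map_smul']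

/-- For an automorphism `α` of the matrix algebra, a matrix `u` with `α a * u = u * a`. -/
def implement (α : MatAlg N → MatAlg N) : MatAlg N :=
  ∑ i : Fin N, rankOneL (EuclideanSpace.single i 1) (α (col (EuclideanSpace.single i 1)) (e0 N))

theorem implement_apply (α : MatAlg N ≃⋆ₐ[ℂ] MatAlg N) (v : Cvec N) :
    implement α v = α (col v) (e0 N) := by
  let f : Cvec N →ₗ[ℂ] Cvec N := (evalL (e0 N)) ∘ₗ (α.toAlgEquiv.toLinearMap) ∘ₗ col
  have hv : ∑ i : Fin N, v i • EuclideanSpace.single i (1 : ℂ) = v := by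
    simpa using (EuclideanSpace.basisFun (Fin N) ℂ).sum_repr v
  change _ = f v
  conv_rhs => rw [← hv]
  rw [map_sum, implement, sum_apply]
  refine Finset.sum_congr rfl fun i _ => ?_
  rw [rankOneL_apply, map_smul]
  simp only [EuclideanSpace.inner_single_left, map_one, one_mul]; rfl

theorem map_mul_implement (α : MatAlg N ≃⋆ₐ[ℂ] MatAlg N) (a : MatAlg N) :
    α a * implement α = implement α * a := by
  apply ext; intro v
  rw [mul_apply, mul_apply, implement_apply, implement_apply, ← mul_col, map_mul, mul_apply]

theorem star_implement_mul (α : MatAlg N ≃⋆ₐ[ℂ] MatAlg N) :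
    star (implement α) * implement α
      = ((‖implement α (e0 N)‖ ^ 2 : ℝ) : ℂ) • (1 : MatAlg N) := by
  set U := implement α with hU
  have h1 : ∀ a, star U * α a = a * star U := by
    intro a
    have := congrArg star (map_mul_implement α (star a))
    rwa [star_mul, star_mul, map_star, star_star, star_star] at this
  have h2 : ∀ a, star U * U * a = a * (star U * U) := by
    intro a
    rw [mul_assoc, ← map_mul_implement, ← mul_assoc, h1, mul_assoc]
  apply ext; intro v
  have h3 := congrArg (fun f : MatAlg N => f (e0 N)) (h2 (col v))
  simp only [mul_apply, col_e0] at h3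
  rw [mul_apply, h3, col, rankOneL_apply, inner_star_right, inner_self_eq_norm_sq_to_K,
    smul_apply, one_apply]
  simp

variable (N) in
/-- Skew-adjoint matrices with vanishing first diagonal entry: a complement of `iℝ` in `𝔲(N)`,
hence a copy of the Lie algebra of `PU(N)`. -/
def liePU : Submodule ℝ (MatAlg N) where
  carrier := {X | star X = -X ∧ inner ℂ (e0 N) (X (e0 N)) = 0}
  add_mem' := by
    rintro a b ⟨h1, h2⟩ ⟨h3, h4⟩
    refine ⟨by rw [star_add, h1, h3]; abel, ?_⟩
    rw [add_apply, inner_add_right, h2, h4, add_zero]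
  zero_mem' := by simp [zero_apply]
  smul_mem' := by
    rintro c a ⟨h1, h2⟩
    have hc : c • a = (c : ℂ) • a := (Complex.coe_smul c a).symm
    refine ⟨?_, ?_⟩
    · rw [hc, star_smul, h1]; simp
    · rw [hc, smul_apply, inner_smul_right, h2, mul_zero]

/-- The matrix `Y` with the scalar that makes the first diagonal entry vanish subtracted. -/
def reduce : MatAlg N →ₗ[ℂ] MatAlg N where
  toFun Y := Y - inner ℂ (e0 N) (Y (e0 N)) • (1 : MatAlg N)
  map_add' x y := by rw [add_apply, inner_add_right, add_smul]; abel
  map_smul' c x := by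
    rw [smul_apply, inner_smul_right, RingHom.id_apply, smul_sub, smul_smul]

/-- The linear projection of matrices onto `liePU N`. -/
def toLie : MatAlg N →ₗ[ℝ] liePU N where
  toFun Y := ⟨(2⁻¹ : ℝ) • (reduce Y - star (reduce Y)), by
    refine Submodule.smul_mem _ _ ⟨by simp, ?_⟩
    have h : inner ℂ (e0 N) (reduce Y (e0 N)) = 0 := by
      change inner ℂ (e0 N) ((Y - inner ℂ (e0 N) (Y (e0 N)) • (1 : MatAlg N)) (e0 N)) = 0
      rw [sub_apply, smul_apply, one_apply, inner_sub_right, inner_smul_right, inner_e0]; simp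
    rw [sub_apply, inner_sub_right, inner_star_right, h, ← inner_conj_symm, h]; simp⟩
  map_add' x y := by
    apply Subtype.ext
    simp only [map_add, star_add, Submodule.coe_add, ← smul_add]
    congr 1; abel
  map_smul' c x := by
    apply Subtype.ext
    have hc : ∀ a : MatAlg N, c • a = (c : ℂ) • a := fun a => (Complex.coe_smul c a).symm
    simp only [RingHom.id_apply, Submodule.coe_smul]
    rw [smul_comm c, hc x, map_smul, star_smul, hc, smul_sub]
    simp [smul_sub]

theorem contDiff_toLie : ContDiff ℝ ∞ (toLie (N := N)) :=
  (toLie (N := N)).toContinuousLinearMap.contDiff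

theorem toLie_add_scalar (X : liePU N) (c : ℂ) : toLie ((X : MatAlg N) + c • 1) = X := by
  obtain ⟨X, h1, h2⟩ := X
  have : reduce (X + c • (1 : MatAlg N)) = X := by
    change (X + c • (1 : MatAlg N)) - inner ℂ (e0 N) ((X + c • (1 : MatAlg N)) (e0 N)) •
      (1 : MatAlg N) = X
    rw [add_apply, smul_apply, one_apply, inner_add_right, h2, inner_smul_right, inner_e0]
    simp
  apply Subtype.ext
  change (2⁻¹ : ℝ) • (reduce (X + c • (1 : MatAlg N)) - star (reduce (X + c • (1 : MatAlg N)))) = X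
  rw [this, h1, sub_neg_eq_add, ← two_smul ℝ X, smul_smul]; simp

/-- A matrix which is skew-adjoint modulo a real scalar is the sum of its projection and a
scalar. -/
theorem exists_eq_toLie_add {Y : MatAlg N} {r : ℂ} (h : -star Y = Y - r • 1) :
    ∃ c : ℂ, Y = (toLie Y : MatAlg N) + c • 1 := by
  set k := inner ℂ (e0 N) (Y (e0 N))
  have h1 : reduce Y = Y - k • 1 := rfl
  have h2 : star (reduce Y) = -Y + (r - star k) • (1 : MatAlg N) := by
    rw [h1, star_sub, star_smul, star_one, ← neg_neg (star Y), h, sub_smul]; abel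
  have h3 : (toLie Y : MatAlg N) = (2⁻¹ : ℝ) • (reduce Y - star (reduce Y)) := rfl
  refine ⟨(2⁻¹ : ℂ) * (k + (r - star k)), ?_⟩
  rw [h3, h2, h1, ← Complex.coe_smul]
  rw [mul_smul, add_smul, show Y - k • (1 : MatAlg N) - (-Y + (r - star k) • 1)
    = (2 : ℂ) • Y - (k • 1 + (r - star k) • 1) by rw [two_smul]; abel, smul_sub, smul_smul]
  simp


/-- Conjugation by the exponential of an element of the Lie algebra. -/
def conjExp (X : liePU N) : MatAlg N ≃⋆ₐ[ℂ] MatAlg N :=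
  Unitary.conjStarAlgAut ℂ (MatAlg N)
    ⟨NormedSpace.exp (X : MatAlg N),
      NormedSpace.exp_mem_unitary_of_mem_skewAdjoint (skewAdjoint.mem_iff.2 X.2.1)⟩

theorem conjExp_apply (X : liePU N) (a : MatAlg N) :
    conjExp X a = NormedSpace.exp (X : MatAlg N) * a * star (NormedSpace.exp (X : MatAlg N)) := rfl

theorem star_exp_mul_exp (X : liePU N) :
    star (NormedSpace.exp (X : MatAlg N)) * NormedSpace.exp (X : MatAlg N) = 1 :=
  (NormedSpace.exp_mem_unitary_of_mem_skewAdjoint (skewAdjoint.mem_iff.2 X.2.1)).1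

theorem implement_conjExp (X : liePU N) :
    implement (conjExp X) = (inner ℂ (NormedSpace.exp (X : MatAlg N) (e0 N)) (e0 N) : ℂ) •
      NormedSpace.exp (X : MatAlg N) := by
  apply ext; intro v
  rw [implement_apply, conjExp_apply, mul_apply, mul_apply, col, rankOneL_apply, inner_star_right,
    map_smul', smul_apply]

theorem implement_refl : implement (StarAlgEquiv.refl ℂ (MatAlg N)) = 1 := by
  apply ext; intro v
  rw [implement_apply]; exact col_e0 v

open NormedSpace in
/-- Coordinates on the automorphism group of the matrix algebra near the identity. -/
theorem exists_chart (N : ℕ) [NeZero N] :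
    ∃ (T : Set (MatAlg N)) (B : Set (liePU N)) (l : MatAlg N → liePU N),
      IsOpen T ∧ IsOpen B ∧ ContDiffOn ℝ ∞ l T ∧ (1 : MatAlg N) ∈ T ∧
      (∀ X ∈ B, implement (conjExp X) ∈ T ∧ l (implement (conjExp X)) = X) ∧
      ∀ α : MatAlg N ≃⋆ₐ[ℂ] MatAlg N, implement α ∈ T →
        l (implement α) ∈ B ∧ conjExp (l (implement α)) = α := by
  obtain ⟨T, S, lg, hT, hS, h1T, h0S, hlg, hTS, hST⟩ := exists_log N
  have hexpc : Continuous (exp : MatAlg N → MatAlg N) := exp_continuous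
  have hev : Continuous fun Y : MatAlg N => exp Y (e0 N) :=
    (evalL (e0 N)).continuous_of_finiteDimensional.comp hexpc
  have hev0 : (exp (0 : MatAlg N)) (e0 N) = e0 N := by rw [exp_zero, one_apply]
  have hnorm0 : ‖e0 N‖ = 1 := by simp [e0]
  let r : MatAlg N → ℝ := fun Y => Real.log (‖exp Y (e0 N)‖ ^ 2)
  have hr : ContinuousAt r 0 := by
    refine ContinuousAt.log (hev.norm.pow 2).continuousAt ?_
    rw [hev0, hnorm0]; norm_num
  have hr0 : r 0 = 0 := by simp only [r]; rw [hev0, hnorm0]; norm_num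
  have hV : ∀ᶠ Y in 𝓝 (0 : MatAlg N), Y ∈ S ∧ -star Y ∈ S ∧ Y - (r Y : ℂ) • 1 ∈ S := by
    have hS0 : ∀ᶠ Y in 𝓝 (0 : MatAlg N), Y ∈ S := hS.mem_nhds h0S
    refine hS0.and (Filter.Eventually.and ?_ ?_)
    · have : ContinuousAt (fun Y : MatAlg N => -star Y) 0 := by fun_prop
      exact this.eventually (by simpa using hS0)
    · have : ContinuousAt (fun Y : MatAlg N => Y - (r Y : ℂ) • (1 : MatAlg N)) 0 := by
        have := Complex.continuous_ofReal.continuousAt.comp hr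
        exact continuousAt_id.sub (this.smul continuousAt_const)
      exact this.eventually (by simpa [hr0] using hS0)
  obtain ⟨V, hV, hVo, hV0⟩ := eventually_nhds_iff.1 hV
  let c : MatAlg N → ℂ := fun Y => inner ℂ (exp Y (e0 N)) (e0 N)
  have hc : Continuous c := hev.inner continuous_const
  have hc0 : c 0 = 1 := by simp only [c]; rw [hev0, inner_e0]
  have hB : ∀ᶠ X : liePU N in 𝓝 (0 : liePU N), c (X : MatAlg N) ≠ 0 ∧
      (X : MatAlg N) + Complex.log (c X) • 1 ∈ V := by
    have h1 : ContinuousAt (fun X : liePU N => c X) 0 :=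
      (hc.comp continuous_subtype_val).continuousAt
    refine Filter.Eventually.and (h1.eventually_ne (by simp [hc0])) ?_
    have h2 : ContinuousAt (fun X : liePU N =>
        (X : MatAlg N) + Complex.log (c X) • (1 : MatAlg N)) 0 := by
      have h3 : ContinuousAt (fun X : liePU N => Complex.log (c X)) 0 := h1.clog (by simp [hc0])
      exact continuous_subtype_val.continuousAt.add (h3.smul continuousAt_const)
    have hV1 : ∀ᶠ Y in 𝓝 (0 : MatAlg N), Y ∈ V := hVo.mem_nhds hV0
    exact h2.eventually (by simpa [hc0] using hV1)
  obtain ⟨B, hB, hBo, hB0⟩ := eventually_nhds_iff.1 hB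
  have hlgc : ContinuousOn lg T := hlg.continuousOn
  have hlg1 : lg 1 = 0 := by
    have := (hST 0 h0S).2
    rwa [exp_zero] at this
  have htoLie : Continuous (toLie (N := N)) := contDiff_toLie.continuous
  refine ⟨T ∩ lg ⁻¹' (V ∩ toLie ⁻¹' B), B, fun u => toLie (lg u),
    hlgc.isOpen_inter_preimage hT (hVo.inter (hBo.preimage htoLie)), hBo,
    contDiff_toLie.comp_contDiffOn (hlg.mono inter_subset_left), ?_, ?_, ?_⟩
  · refine ⟨h1T, ?_, ?_⟩
    · rwa [hlg1]
    · change toLie (lg 1) ∈ B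
      rwa [hlg1, map_zero]
  · intro X hX
    obtain ⟨hcX, hXV⟩ := hB X hX
    have h1 : implement (conjExp X) = exp ((X : MatAlg N) + Complex.log (c X) • 1) := by
      rw [implement_conjExp, exp_add_scalar, Complex.exp_log hcX]
    have h2 := hST _ (hV _ hXV).1
    have h3 : toLie ((X : MatAlg N) + Complex.log (c X) • 1) = X := toLie_add_scalar X _
    rw [h1]
    refine ⟨⟨h2.1, ?_⟩, ?_⟩
    · change lg _ ∈ V ∩ _
      rw [h2.2]
      refine ⟨hXV, ?_⟩
      change toLie _ ∈ B
      rwa [h3]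
    · change toLie (lg _) = X
      rw [h2.2, h3]
  · rintro α ⟨hα1, hα2, hα3⟩
    refine ⟨hα3, ?_⟩
    set u := implement α with hu
    set Y := lg u with hY
    have hexp : exp Y = u := (hTS u hα1).2
    obtain ⟨-, hY2, hY3⟩ := hV Y hα2
    have hs := star_implement_mul α
    rw [← hu] at hs
    have hunit : IsUnit u := hexp ▸ isUnit_exp Y
    have hs0 : ‖u (e0 N)‖ ^ 2 ≠ 0 := by
      intro h
      have h1 : u (e0 N) = 0 := by simpa using h
      obtain ⟨w, hw⟩ := hunit.exists_left_inv
      have h2 := congrArg (fun a : MatAlg N => a (e0 N)) hw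
      simp only [mul_apply, h1, one_apply] at h2
      rw [← h2, ← zero_smul ℂ (0 : Cvec N), map_smul', zero_smul] at hnorm0
      simp at hnorm0
    have hspos : 0 < ‖u (e0 N)‖ ^ 2 := lt_of_le_of_ne (by positivity) (Ne.symm hs0)
    have hkey : exp (-star Y) = exp (Y - (r Y : ℂ) • 1) := by
      have h1 : exp (-star Y) * (star u * u) = u := by
        rw [← hexp, star_exp, ← mul_assoc, ← exp_add_of_commute (Commute.refl (star Y)).neg_left]
        simp
      rw [hs, mul_smul_comm, mul_one] at h1
      rw [sub_eq_add_neg, ← neg_smul, exp_add_scalar, hexp, ← Complex.ofReal_neg,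
        ← Complex.ofReal_exp, Real.exp_neg, Real.exp_log (by rw [hexp]; exact hspos), hexp]
      generalize hsdef : ‖u (e0 N)‖ ^ 2 = s at h1 hs0
      rw [← h1]
      rw [smul_smul, ← Complex.ofReal_mul, inv_mul_cancel₀ hs0]
      simp
    have hkey2 : -star Y = Y - (r Y : ℂ) • 1 := by
      rw [← (hST _ hY2).2, hkey, (hST _ hY3).2]
    obtain ⟨k, hk⟩ := exists_eq_toLie_add hkey2
    have hu2 : u = Complex.exp k • exp (toLie Y : MatAlg N) := by
      rw [← hexp, ← exp_add_scalar, ← hk]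
    have hunitary := exp_mem_unitary_of_mem_skewAdjoint (skewAdjoint.mem_iff.2 (toLie Y).2.1)
    apply StarAlgEquiv.ext
    intro a
    have h4 := map_mul_implement α a
    rw [← hu, hu2, mul_smul_comm, smul_mul_assoc] at h4
    have h5 := smul_right_injective (MatAlg N) (Complex.exp_ne_zero k) h4
    change conjExp (toLie Y) a = α a
    rw [conjExp_apply, ← h5, mul_assoc, (Unitary.mem_iff.1 hunitary).2, mul_one]

end MatAlg

/-- A star Azumaya bundle on `Z` with fibres `N × N` matrix algebras: a smooth complex vector bundle
whose fibres are star algebras, which is locally, by smooth frames, isomorphic to the trivial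
bundle of matrix algebras.  (In `locTriv` only the values of `φ` on `O` matter.) -/
structure AzumayaBundle (N d : ℕ) (Z : Type u) [TopologicalSpace Z]
    [ChartedSpace (EuclideanSpace ℝ (Fin d)) Z] where
  rank : ℕ
  Fib : Z → Type v
  [ring : ∀ z, Ring (Fib z)]
  [algebra : ∀ z, Algebra ℂ (Fib z)]
  [starRing : ∀ z, StarRing (Fib z)]
  [topFib : ∀ z, TopologicalSpace (Fib z)]
  [topTotal : TopologicalSpace (TotalSpace (Cvec rank) Fib)]
  [fiberBundle : FiberBundle (Cvec rank) Fib]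
  [vectorBundle : VectorBundle ℂ (Cvec rank) Fib]
  [vectorBundleReal : VectorBundle ℝ (Cvec rank) Fib]
  [smooth : ContMDiffVectorBundle ∞ (Cvec rank) Fib (𝓡 d)]
  locTriv : ∀ z, ∃ (O : Set Z) (φ : ∀ y, Fib y ≃⋆ₐ[ℂ] MatAlg N), IsOpen O ∧ z ∈ O ∧
    ∀ a : MatAlg N, ContMDiffOn (𝓡 d) ((𝓡 d).prod 𝓘(ℝ, Cvec rank)) ∞
      (fun y => (⟨y, (φ y).symm a⟩ : TotalSpace (Cvec rank) Fib)) O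

namespace AzumayaBundle

attribute [instance] ring algebra starRing topFib topTotal fiberBundle vectorBundle
  vectorBundleReal smooth

variable {N d : ℕ} {Z : Type u} [TopologicalSpace Z] [ChartedSpace (EuclideanSpace ℝ (Fin d)) Z]
  (A : AzumayaBundle.{u, v} N d Z)

/-- The total space of an Azumaya bundle, a manifold. -/
abbrev Total : Type (max u v) := TotalSpace (Cvec A.rank) A.Fib

/-- The model of the total space of an Azumaya bundle. -/
abbrev totalModel : ModelWithCorners ℝ (EuclideanSpace ℝ (Fin d) × Cvec A.rank)
    (ModelProd (EuclideanSpace ℝ (Fin d)) (Cvec A.rank)) := (𝓡 d).prod 𝓘(ℝ, Cvec A.rank)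

/-- The bundle `𝒫` of trivializations of `A`: a point over `z` is a star algebra isomorphism of the
fibre at `z` with the matrix algebra. -/
@[ext] structure Triv where
  base : Z
  iso : A.Fib base ≃⋆ₐ[ℂ] MatAlg N

/-- A smooth trivialization of an Azumaya bundle over an open set. -/
structure LocalTriv where
  O : Set Z
  iso : ∀ y, A.Fib y ≃⋆ₐ[ℂ] MatAlg N
  isOpen : IsOpen O
  smooth : ∀ a : MatAlg N, ContMDiffOn (𝓡 d) A.totalModel ∞
    (fun y => (⟨y, (iso y).symm a⟩ : A.Total)) O

variable {A}

namespace LocalTriv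

section

variable {E' H' X : Type*} [NormedAddCommGroup E'] [NormedSpace ℝ E'] [TopologicalSpace H']
  {I' : ModelWithCorners ℝ E' H'} [TopologicalSpace X] [ChartedSpace H' X]

/-- The matrix of a local trivialization of algebras in terms of a local trivialization of vector
bundles. -/
def mat (τ : A.LocalTriv) (y₀ y : Z) : MatAlg N →L[ℂ] Cvec A.rank :=
  LinearMap.toContinuousLinearMap
    ((((trivializationAt (Cvec A.rank) A.Fib y₀).continuousLinearMapAt ℂ y :
      A.Fib y →L[ℂ] Cvec A.rank) : A.Fib y →ₗ[ℂ] Cvec A.rank) ∘ₗ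
      (τ.iso y).symm.toAlgEquiv.toLinearMap)

theorem mat_apply (τ : A.LocalTriv) {y₀ y : Z}
    (hy : y ∈ (trivializationAt (Cvec A.rank) A.Fib y₀).baseSet) (a : MatAlg N) :
    τ.mat y₀ y a = (trivializationAt (Cvec A.rank) A.Fib y₀ ⟨y, (τ.iso y).symm a⟩).2 := by
  change (trivializationAt (Cvec A.rank) A.Fib y₀).continuousLinearMapAt ℂ y _ = _
  rw [Bundle.Trivialization.continuousLinearMapAt_apply,
    Bundle.Trivialization.linearMapAt_apply, if_pos hy]
  rfl

theorem mat_isInvertible (τ : A.LocalTriv) {y₀ y : Z}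
    (hy : y ∈ (trivializationAt (Cvec A.rank) A.Fib y₀).baseSet) :
    ∃ e : MatAlg N ≃L[ℂ] Cvec A.rank, (e : MatAlg N →L[ℂ] Cvec A.rank) = τ.mat y₀ y := by
  let e₁ : MatAlg N ≃ₗ[ℂ] Cvec A.rank := (τ.iso y).symm.toAlgEquiv.toLinearEquiv.trans
    ((trivializationAt (Cvec A.rank) A.Fib y₀).continuousLinearEquivAt ℂ y hy).toLinearEquiv
  refine ⟨e₁.toContinuousLinearEquiv, ?_⟩
  ext1 a
  rw [mat_apply τ hy]
  rfl

theorem contMDiffAt_mat (τ : A.LocalTriv) {z : X → Z} {x₀ : X}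
    (hz : ContMDiffAt I' (𝓡 d) ∞ z x₀) (h : z x₀ ∈ τ.O) :
    ContMDiffAt I' 𝓘(ℝ, MatAlg N →L[ℂ] Cvec A.rank) ∞ (fun x => τ.mat (z x₀) (z x)) x₀ := by
  let b := Module.finBasis ℂ (MatAlg N)
  let c : ∀ i, MatAlg N →L[ℂ] ℂ := fun i => LinearMap.toContinuousLinearMap (b.coord i)
  have key : ∀ f : MatAlg N →L[ℂ] Cvec A.rank,
      f = ∑ i, ContinuousLinearMap.smulRightL ℂ (MatAlg N) (Cvec A.rank) (c i) (f (b i)) := by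
    intro f
    ext1 a
    have h1 := congrArg f (b.sum_repr a)
    rw [map_sum] at h1
    simp only [map_smul] at h1
    rw [← h1]
    simp [c]
  have hb : ∀ᶠ x in 𝓝 x₀, z x ∈ (trivializationAt (Cvec A.rank) A.Fib (z x₀)).baseSet :=
    hz.continuousAt.eventually ((trivializationAt (Cvec A.rank) A.Fib (z x₀)).open_baseSet.mem_nhds
      (FiberBundle.mem_baseSet_trivializationAt' (z x₀)))
  have h1 : ∀ i, ContMDiffAt I' 𝓘(ℝ, Cvec A.rank) ∞ (fun x => τ.mat (z x₀) (z x) (b i)) x₀ := by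
    intro i
    have h2 : ContMDiffAt I' A.totalModel ∞
        (fun x => (⟨z x, (τ.iso (z x)).symm (b i)⟩ : A.Total)) x₀ :=
      ContMDiffAt.comp x₀ (g := fun y => (⟨y, (τ.iso y).symm (b i)⟩ : A.Total))
        ((τ.smooth (b i)).contMDiffAt (τ.isOpen.mem_nhds h)) hz
    refine (Bundle.contMDiffAt_totalSpace.1 h2).2.congr_of_eventuallyEq ?_
    filter_upwards [hb] with x hx
    exact mat_apply τ hx _
  have h3 : (fun x => τ.mat (z x₀) (z x)) = fun x => ∑ i,
      ((ContinuousLinearMap.smulRightL ℂ (MatAlg N) (Cvec A.rank) (c i)).restrictScalars ℝ)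
        (τ.mat (z x₀) (z x) (b i)) := by
    funext x; exact key _
  rw [h3]
  refine ContMDiffAt.sum fun i _ => ?_
  exact (ContinuousLinearMap.contMDiff _).contMDiffAt.comp x₀ (h1 i)

/-- A family of elements of the fibres is smooth if and only if its coordinates are. -/
theorem contMDiffAt_iff (τ : A.LocalTriv) {s : X → A.Total} {x₀ : X} (h : (s x₀).proj ∈ τ.O) :
    ContMDiffAt I' A.totalModel ∞ s x₀ ↔
      ContMDiffAt I' (𝓡 d) ∞ (fun x => (s x).proj) x₀ ∧
        ContMDiffAt I' 𝓘(ℝ, MatAlg N) ∞ (fun x => τ.iso (s x).proj (s x).2) x₀ := by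
  rw [Bundle.contMDiffAt_totalSpace]
  refine and_congr_right fun hz => ?_
  have hm := τ.contMDiffAt_mat hz h
  have hb : ∀ᶠ x in 𝓝 x₀, (s x).proj ∈
      (trivializationAt (Cvec A.rank) A.Fib (s x₀).proj).baseSet :=
    hz.continuousAt.eventually
      ((trivializationAt (Cvec A.rank) A.Fib (s x₀).proj).open_baseSet.mem_nhds
        (FiberBundle.mem_baseSet_trivializationAt' (s x₀).proj))
  have hval : ∀ x, (s x).proj ∈ (trivializationAt (Cvec A.rank) A.Fib (s x₀).proj).baseSet →
      τ.mat (s x₀).proj (s x).proj (τ.iso (s x).proj (s x).2)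
        = (trivializationAt (Cvec A.rank) A.Fib (s x₀).proj (s x)).2 := by
    intro x hx
    rw [mat_apply τ hx, StarAlgEquiv.symm_apply_apply]
  have happ : ∀ {V W : Type} [NormedAddCommGroup V] [NormedSpace ℂ V] [NormedAddCommGroup W]
      [NormedSpace ℂ W] {f : X → V →L[ℂ] W} {g : X → V},
      ContMDiffAt I' 𝓘(ℝ, V →L[ℂ] W) ∞ f x₀ → ContMDiffAt I' 𝓘(ℝ, V) ∞ g x₀ →
      ContMDiffAt I' 𝓘(ℝ, W) ∞ (fun x => f x (g x)) x₀ := by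
    intro V W _ _ _ _ f g hf hg
    have hB : ContDiff ℝ ∞ (fun p : (V →L[ℂ] W) × V => p.1 p.2) :=
      (isBoundedBilinearMap_apply (𝕜 := ℂ) (E := V) (F := W)).contDiff.restrict_scalars ℝ
    exact hB.contMDiff.contMDiffAt.comp x₀ (hf.prodMk_space hg)
  constructor
  · intro hs
    obtain ⟨e, he⟩ := τ.mat_isInvertible (FiberBundle.mem_baseSet_trivializationAt' (s x₀).proj)
    have hinv : ContMDiffAt I' 𝓘(ℝ, Cvec A.rank →L[ℂ] MatAlg N) ∞
        (fun x => (τ.mat (s x₀).proj (s x).proj).inverse) x₀ := by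
      have h1 : ContDiffAt ℝ ∞ (ContinuousLinearMap.inverse :
          (MatAlg N →L[ℂ] Cvec A.rank) → _) (τ.mat (s x₀).proj (s x₀).proj) := by
        rw [← he]
        exact (contDiffAt_map_inverse e).restrict_scalars ℝ
      exact ContMDiffAt.comp x₀ (g := (ContinuousLinearMap.inverse :
          (MatAlg N →L[ℂ] Cvec A.rank) → _)) h1.contMDiffAt hm
    refine (happ hinv hs).congr_of_eventuallyEq ?_
    filter_upwards [hb] with x hx
    obtain ⟨e', he'⟩ := τ.mat_isInvertible hx
    rw [← hval x hx, ← he', ContinuousLinearMap.inverse_equiv]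
    simp
  · intro hs
    refine (happ hm hs).congr_of_eventuallyEq ?_
    filter_upwards [hb] with x hx
    exact (hval x hx).symm

end

end LocalTriv

section atlas

variable {E' H' X : Type*} [NormedAddCommGroup E'] [NormedSpace ℝ E'] [TopologicalSpace H']
  {I' : ModelWithCorners ℝ E' H'} [TopologicalSpace X] [ChartedSpace H' X]

/-- The position of a point of `𝒫` relative to a local trivialization. -/
def LocalTriv.rel (τ : A.LocalTriv) (p : A.Triv) : MatAlg N ≃⋆ₐ[ℂ] MatAlg N :=
  p.iso.symm.trans (τ.iso p.base)

/-- A family of points of `𝒫` depends smoothly on the parameter if the base point and all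
elements of the fibre that correspond to a fixed matrix do. -/
def SmoothFamilyAt (I' : ModelWithCorners ℝ E' H') (f : X → A.Triv) (x₀ : X) : Prop :=
  ∀ a : MatAlg N, ContMDiffAt I' A.totalModel ∞
    (fun x => (⟨(f x).base, (f x).iso.symm a⟩ : A.Total)) x₀

theorem SmoothFamilyAt.base {f : X → A.Triv} {x₀ : X} (hf : SmoothFamilyAt I' f x₀) :
    ContMDiffAt I' (𝓡 d) ∞ (fun x => (f x).base) x₀ :=
  (Bundle.contMDiffAt_totalSpace.1 (hf 0)).1

theorem contMDiffAt_apply {m : X → MatAlg N} {x₀ : X}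
    (hm : ContMDiffAt I' 𝓘(ℝ, MatAlg N) ∞ m x₀) (v : Cvec N) :
    ContMDiffAt I' 𝓘(ℝ, Cvec N) ∞ (fun x => m x v) x₀ :=
  ((LinearMap.toContinuousLinearMap (MatAlg.evalL v)).restrictScalars ℝ).contMDiff.contMDiffAt.comp
    x₀ hm

theorem exists_localTriv (p : A.Triv) : ∃ τ : A.LocalTriv, p.base ∈ τ.O ∧ τ.iso p.base = p.iso := by
  obtain ⟨O, φ, hO, hz, hφ⟩ := A.locTriv p.base
  refine ⟨⟨O, fun y => (φ y).trans ((φ p.base).symm.trans p.iso), hO, fun a => ?_⟩, hz, ?_⟩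
  · exact hφ (((φ p.base).symm.trans p.iso).symm a)
  · ext a
    simp

variable [NeZero N]

theorem SmoothFamilyAt.implement {f : X → A.Triv} {x₀ : X} (hf : SmoothFamilyAt I' f x₀)
    (τ : A.LocalTriv) (h : (f x₀).base ∈ τ.O) :
    ContMDiffAt I' 𝓘(ℝ, MatAlg N) ∞ (fun x => MatAlg.implement (τ.rel (f x))) x₀ := by
  refine ContMDiffAt.sum fun i _ => ?_
  refine ((LinearMap.toContinuousLinearMap (MatAlg.rankOneL (EuclideanSpace.single i (1 : ℂ)) :
    Cvec N →ₗ[ℂ] MatAlg N)).restrictScalars ℝ).contMDiff.contMDiffAt.comp x₀ ?_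
  exact contMDiffAt_apply ((τ.contMDiffAt_iff h).1 (hf _)).2 _

variable (N) in
/-- The domain of the coordinates on the automorphism group of the matrix algebra. -/
def autDom : Set (MatAlg N) := (MatAlg.exists_chart N).choose

variable (N) in
/-- The range of the coordinates on the automorphism group of the matrix algebra. -/
def autRange : Set (MatAlg.liePU N) := (MatAlg.exists_chart N).choose_spec.choose

/-- Coordinates on the automorphism group of the matrix algebra near the identity. -/
def autCoord : MatAlg N → MatAlg.liePU N := (MatAlg.exists_chart N).choose_spec.choose_spec.choose

theorem aut_spec : IsOpen (autDom N) ∧ IsOpen (autRange N) ∧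
    ContDiffOn ℝ ∞ autCoord (autDom N) ∧ (1 : MatAlg N) ∈ autDom N ∧
      (∀ Y ∈ autRange N, MatAlg.implement (MatAlg.conjExp Y) ∈ autDom N ∧
        autCoord (MatAlg.implement (MatAlg.conjExp Y)) = Y) ∧
      ∀ α : MatAlg N ≃⋆ₐ[ℂ] MatAlg N, MatAlg.implement α ∈ autDom N →
        autCoord (MatAlg.implement α) ∈ autRange N ∧
          MatAlg.conjExp (autCoord (MatAlg.implement α)) = α :=
  (MatAlg.exists_chart N).choose_spec.choose_spec.choose_spec

variable (N d) in
/-- The model space of `𝒫`. -/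
abbrev TrivModel : Type := EuclideanSpace ℝ (Fin d) × MatAlg.liePU N

/-- The chart of `𝒫` given by a local trivialization of `A` and a chart of `Z`. -/
def trivChart (τ : A.LocalTriv) (e : OpenPartialHomeomorph Z (EuclideanSpace ℝ (Fin d))) :
    PartialEquiv A.Triv (TrivModel N d) where
  toFun p := (e p.base, autCoord (MatAlg.implement (τ.rel p)))
  invFun y := ⟨e.symm y.1, (τ.iso (e.symm y.1)).trans (MatAlg.conjExp y.2).symm⟩
  source := {p | p.base ∈ τ.O ∧ p.base ∈ e.source ∧ MatAlg.implement (τ.rel p) ∈ autDom N}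
  target := {y | y.1 ∈ e.target ∧ e.symm y.1 ∈ τ.O ∧ y.2 ∈ autRange N}
  map_source' := by
    rintro p ⟨h1, h2, h3⟩
    refine ⟨e.map_source h2, ?_, (aut_spec.2.2.2.2.2 _ h3).1⟩
    simpa only [e.left_inv h2] using h1
  map_target' := by
    rintro y ⟨h1, h2, h3⟩
    refine ⟨h2, e.map_target h1, ?_⟩
    have : τ.rel (⟨e.symm y.1, (τ.iso (e.symm y.1)).trans (MatAlg.conjExp y.2).symm⟩ : A.Triv)
        = MatAlg.conjExp y.2 := by
      ext a; simp [LocalTriv.rel]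
    rw [this]
    exact (aut_spec.2.2.2.2.1 _ h3).1
  left_inv' := by
    rintro ⟨z, p⟩ ⟨h1, h2, h3⟩
    have h4 : e.symm (e z) = z := e.left_inv h2
    have h5 := (aut_spec.2.2.2.2.2 _ h3).2
    simp only
    rw [h5]
    have : ∀ z', z' = z → (⟨z', (τ.iso z').trans (τ.rel ⟨z, p⟩).symm⟩ : A.Triv) = ⟨z, p⟩ := by
      intro z' hz
      subst hz
      congr 1
      apply StarAlgEquiv.ext
      intro a
      change p ((τ.iso z').symm (τ.iso z' a)) = p a
      rw [StarAlgEquiv.symm_apply_apply]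
    exact this _ h4
  right_inv' := by
    rintro y ⟨h1, h2, h3⟩
    have : τ.rel (⟨e.symm y.1, (τ.iso (e.symm y.1)).trans (MatAlg.conjExp y.2).symm⟩ : A.Triv)
        = MatAlg.conjExp y.2 := by
      ext a; simp [LocalTriv.rel]
    simp only
    rw [this, (aut_spec.2.2.2.2.1 _ h3).2, e.right_inv h1]

theorem isOpen_trivChart_target (τ : A.LocalTriv)
    (e : OpenPartialHomeomorph Z (EuclideanSpace ℝ (Fin d))) : IsOpen (trivChart τ e).target := by
  have h : (trivChart τ e).target = (e.target ∩ e.symm ⁻¹' τ.O) ×ˢ autRange N := by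
    ext y; simp [trivChart, and_assoc]
  rw [h]
  exact (e.isOpen_inter_preimage_symm τ.isOpen).prod aut_spec.2.1

theorem mem_trivChart_source (p : A.Triv) :
    p ∈ (trivChart (exists_localTriv p).choose
      (chartAt (EuclideanSpace ℝ (Fin d)) p.base)).source := by
  obtain ⟨h1, h2⟩ := (exists_localTriv p).choose_spec
  refine ⟨h1, mem_chart_source _ _, ?_⟩
  have : (exists_localTriv p).choose.rel p = StarAlgEquiv.refl ℂ (MatAlg N) := by
    ext a
    simp [LocalTriv.rel, h2]
  rw [this, MatAlg.implement_refl]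
  exact aut_spec.2.2.2.1

variable [IsManifold (𝓡 d) ∞ Z]

theorem SmoothFamilyAt.chart {f : X → A.Triv} {x₀ : X} (hf : SmoothFamilyAt I' f x₀)
    (τ : A.LocalTriv) {e : OpenPartialHomeomorph Z (EuclideanSpace ℝ (Fin d))}
    (he : e ∈ atlas (EuclideanSpace ℝ (Fin d)) Z) (h : f x₀ ∈ (trivChart τ e).source) :
    (∀ᶠ x in 𝓝 x₀, f x ∈ (trivChart τ e).source) ∧
      ContMDiffAt I' 𝓘(ℝ, TrivModel N d) ∞ (fun x => trivChart τ e (f x)) x₀ := by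
  obtain ⟨h1, h2, h3⟩ := h
  have hi := hf.implement τ h1
  have hb := hf.base
  refine ⟨?_, ?_⟩
  · filter_upwards [hb.continuousAt.eventually (τ.isOpen.mem_nhds h1),
      hb.continuousAt.eventually (e.open_source.mem_nhds h2),
      hi.continuousAt.eventually (aut_spec.1.mem_nhds h3)] with x a b c
    exact ⟨a, b, c⟩
  · have hc : ContMDiffAt I' 𝓘(ℝ, MatAlg.liePU N) ∞
        (fun x => autCoord (MatAlg.implement (τ.rel (f x)))) x₀ :=
      ContMDiffAt.comp x₀ (g := autCoord)
        (aut_spec.2.2.1.contDiffAt (aut_spec.1.mem_nhds h3)).contMDiffAt hi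
    have he' : ContMDiffAt I' (𝓡 d) ∞ (fun x => e (f x).base) x₀ :=
      ContMDiffAt.comp x₀ (g := e)
        (contMDiffAt_of_mem_maximalAtlas (IsManifold.subset_maximalAtlas he) h2) hb
    exact he'.prodMk_space hc

theorem smoothFamilyAt_symm (τ : A.LocalTriv)
    {e : OpenPartialHomeomorph Z (EuclideanSpace ℝ (Fin d))}
    (he : e ∈ atlas (EuclideanSpace ℝ (Fin d)) Z) {y : TrivModel N d}
    (hy : y ∈ (trivChart τ e).target) :
    SmoothFamilyAt 𝓘(ℝ, TrivModel N d) (trivChart τ e).symm y := by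
  intro a
  obtain ⟨h1, h2, h3⟩ := hy
  refine (τ.contMDiffAt_iff (by exact h2)).2 ⟨?_, ?_⟩
  · exact ContMDiffAt.comp y (g := e.symm) (f := Prod.fst) (I' := 𝓡 d)
      (contMDiffAt_symm_of_mem_maximalAtlas (IsManifold.subset_maximalAtlas he) h1)
      contDiff_fst.contMDiff.contMDiffAt
  · have hexp : ContDiff ℝ ∞ (fun Y : TrivModel N d => NormedSpace.exp (Y.2 : MatAlg N)) := by
      have h1 : ContDiff ℝ ∞ (NormedSpace.exp : MatAlg N → MatAlg N) :=
        contDiff_iff_contDiffAt.2 fun x => (NormedSpace.exp_analytic (𝕂 := ℝ) x).contDiffAt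
      exact h1.comp ((MatAlg.liePU N).subtypeL.contDiff.comp contDiff_snd)
    have hstar : ContDiff ℝ ∞ (fun Y : TrivModel N d => star (NormedSpace.exp (Y.2 : MatAlg N))) :=
      (starL' ℝ : MatAlg N ≃L[ℝ] MatAlg N).contDiff.comp hexp
    have h5 : ContDiff ℝ ∞ (fun Y : TrivModel N d => MatAlg.conjExp Y.2 a) :=
      (hexp.mul contDiff_const).mul hstar
    refine h5.contMDiff.contMDiffAt.congr_of_eventuallyEq (Filter.Eventually.of_forall fun Y => ?_)
    change τ.iso _ ((τ.iso _).symm (MatAlg.conjExp Y.2 a)) = _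
    rw [StarAlgEquiv.apply_symm_apply]

theorem trivChart_trans (τ τ' : A.LocalTriv)
    {e e' : OpenPartialHomeomorph Z (EuclideanSpace ℝ (Fin d))}
    (he : e ∈ atlas (EuclideanSpace ℝ (Fin d)) Z) (he' : e' ∈ atlas (EuclideanSpace ℝ (Fin d)) Z) :
    IsOpen ((trivChart τ e).symm.trans (trivChart τ' e')).source ∧
      ContDiffOn ℝ ∞ ((trivChart τ e).symm.trans (trivChart τ' e'))
        ((trivChart τ e).symm.trans (trivChart τ' e')).source := by
  have key : ∀ y ∈ ((trivChart τ e).symm.trans (trivChart τ' e')).source,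
      (∀ᶠ x in 𝓝 y, (trivChart τ e).symm x ∈ (trivChart τ' e').source) ∧
      ContMDiffAt 𝓘(ℝ, TrivModel N d) 𝓘(ℝ, TrivModel N d) ∞
        (fun x => trivChart τ' e' ((trivChart τ e).symm x)) y := by
    intro y hy
    exact (smoothFamilyAt_symm τ he hy.1).chart τ' he' hy.2
  constructor
  · rw [isOpen_iff_mem_nhds]
    intro y hy
    filter_upwards [(key y hy).1, (isOpen_trivChart_target τ e).mem_nhds hy.1] with x h1 h2
    exact ⟨h2, h1⟩
  · intro y hy
    exact (contMDiffAt_iff_contDiffAt.1 (key y hy).2).contDiffWithinAt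

variable (A) in
/-- The atlas of `𝒫`. -/
def trivCore : ChartedSpaceCore (TrivModel N d) A.Triv where
  atlas := {c | ∃ (τ : A.LocalTriv) (e : OpenPartialHomeomorph Z (EuclideanSpace ℝ (Fin d))),
    e ∈ atlas (EuclideanSpace ℝ (Fin d)) Z ∧ c = trivChart τ e}
  chartAt p := trivChart (exists_localTriv p).choose (chartAt (EuclideanSpace ℝ (Fin d)) p.base)
  mem_chart_source := mem_trivChart_source
  chart_mem_atlas p := ⟨_, _, chart_mem_atlas _ _, rfl⟩
  open_source := by
    rintro _ _ ⟨τ, e, he, rfl⟩ ⟨τ', e', he', rfl⟩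
    exact (trivChart_trans τ τ' he he').1
  continuousOn_toFun := by
    rintro _ _ ⟨τ, e, he, rfl⟩ ⟨τ', e', he', rfl⟩
    exact (trivChart_trans τ τ' he he').2.continuousOn

instance : TopologicalSpace A.Triv := A.trivCore.toTopologicalSpace

instance : ChartedSpace (TrivModel N d) A.Triv := A.trivCore.toChartedSpace

theorem mem_atlas_triv {c : OpenPartialHomeomorph A.Triv (TrivModel N d)}
    (hc : c ∈ atlas (TrivModel N d) A.Triv) :
    ∃ (τ : A.LocalTriv) (e : OpenPartialHomeomorph Z (EuclideanSpace ℝ (Fin d))),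
      e ∈ atlas (EuclideanSpace ℝ (Fin d)) Z ∧ c.toPartialEquiv = trivChart τ e := by
  obtain ⟨c', ⟨c'', rfl⟩, h⟩ := hc
  simp only [mem_iUnion, mem_singleton_iff] at h
  obtain ⟨⟨τ, e, he, rfl⟩, rfl⟩ := h
  exact ⟨τ, e, he, rfl⟩

instance : IsManifold 𝓘(ℝ, TrivModel N d) ∞ A.Triv := by
  refine isManifold_of_contDiffOn _ _ _ fun c c' hc hc' => ?_
  obtain ⟨τ, e, he, h⟩ := mem_atlas_triv hc
  obtain ⟨τ', e', he', h'⟩ := mem_atlas_triv hc'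
  have h2 := (trivChart_trans τ τ' he he').2
  rw [← h, ← h'] at h2
  simpa using h2

/-- The smooth structure of `𝒫` is the one for which smooth maps into `𝒫` are the same as smooth
families of trivializations of fibres of `A`. -/
theorem contMDiffAt_triv_iff {f : X → A.Triv} {x₀ : X} :
    ContMDiffAt I' 𝓘(ℝ, TrivModel N d) ∞ f x₀ ↔ SmoothFamilyAt I' f x₀ := by
  have hc := chart_mem_atlas (TrivModel N d) (f x₀)
  obtain ⟨τ, e, he, h⟩ := mem_atlas_triv hc
  have hs : f x₀ ∈ (chartAt (TrivModel N d) (f x₀)).source := mem_chart_source _ _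
  have hcoe : ∀ p, chartAt (TrivModel N d) (f x₀) p = trivChart τ e p := fun p =>
    congrFun (congrArg (fun c : PartialEquiv A.Triv (TrivModel N d) => (c : A.Triv → _)) h) p
  have hcoes : ∀ p, (chartAt (TrivModel N d) (f x₀)).symm p = (trivChart τ e).symm p := fun p =>
    congrFun (congrArg (fun c : PartialEquiv A.Triv (TrivModel N d) => (c.symm : _ → A.Triv)) h) p
  have hsrc : (chartAt (TrivModel N d) (f x₀)).source = (trivChart τ e).source :=
    congrArg PartialEquiv.source h
  constructor
  · intro hf a
    have h1 : ContMDiffAt I' 𝓘(ℝ, TrivModel N d) ∞ (fun x => trivChart τ e (f x)) x₀ := by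
      have := (contMDiffAt_iff_target.1 hf).2
      refine this.congr_of_eventuallyEq (Filter.Eventually.of_forall fun x => ?_)
      simp [hcoe]
    have hs' : f x₀ ∈ (trivChart τ e).source := hsrc ▸ hs
    have h2 := smoothFamilyAt_symm τ he ((trivChart τ e).map_source hs') a
    have h3 := ContMDiffAt.comp x₀ (f := fun x => trivChart τ e (f x))
      (g := fun y => (⟨((trivChart τ e).symm y).base, ((trivChart τ e).symm y).iso.symm a⟩ :
        A.Total)) h2 h1
    refine h3.congr_of_eventuallyEq ?_
    filter_upwards [hf.continuousAt.eventually
      ((chartAt (TrivModel N d) (f x₀)).open_source.mem_nhds hs)] with x hx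
    rw [hsrc] at hx
    simp only [Function.comp_apply]
    rw [(trivChart τ e).left_inv hx]
  · intro hf
    obtain ⟨h1, h2⟩ := hf.chart τ he (hsrc ▸ hs)
    have h3 : ContMDiffAt I' 𝓘(ℝ, TrivModel N d) ∞
        (extChartAt 𝓘(ℝ, TrivModel N d) (f x₀) ∘ f) x₀ := by
      refine h2.congr_of_eventuallyEq (Filter.Eventually.of_forall fun x => ?_)
      simp [hcoe]
    refine contMDiffAt_iff_target.2 ⟨?_, h3⟩
    refine ((chartAt (TrivModel N d) (f x₀)).continuousAt_iff_continuousAt_comp_left ?_).2 ?_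
    · rw [hsrc]; exact h1
    · have := h2.continuousAt
      refine this.congr (Filter.Eventually.of_forall fun x => ?_)
      simp [hcoe]

end atlas

section smoothAlong

variable {E' H' X : Type*} [NormedAddCommGroup E'] [NormedSpace ℝ E'] [TopologicalSpace H']
  {I' : ModelWithCorners ℝ E' H'} [TopologicalSpace X] [ChartedSpace H' X]

theorem SmoothFamilyAt.symm_apply {f : X → A.Triv} {x₀ : X} (hf : SmoothFamilyAt I' f x₀)
    {m : X → MatAlg N} (hm : ContMDiffAt I' 𝓘(ℝ, MatAlg N) ∞ m x₀) :
    ContMDiffAt I' A.totalModel ∞ (fun x => (⟨(f x).base, (f x).iso.symm (m x)⟩ : A.Total)) x₀ := by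
  obtain ⟨τ, h, -⟩ := exists_localTriv (f x₀)
  refine (τ.contMDiffAt_iff (by exact h)).2 ⟨hf.base, ?_⟩
  let b := Module.finBasis ℂ (MatAlg N)
  let c : ∀ i, MatAlg N →L[ℂ] ℂ := fun i => LinearMap.toContinuousLinearMap (b.coord i)
  have h3 : (fun x => τ.iso (f x).base ((f x).iso.symm (m x))) = fun x => ∑ i,
      c i (m x) • τ.iso (f x).base ((f x).iso.symm (b i)) := by
    funext x
    conv_lhs => rw [← b.sum_repr (m x)]
    simp only [map_sum, map_smul]
    rfl
  change ContMDiffAt I' 𝓘(ℝ, MatAlg N) ∞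
    (fun x => τ.iso (f x).base ((f x).iso.symm (m x))) x₀
  rw [h3]
  refine ContMDiffAt.sum fun i _ => ?_
  have h4 : ContMDiffAt I' 𝓘(ℝ, ℂ) ∞ (fun x => c i (m x)) x₀ :=
    ((c i).restrictScalars ℝ).contMDiff.contMDiffAt.comp x₀ hm
  have h5 : ContMDiffAt I' 𝓘(ℝ, MatAlg N) ∞
      (fun x => τ.iso (f x).base ((f x).iso.symm (b i))) x₀ :=
    ((τ.contMDiffAt_iff (by exact h)).1 (hf (b i))).2
  have h6 : ContDiff ℝ ∞ (fun q : ℂ × MatAlg N => q.1 • q.2) := contDiff_fst.smul contDiff_snd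
  exact h6.contMDiff.contMDiffAt.comp x₀ (h4.prodMk_space h5)

/-- Points of `𝒫` that depend smoothly on a parameter identify smooth families of elements of the
fibres with smooth families of matrices. -/
theorem SmoothFamilyAt.apply [NeZero N] [IsManifold (𝓡 d) ∞ Z] {f : X → A.Triv} {x₀ : X}
    (hf : SmoothFamilyAt I' f x₀) {s : ∀ x, A.Fib (f x).base}
    (hs : ContMDiffAt I' A.totalModel ∞ (fun x => (⟨(f x).base, s x⟩ : A.Total)) x₀) :
    ContMDiffAt I' 𝓘(ℝ, MatAlg N) ∞ (fun x => (f x).iso (s x)) x₀ := by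
  have h0 := mem_trivChart_source (f x₀)
  set τ := (exists_localTriv (f x₀)).choose
  obtain ⟨h1, h2⟩ := hf.chart τ (chart_mem_atlas _ _) h0
  have h3 := ((τ.contMDiffAt_iff (by exact h0.1)).1 hs).2
  let Y : X → MatAlg.liePU N := fun x => autCoord (MatAlg.implement (τ.rel (f x)))
  have hY : ContMDiffAt I' 𝓘(ℝ, MatAlg.liePU N) ∞ Y x₀ :=
    ContMDiffAt.comp x₀ (g := Prod.snd) (I' := 𝓘(ℝ, TrivModel N d))
      (contDiff_snd (E := EuclideanSpace ℝ (Fin d)) (F := MatAlg.liePU N)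
        (𝕜 := ℝ)).contMDiff.contMDiffAt h2
  have hG : ContDiff ℝ ∞ (fun q : MatAlg.liePU N × MatAlg N =>
      star (NormedSpace.exp (q.1 : MatAlg N)) * q.2 * NormedSpace.exp (q.1 : MatAlg N)) := by
    have h1 : ContDiff ℝ ∞ (NormedSpace.exp : MatAlg N → MatAlg N) :=
      contDiff_iff_contDiffAt.2 fun x => (NormedSpace.exp_analytic (𝕂 := ℝ) x).contDiffAt
    have hexp : ContDiff ℝ ∞ (fun q : MatAlg.liePU N × MatAlg N =>
        NormedSpace.exp (q.1 : MatAlg N)) :=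
      h1.comp ((MatAlg.liePU N).subtypeL.contDiff.comp contDiff_fst)
    exact (((starL' ℝ : MatAlg N ≃L[ℝ] MatAlg N).contDiff.comp hexp).mul contDiff_snd).mul hexp
  refine (hG.contMDiff.contMDiffAt.comp x₀ (hY.prodMk_space h3)).congr_of_eventuallyEq ?_
  filter_upwards [h1] with x hx
  have h5 := (aut_spec.2.2.2.2.2 _ hx.2.2).2
  have h6 : τ.iso (f x).base (s x) = MatAlg.conjExp (Y x) ((f x).iso (s x)) := by
    rw [h5]
    change _ = τ.iso (f x).base ((f x).iso.symm ((f x).iso (s x)))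
    rw [StarAlgEquiv.symm_apply_apply]
  have h7 : star (NormedSpace.exp (Y x : MatAlg N)) * NormedSpace.exp (Y x : MatAlg N) = 1 :=
    MatAlg.star_exp_mul_exp (Y x)
  change _ = star (NormedSpace.exp (Y x : MatAlg N)) * τ.iso (f x).base (s x) *
    NormedSpace.exp (Y x : MatAlg N)
  rw [h6, MatAlg.conjExp_apply, ← mul_assoc, ← mul_assoc, h7, one_mul, mul_assoc, h7, mul_one]

end smoothAlong

end AzumayaBundle

/-- The determinant of a matrix. -/
def MatAlg.det {N : ℕ} (a : MatAlg N) : ℂ :=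
  LinearMap.det (ContinuousLinearMap.toLinearMap (a : Cvec N →L[ℂ] Cvec N))

theorem MatAlg.det_mul {N : ℕ} (a b : MatAlg N) : (a * b).det = a.det * b.det :=
  LinearMap.det_comp (ContinuousLinearMap.toLinearMap (a : Cvec N →L[ℂ] Cvec N))
    (ContinuousLinearMap.toLinearMap (b : Cvec N →L[ℂ] Cvec N))

theorem MatAlg.det_one {N : ℕ} : (1 : MatAlg N).det = 1 := by
  have : ContinuousLinearMap.toLinearMap ((1 : MatAlg N) : Cvec N →L[ℂ] Cvec N)
    = LinearMap.id := rfl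
  rw [MatAlg.det, this, LinearMap.det_id]

/-- The special unitary group. -/
def SU (N : ℕ) : Subgroup (unitary (MatAlg N)) where
  carrier := {u | (u : MatAlg N).det = 1}
  mul_mem' {a b} ha hb := by
    have ha : (a : MatAlg N).det = 1 := ha
    have hb : (b : MatAlg N).det = 1 := hb
    change MatAlg.det ((a * b : unitary (MatAlg N)) : MatAlg N) = 1
    rw [Submonoid.coe_mul, MatAlg.det_mul, ha, hb, one_mul]
  one_mem' := by
    change MatAlg.det ((1 : unitary (MatAlg N)) : MatAlg N) = 1
    rw [Submonoid.coe_one, MatAlg.det_one]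
  inv_mem' {a} ha := by
    have ha : (a : MatAlg N).det = 1 := ha
    have h : ((a⁻¹ : unitary (MatAlg N)) : MatAlg N) * (a : MatAlg N) = 1 := by
      rw [← Submonoid.coe_mul, inv_mul_cancel, Submonoid.coe_one]
    have h2 := congrArg MatAlg.det h
    rw [MatAlg.det_mul, MatAlg.det_one, ha, mul_one] at h2
    exact h2

/-- An element of the special unitary group as a matrix. -/
def SU.mat {N : ℕ} (g : SU N) : MatAlg N := ((g : unitary (MatAlg N)) : MatAlg N)

/-- Conjugation by an element of the special unitary group. -/
def SU.conj {N : ℕ} : SU N →* (MatAlg N ≃⋆ₐ[ℂ] MatAlg N) :=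
  (Unitary.conjStarAlgAut ℂ (MatAlg N)).comp (SU N).subtype

theorem SU.conj_apply {N : ℕ} (g : SU N) (a : MatAlg N) :
    SU.conj g a = SU.mat g * a * star (SU.mat g) := rfl

section bundles

variable {N d : ℕ} {Z : Type u} [TopologicalSpace Z] [ChartedSpace (EuclideanSpace ℝ (Fin d)) Z]

/-- The special unitary group acts on `𝒫` by conjugation of trivializations; this is the principal
action of its quotient `PU(N)`. -/
instance AzumayaBundle.instMulActionTriv (A : AzumayaBundle.{u, v} N d Z) :
    MulAction (SU N) A.Triv where
  smul g p := ⟨p.base, p.iso.trans (SU.conj g)⟩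
  one_smul p := by
    have h : p.iso.trans (SU.conj 1) = p.iso := by
      rw [map_one]
      apply StarAlgEquiv.ext; intro a
      rw [StarAlgEquiv.trans_apply, StarAlgEquiv.one_apply]
    exact congrArg (AzumayaBundle.Triv.mk p.base) h
  mul_smul g h p := by
    have h : p.iso.trans (SU.conj (g * h)) = (p.iso.trans (SU.conj h)).trans (SU.conj g) := by
      rw [map_mul]
      apply StarAlgEquiv.ext; intro a
      rw [StarAlgEquiv.trans_apply, StarAlgEquiv.trans_apply, StarAlgEquiv.trans_apply,
        StarAlgEquiv.mul_apply]
    exact congrArg (AzumayaBundle.Triv.mk p.base) h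

/-- A smooth complex vector bundle of finite rank over a (real) manifold. -/
structure SmoothBundle {E H : Type*} [NormedAddCommGroup E] [NormedSpace ℝ E] [TopologicalSpace H]
    (I : ModelWithCorners ℝ E H) (M : Type*) [TopologicalSpace M] [ChartedSpace H M] where
  rank : ℕ
  Fib : M → Type*
  [addCommGroup : ∀ x, AddCommGroup (Fib x)]
  [module : ∀ x, Module ℂ (Fib x)]
  [topFib : ∀ x, TopologicalSpace (Fib x)]
  [topTotal : TopologicalSpace (TotalSpace (Cvec rank) Fib)]
  [fiberBundle : FiberBundle (Cvec rank) Fib]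
  [vectorBundle : VectorBundle ℂ (Cvec rank) Fib]
  [vectorBundleReal : VectorBundle ℝ (Cvec rank) Fib]
  [smooth : ContMDiffVectorBundle ∞ (Cvec rank) Fib I]

namespace SmoothBundle

attribute [instance] addCommGroup module topFib topTotal fiberBundle vectorBundle
  vectorBundleReal smooth

variable {E H : Type*} [NormedAddCommGroup E] [NormedSpace ℝ E] [TopologicalSpace H]
    {I : ModelWithCorners ℝ E H} {M : Type*} [TopologicalSpace M] [ChartedSpace H M]

/-- A family of elements `v t` of the fibres at `x t`, with `t` in a Euclidean space, is smooth, as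
a map into the total space.

Smoothness of maps between total spaces of bundles, fibre products of such, and the like is
expressed below by saying that smooth families are mapped to smooth families; a map of manifolds
is smooth if and only if its composites with all smooth maps from Euclidean spaces are. -/
def SmoothAlong (V : SmoothBundle I M) {k : ℕ} (x : EuclideanSpace ℝ (Fin k) → M)
    (v : ∀ t, V.Fib (x t)) : Prop :=
  ContMDiff (𝓡 k) (I.prod 𝓘(ℝ, Cvec V.rank)) ∞
    (fun t => (⟨x t, v t⟩ : TotalSpace (Cvec V.rank) V.Fib))

end SmoothBundle

/-- Smooth families of elements of the fibres of an Azumaya bundle. -/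
def AzumayaBundle.SmoothAlong (A : AzumayaBundle.{u, v} N d Z) {k : ℕ}
    (x : EuclideanSpace ℝ (Fin k) → Z) (a : ∀ t, A.Fib (x t)) : Prop :=
  ContMDiff (𝓡 k) A.totalModel ∞ (fun t => (⟨x t, a t⟩ : A.Total))

theorem MatAlg.contDiff_apply {k : ℕ} {m : EuclideanSpace ℝ (Fin k) → MatAlg N}
    {v : EuclideanSpace ℝ (Fin k) → Cvec N} (hm : ContDiff ℝ ∞ m) (hv : ContDiff ℝ ∞ v) :
    ContDiff ℝ ∞ (fun t => m t (v t)) := by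
  have h : ∀ t, m t (v t) = ∑ i : Fin N, v t i • m t (EuclideanSpace.single i (1 : ℂ)) := by
    intro t
    have hv : ∑ i : Fin N, v t i • EuclideanSpace.single i (1 : ℂ) = v t := by
      simpa using (EuclideanSpace.basisFun (Fin N) ℂ).sum_repr (v t)
    conv_lhs => rw [← hv]
    have := map_sum (ContinuousLinearMap.toLinearMap ((m t : MatAlg N) : Cvec N →L[ℂ] Cvec N))
      (fun i => v t i • EuclideanSpace.single i (1 : ℂ)) Finset.univ
    refine this.trans (Finset.sum_congr rfl fun i _ => ?_)
    exact MatAlg.map_smul' (m t) _ _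
  simp_rw [h]
  refine ContDiff.sum fun i _ => ?_
  have h1 : ContDiff ℝ ∞ fun t => v t i :=
    ((EuclideanSpace.proj (𝕜 := ℂ) i).restrictScalars ℝ).contDiff.comp hv
  have h2 : ContDiff ℝ ∞ fun t => m t (EuclideanSpace.single i (1 : ℂ)) :=
    ((LinearMap.toContinuousLinearMap
      (MatAlg.evalL (EuclideanSpace.single i (1 : ℂ)))).restrictScalars ℝ).contDiff.comp hm
  exact h1.smul h2

variable [NeZero N] [IsManifold (𝓡 d) ∞ Z]

/-- A smooth complex vector bundle over `𝒫` with a smooth linear action of `SU(N)` which covers the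
action on `𝒫` and in which the centre of `SU(N)`, i.e. the scalar matrices, acts by scalars. -/
structure EquivariantBundle (A : AzumayaBundle.{u, v} N d Z) extends
    SmoothBundle 𝓘(ℝ, AzumayaBundle.TrivModel N d) A.Triv where
  act : ∀ (g : SU N) (p : A.Triv), Fib p →ₗ[ℂ] Fib (g • p)
  act_one : ∀ (p : A.Triv) (v : Fib p),
    (⟨(1 : SU N) • p, act 1 p v⟩ : TotalSpace (Cvec rank) Fib) = ⟨p, v⟩
  act_mul : ∀ (g h : SU N) (p : A.Triv) (v : Fib p),
    (⟨(g * h) • p, act (g * h) p v⟩ : TotalSpace (Cvec rank) Fib)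
      = ⟨g • h • p, act g (h • p) (act h p v)⟩
  act_smooth : ∀ (k : ℕ) (g : EuclideanSpace ℝ (Fin k) → SU N)
    (p : EuclideanSpace ℝ (Fin k) → A.Triv) (v : ∀ t, Fib (p t)),
    ContDiff ℝ ∞ (fun t => SU.mat (g t)) → toSmoothBundle.SmoothAlong p v →
      toSmoothBundle.SmoothAlong (fun t => g t • p t) (fun t => act (g t) (p t) (v t))
  act_center : ∀ (c : SU N) (ζ : ℂ), SU.mat c = ζ • 1 → ∀ p : A.Triv, ∃ χ : ℂ, ∀ v : Fib p,
    (⟨c • p, act c p v⟩ : TotalSpace (Cvec rank) Fib) = ⟨p, χ • v⟩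

/-- A representing bundle for an Azumaya bundle `A`: an equivariant bundle `V` over `𝒫` with an
isomorphism of bundles of algebras between `A` and `hom(V)`, viewed as a bundle over the base;
so the latter is a smooth family of isomorphisms over `𝒫`, invariant under `SU(N)`. -/
structure RepresentingBundle (A : AzumayaBundle.{u, v} N d Z) extends EquivariantBundle A where
  rep : ∀ p : A.Triv, A.Fib p.base ≃ₐ[ℂ] Module.End ℂ (Fib p)
  rep_smooth : ∀ (k : ℕ) (p : EuclideanSpace ℝ (Fin k) → A.Triv)
    (a : ∀ t, A.Fib (p t).base) (v : ∀ t, Fib (p t)),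
    A.SmoothAlong (fun t => (p t).base) a → toSmoothBundle.SmoothAlong p v →
      toSmoothBundle.SmoothAlong p (fun t => rep (p t) (a t) (v t))
  rep_act : ∀ (g : SU N) (p : A.Triv) (a : A.Fib p.base) (v : Fib p),
    rep (g • p) a (act g p v) = act g p (rep p a v)

/-- A line bundle over `𝒫` with an `SU(N)` action. -/
structure EquivariantLineBundle (A : AzumayaBundle.{u, v} N d Z) extends EquivariantBundle A where
  rank_eq_one : rank = 1


theorem smoothAlong_trivial_iff {E H : Type*} [NormedAddCommGroup E] [NormedSpace ℝ E]
    [TopologicalSpace H] {I : ModelWithCorners ℝ E H} {M : Type*} [TopologicalSpace M]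
    [ChartedSpace H M] {n k : ℕ} {x : EuclideanSpace ℝ (Fin k) → M}
    {v : EuclideanSpace ℝ (Fin k) → Cvec n} :
    ContMDiff (𝓡 k) (I.prod 𝓘(ℝ, Cvec n)) ∞
      (fun t => (⟨x t, v t⟩ : TotalSpace (Cvec n) (Bundle.Trivial M (Cvec n)))) ↔
      ContMDiff (𝓡 k) I ∞ x ∧ ContDiff ℝ ∞ v := by
  rw [← contMDiff_iff_contDiff]
  constructor
  · intro h
    exact ⟨fun t => (Bundle.contMDiffAt_totalSpace.1 (h t)).1,
      fun t => (Bundle.contMDiffAt_totalSpace.1 (h t)).2⟩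
  · rintro ⟨h1, h2⟩ t
    exact Bundle.contMDiffAt_totalSpace.2 ⟨h1 t, h2 t⟩

namespace AzumayaBundle

theorem contMDiff_smul_triv {A : AzumayaBundle.{u, v} N d Z} {k : ℕ}
    {g : EuclideanSpace ℝ (Fin k) → SU N} {p : EuclideanSpace ℝ (Fin k) → A.Triv}
    (hg : ContDiff ℝ ∞ (fun t => SU.mat (g t)))
    (hp : ContMDiff (𝓡 k) 𝓘(ℝ, TrivModel N d) ∞ p) :
    ContMDiff (𝓡 k) 𝓘(ℝ, TrivModel N d) ∞ (fun t => g t • p t) := by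
  intro t
  rw [contMDiffAt_triv_iff]
  intro a
  have hstar : ContDiff ℝ ∞ (fun t => star (SU.mat (g t))) :=
    (starL' ℝ : MatAlg N ≃L[ℝ] MatAlg N).contDiff.comp hg
  have hm : ContDiff ℝ ∞ (fun t => star (SU.mat (g t)) * a * SU.mat (g t)) :=
    (hstar.mul contDiff_const).mul hg
  exact (contMDiffAt_triv_iff.1 (hp t)).symm_apply hm.contMDiff.contMDiffAt

/-- Matrices as endomorphisms. -/
def _root_.MatAlg.toEnd (N : ℕ) : MatAlg N ≃ₐ[ℂ] Module.End ℂ (Cvec N) :=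
  (Module.End.toContinuousLinearMap (𝕜 := ℂ) (Cvec N)).symm

/-- The standard representing bundle: the trivial bundle with fibre `ℂᴺ`, with the standard action
of `SU(N)`, and with `A` acting through its trivializations. -/
def standard (A : AzumayaBundle.{u, v} N d Z) : RepresentingBundle.{u, v, 0} A where
  rank := N
  Fib := Bundle.Trivial A.Triv (Cvec N)
  act g _ := MatAlg.toEnd N (SU.mat g)
  act_one p v := by
    have h : ∀ q, q = p → (⟨q, v⟩ : TotalSpace (Cvec N) (Bundle.Trivial A.Triv (Cvec N)))
      = ⟨p, v⟩ := by rintro _ rfl; rfl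
    exact h _ (one_smul _ p)
  act_mul g h p v := by
    have h : ∀ q q', q = q' → ∀ w w' : Cvec N, w = w' →
        (⟨q, w⟩ : TotalSpace (Cvec N) (Bundle.Trivial A.Triv (Cvec N))) = ⟨q', w'⟩ := by
      rintro _ _ rfl _ _ rfl; rfl
    exact h _ _ (mul_smul g _ p) _ _ rfl
  act_smooth k g p v hg hv := by
    have hv := smoothAlong_trivial_iff.1 hv
    exact smoothAlong_trivial_iff.2 ⟨contMDiff_smul_triv hg hv.1, MatAlg.contDiff_apply hg hv.2⟩
  act_center c ζ hc p := by
    refine ⟨ζ, fun v => ?_⟩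
    have hcp : c • p = p := by
      have hstar : star (SU.mat c) * SU.mat c = 1 := (c : unitary (MatAlg N)).2.1
      have h : p.iso.trans (SU.conj c) = p.iso := by
        apply StarAlgEquiv.ext; intro a
        rw [StarAlgEquiv.trans_apply, SU.conj_apply]
        have hcomm : SU.mat c * p.iso a = p.iso a * SU.mat c := by rw [hc]; simp
        have hstar' : SU.mat c * star (SU.mat c) = 1 := (c : unitary (MatAlg N)).2.2
        rw [hcomm, mul_assoc, hstar', mul_one]
      exact congrArg (AzumayaBundle.Triv.mk p.base) h
    have h : ∀ q q', q = q' → ∀ w w' : Cvec N, w = w' →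
        (⟨q, w⟩ : TotalSpace (Cvec N) (Bundle.Trivial A.Triv (Cvec N))) = ⟨q', w'⟩ := by
      rintro _ _ rfl _ _ rfl; rfl
    refine h _ _ hcp _ _ ?_
    change SU.mat c v = ζ • v
    rw [hc]; rfl
  rep p := p.iso.toAlgEquiv.trans (MatAlg.toEnd N)
  rep_smooth k p a v ha hv := by
    have hv := smoothAlong_trivial_iff.1 hv
    refine smoothAlong_trivial_iff.2 ⟨hv.1, MatAlg.contDiff_apply (m := fun t => (p t).iso (a t))
      ?_ hv.2⟩
    rw [← contMDiff_iff_contDiff]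
    exact fun t => (contMDiffAt_triv_iff.1 (hv.1 t)).apply (ha t)
  rep_act g p a v := by
    have hstar : star (SU.mat g) * SU.mat g = 1 := (g : unitary (MatAlg N)).2.1
    change (SU.mat g * p.iso a * star (SU.mat g)) (SU.mat g v) = SU.mat g (p.iso a v)
    rw [← MatAlg.mul_apply, mul_assoc, hstar, mul_one, MatAlg.mul_apply]

end AzumayaBundle

open TopologicalSpace (Opens)

variable {A : AzumayaBundle.{u, v} N d Z}

/-- An equivalence of the representing bundle `V` with `L ⊗ E`, where `L` is a line bundle over `𝒫`
with an `SU(N)` action and `E` is the standard representing bundle. -/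
structure RepresentingBundle.Factorization (V : RepresentingBundle.{u, v, w} A)
    (L : EquivariantLineBundle.{u, v, w} A) where
  iso : ∀ p : A.Triv, (L.Fib p ⊗[ℂ] A.standard.Fib p) ≃ₗ[ℂ] V.Fib p
  smooth : ∀ (k : ℕ) (p : EuclideanSpace ℝ (Fin k) → A.Triv) (l : ∀ t, L.Fib (p t))
    (v : ∀ t, A.standard.Fib (p t)), L.SmoothAlong p l → A.standard.SmoothAlong p v →
      V.SmoothAlong p (fun t => iso (p t) (l t ⊗ₜ v t))
  act : ∀ (g : SU N) (p : A.Triv) (l : L.Fib p) (v : A.standard.Fib p),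
    iso (g • p) (L.act g p l ⊗ₜ A.standard.act g p v) = V.act g p (iso p (l ⊗ₜ v))
  rep : ∀ (p : A.Triv) (a : A.Fib p.base) (l : L.Fib p) (v : A.standard.Fib p),
    iso p (l ⊗ₜ A.standard.rep p a v) = V.rep p a (iso p (l ⊗ₜ v))

/-- The bundle `Hom(V)` over `𝒫 × 𝒫`, with fibre `hom(V_{p'}, V_p) = V_p ⊗ V_{p'}*` at `(p, p')`,
descended from a neighbourhood `W` of the diagonal in `𝒫 × 𝒫` to a bundle over a neighbourhood `U`
of the diagonal in `Z × Z`, with its composition maps.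

For a line bundle `V` it is the descended bundle of `V ⊠ V⁻¹`.

Here `O` is a neighbourhood of the identity in `SU(N)`; any two points of `W` over the same point of
`U` are related by elements `g`, `g'` of `SU(N)` with `g' * g⁻¹ ∈ O`, and the isomorphisms `lift`
with the fibres of `Hom(V)` are compatible with the actions of any such `g`, `g'`. -/
structure EquivariantBundle.HomDescent (V : EquivariantBundle.{u, v, w} A) where
  U : Opens (Z × Z)
  diag_mem : ∀ z, (z, z) ∈ U
  bundle : SmoothBundle.{0, 0, u, w} ((𝓡 d).prod (𝓡 d)) U
  W : Set (A.Triv × A.Triv)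
  isOpen_W : IsOpen W
  diag_mem_W : ∀ p, (p, p) ∈ W
  base_mem : ∀ {p p' : A.Triv}, (p, p') ∈ W → (p.base, p'.base) ∈ U
  exists_mem_W : ∀ {z z' : Z}, (z, z') ∈ U →
    ∃ p p' : A.Triv, (p, p') ∈ W ∧ p.base = z ∧ p'.base = z'
  O : Set (SU N)
  O_mem : O ∈ 𝓝 1
  related : ∀ {p p' q q' : A.Triv}, (p, p') ∈ W → (q, q') ∈ W → p.base = q.base →
    p'.base = q'.base → ∃ g g' : SU N, g' * g⁻¹ ∈ O ∧ g • p = q ∧ g' • p' = q'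
  lift : ∀ {p p' : A.Triv} (h : (p, p') ∈ W),
    bundle.Fib ⟨(p.base, p'.base), base_mem h⟩ ≃ₗ[ℂ] (V.Fib p' →ₗ[ℂ] V.Fib p)
  lift_smooth : ∀ (k : ℕ) (p p' : EuclideanSpace ℝ (Fin k) → A.Triv) (h : ∀ t, (p t, p' t) ∈ W)
    (b : ∀ t, bundle.Fib ⟨((p t).base, (p' t).base), base_mem (h t)⟩) (v : ∀ t, V.Fib (p' t)),
    ContMDiff (𝓡 k) 𝓘(ℝ, AzumayaBundle.TrivModel N d) ∞ p → bundle.SmoothAlong _ b →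
      V.SmoothAlong p' v → V.SmoothAlong p (fun t => lift (h t) (b t) (v t))
  lift_act : ∀ {p p' : A.Triv} (h : (p, p') ∈ W) {g g' : SU N} (h' : (g • p, g' • p') ∈ W),
    g' * g⁻¹ ∈ O → ∀ (b : bundle.Fib ⟨(p.base, p'.base), base_mem h⟩) (v : V.Fib p'),
      lift h' b (V.act g' p' v) = V.act g p (lift h b v)
  comp : ∀ {x y z : Z} (hxy : (x, y) ∈ U) (hyz : (y, z) ∈ U) (hxz : (x, z) ∈ U),
    bundle.Fib ⟨(x, y), hxy⟩ →ₗ[ℂ] bundle.Fib ⟨(y, z), hyz⟩ →ₗ[ℂ] bundle.Fib ⟨(x, z), hxz⟩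
  comp_smooth : ∀ (k : ℕ) (x y z : EuclideanSpace ℝ (Fin k) → Z) (hxy : ∀ t, (x t, y t) ∈ U)
    (hyz : ∀ t, (y t, z t) ∈ U) (hxz : ∀ t, (x t, z t) ∈ U)
    (b : ∀ t, bundle.Fib ⟨(x t, y t), hxy t⟩) (c : ∀ t, bundle.Fib ⟨(y t, z t), hyz t⟩),
    bundle.SmoothAlong _ b → bundle.SmoothAlong _ c →
      bundle.SmoothAlong (fun t => ⟨(x t, z t), hxz t⟩)
        (fun t => comp (hxy t) (hyz t) (hxz t) (b t) (c t))
  comp_assoc : ∀ {x y z t : Z} (hxy : (x, y) ∈ U) (hyz : (y, z) ∈ U) (hxz : (x, z) ∈ U)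
    (hzt : (z, t) ∈ U) (hxt : (x, t) ∈ U) (hyt : (y, t) ∈ U) (a : bundle.Fib ⟨(x, y), hxy⟩)
    (b : bundle.Fib ⟨(y, z), hyz⟩) (c : bundle.Fib ⟨(z, t), hzt⟩),
    comp hxz hzt hxt (comp hxy hyz hxz a b) c = comp hxy hyt hxt a (comp hyz hzt hyt b c)
  lift_comp : ∀ {p q r : A.Triv} (hpq : (p, q) ∈ W) (hqr : (q, r) ∈ W) (hpr : (p, r) ∈ W)
    (b : bundle.Fib ⟨(p.base, q.base), base_mem hpq⟩)
    (c : bundle.Fib ⟨(q.base, r.base), base_mem hqr⟩),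
    lift hpr (comp (base_mem hpq) (base_mem hqr) (base_mem hpr) b c) = lift hpq b ∘ₗ lift hqr c

/-- The extension of the Azumaya bundle `A` off the diagonal given by the representing bundle `V`:
the descended bundle of `Hom(V)`, with an isomorphism of algebras of its restriction to the diagonal
with `A`, which lifts to the given isomorphism of `A` and `hom(V)`. -/
structure RepresentingBundle.Extension (V : RepresentingBundle.{u, v, w} A) extends
    V.toEquivariantBundle.HomDescent where
  diag : ∀ z, A.Fib z ≃ₗ[ℂ] bundle.Fib ⟨(z, z), diag_mem z⟩
  diag_smooth : ∀ (k : ℕ) (z : EuclideanSpace ℝ (Fin k) → Z) (a : ∀ t, A.Fib (z t)),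
    A.SmoothAlong z a → bundle.SmoothAlong _ (fun t => diag (z t) (a t))
  diag_mul : ∀ (z : Z) (a b : A.Fib z),
    diag z (a * b) = comp (diag_mem z) (diag_mem z) (diag_mem z) (diag z a) (diag z b)
  lift_diag : ∀ (p : A.Triv) (a : A.Fib p.base),
    lift (diag_mem_W p) (diag p.base a) = V.rep p a

/-- An isomorphism, near the diagonal, of the extension `X` of `A` given by `V = L ⊗ E` with the
tensor product of the canonical extension `Y` of `A` and the bundle `D` descended from `L ⊠ L⁻¹`: a
smooth isomorphism of bundles over a neighbourhood `U` of the diagonal, which intertwines the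
composition maps and which lifts, near the diagonal in `𝒫 × 𝒫`, to the natural isomorphism of
`Hom(L ⊗ E)` and `Hom(E) ⊗ Hom(L)`. -/
structure RepresentingBundle.Factorization.TensorIso {V : RepresentingBundle.{u, v, w} A}
    {L : EquivariantLineBundle.{u, v, w} A} (e : V.Factorization L) (X : V.Extension)
    (Y : A.standard.Extension) (D : L.toEquivariantBundle.HomDescent) where
  U : Opens (Z × Z)
  diag_mem : ∀ z, (z, z) ∈ U
  le_X : U ≤ X.U
  le_Y : U ≤ Y.U
  le_D : U ≤ D.U
  iso : ∀ (u : Z × Z) (h : u ∈ U),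
    (Y.bundle.Fib ⟨u, le_Y h⟩ ⊗[ℂ] D.bundle.Fib ⟨u, le_D h⟩) ≃ₗ[ℂ] X.bundle.Fib ⟨u, le_X h⟩
  smooth : ∀ (k : ℕ) (x : EuclideanSpace ℝ (Fin k) → Z × Z) (h : ∀ t, x t ∈ U)
    (a : ∀ t, Y.bundle.Fib ⟨x t, le_Y (h t)⟩) (l : ∀ t, D.bundle.Fib ⟨x t, le_D (h t)⟩),
    Y.bundle.SmoothAlong _ a → D.bundle.SmoothAlong _ l →
      X.bundle.SmoothAlong _ (fun t => iso (x t) (h t) (a t ⊗ₜ l t))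
  map_comp : ∀ {x y z : Z} (hxy : (x, y) ∈ U) (hyz : (y, z) ∈ U) (hxz : (x, z) ∈ U)
    (a : Y.bundle.Fib ⟨(x, y), le_Y hxy⟩) (b : Y.bundle.Fib ⟨(y, z), le_Y hyz⟩)
    (l : D.bundle.Fib ⟨(x, y), le_D hxy⟩) (m : D.bundle.Fib ⟨(y, z), le_D hyz⟩),
    iso (x, z) hxz (Y.comp (le_Y hxy) (le_Y hyz) (le_Y hxz) a b ⊗ₜ
        D.comp (le_D hxy) (le_D hyz) (le_D hxz) l m)
      = X.comp (le_X hxy) (le_X hyz) (le_X hxz) (iso (x, y) hxy (a ⊗ₜ l)) (iso (y, z) hyz (b ⊗ₜ m))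
  W : Set (A.Triv × A.Triv)
  isOpen_W : IsOpen W
  diag_mem_W : ∀ p, (p, p) ∈ W
  base_mem : ∀ {p p' : A.Triv}, (p, p') ∈ W → (p.base, p'.base) ∈ U
  exists_mem_W : ∀ {z z' : Z}, (z, z') ∈ U →
    ∃ p p' : A.Triv, (p, p') ∈ W ∧ p.base = z ∧ p'.base = z'
  W_X : W ⊆ X.W
  W_Y : W ⊆ Y.W
  W_D : W ⊆ D.W
  lift_iso : ∀ {p p' : A.Triv} (h : (p, p') ∈ W)
    (a : Y.bundle.Fib ⟨(p.base, p'.base), le_Y (base_mem h)⟩)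
    (l : D.bundle.Fib ⟨(p.base, p'.base), le_D (base_mem h)⟩)
    (s : L.Fib p') (v : A.standard.Fib p'),
    X.lift (W_X h) (iso _ (base_mem h) (a ⊗ₜ l)) (e.iso p' (s ⊗ₜ v))
      = e.iso p (D.lift (W_D h) l s ⊗ₜ Y.lift (W_Y h) a v)

end bundles

end

/-! Every star automorphism of the matrix algebra is conjugation by a special unitary matrix, unique
up to the finite centre of `SU N` (`MatAlg.exists_su_conj`, `SU.finite_central`). Hence two pairs in
`𝒫 × 𝒫` over the same point of `Z × Z` are related by some `(g, g')`, and the fibres of `Hom(V)` at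
these pairs are identified by `f ↦ g f g'⁻¹`. The identification depends on the choice of `(g, g')`,
but only up to pairs of central elements.

Near the diagonal this ambiguity disappears. By compactness of `𝒫` and of `SU N`, pairs close to the
diagonal are related by some `g'` close to `g` (`AzumayaBundle.exists_related_nhds`). Two such
choices differ by central elements that are close to each other, hence equal, since the centre is
discrete. A central element acts on a nonzero fibre of `V` by an `N`-th root of unity; this scalar
is locally constant, so it is the same at both ends of a short pair
(`EquivariantBundle.sameCharacter_mem_nhdsSet`) and cancels in `Hom(V)`. This is
`DescentDomain.lift_tr`, on which the whole descent rests. Fibres of the descended bundle are spaces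
of homomorphisms at a chosen pair, composition is defined by lifting to compatible triples of
points, and associativity is checked on four compatible points. A family is declared smooth when its
lifts are smooth, and the bundle structure is recovered from this notion
(`SmoothFamilies.toBundle`). On the diagonal, the given representation is invariant under `SU N` and
so descends to an isomorphism with `A`.

For the factorization, the line bundle is the bundle of intertwiners from `ℂᴺ` to `V_p`. Both are
modules over the matrix algebra whose image is the full endomorphism algebra, so intertwiners form a
line, and evaluation `L ⊗ E → V` is an isomorphism (`lineEval_bijective`). The one-dimensionality
comes from the minimal idempotent `e = e₀ ⊗ e₀*`, for which `e m e` is always a multiple of `e`.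

For the comparison, three arbitrary descents are given. At a pair of points of `𝒫` close to the
diagonal, the isomorphism `Hom(L ⊗ E) ≅ Hom(E) ⊗ Hom(L)` is transported through the three lifts. All
three lifts are compatible with the same `(g, g')` once `g' g⁻¹` is close to `1`, so the result does
not depend on the pair (`TensorDomain.liftTo_iso`), and compatibility with composition and
smoothness can be tested upstairs. -/

noncomputable section

/-! ### Smooth families of linear maps between finite-dimensional spaces -/

/-- The Euclidean spaces which serve as parameter spaces of smooth families. -/
abbrev Param (k : ℕ) : Type := EuclideanSpace ℝ (Fin k)

theorem contDiff_congr {E F : Type*} [NormedAddCommGroup E] [NormedSpace ℝ E]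
    [NormedAddCommGroup F] [NormedSpace ℝ F] {f g : E → F} (hf : ContDiff ℝ ∞ f)
    (h : ∀ t, g t = f t) : ContDiff ℝ ∞ g :=
  (funext h : g = f) ▸ hf

section LinearFamilies

variable {k : ℕ} {F F' : Type*} [NormedAddCommGroup F] [NormedSpace ℝ F] [FiniteDimensional ℝ F]
  [NormedAddCommGroup F'] [NormedSpace ℝ F']

/-- In finite dimensions smoothness in the operator norm is smoothness on each fixed vector.
Hypotheses on linear families are therefore made vector by vector below. -/
theorem contDiff_toContinuousLinearMap {Φ : Param k → F →ₗ[ℝ] F'}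
    (h : ∀ v, ContDiff ℝ ∞ fun t => Φ t v) :
    ContDiff ℝ ∞ fun t => LinearMap.toContinuousLinearMap (Φ t) :=
  contDiff_clm_apply_iff.2 h

theorem contDiff_linear_apply {Φ : Param k → F →ₗ[ℝ] F'} (h : ∀ v, ContDiff ℝ ∞ fun t => Φ t v)
    {v : Param k → F} (hv : ContDiff ℝ ∞ v) : ContDiff ℝ ∞ fun t => Φ t (v t) :=
  (contDiff_toContinuousLinearMap h).clm_apply hv

/-- Inversion is a smooth map at invertible operators. -/
theorem contDiff_linear_symm_apply [FiniteDimensional ℝ F'] {Φ : Param k → F ≃ₗ[ℝ] F'}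
    (h : ∀ v, ContDiff ℝ ∞ fun t => Φ t v)
    {v : Param k → F'} (hv : ContDiff ℝ ∞ v) : ContDiff ℝ ∞ fun t => (Φ t).symm (v t) := by
  have h1 := contDiff_toContinuousLinearMap (Φ := fun t => (Φ t : F →ₗ[ℝ] F')) h
  have h2 : ContDiff ℝ ∞ fun t =>
      (LinearMap.toContinuousLinearMap (Φ t : F →ₗ[ℝ] F')).inverse := by
    rw [contDiff_iff_contDiffAt] at h1 ⊢
    intro t
    have := contDiffAt_map_inverse (𝕜 := ℝ) (n := ∞) (Φ t).toContinuousLinearEquiv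
    exact ContDiffAt.comp (f := fun t => LinearMap.toContinuousLinearMap (Φ t : F →ₗ[ℝ] F'))
      t this (h1 t)
  refine contDiff_congr (h2.clm_apply hv) fun t => ?_
  have : LinearMap.toContinuousLinearMap (Φ t : F →ₗ[ℝ] F')
    = ((Φ t).toContinuousLinearEquiv : F →L[ℝ] F') := rfl
  rw [this, ContinuousLinearMap.inverse_equiv]
  rfl

end LinearFamilies

/-- Endomorphisms of `ℂʳ` as vectors. -/
def endVec (r : ℕ) : (Cvec r →ₗ[ℂ] Cvec r) ≃ₗ[ℂ] Cvec (r * r) :=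
  LinearEquiv.ofFinrankEq _ _ (by simp [Module.finrank_linearMap])

/-- An endomorphism depends linearly on its values on a basis. This allows the coordinates `endVec`
of a space of homomorphisms to be tested on fixed vectors. -/
theorem contDiff_endVec_iff {k r : ℕ} {T : Param k → Cvec r →ₗ[ℂ] Cvec r} :
    ContDiff ℝ ∞ (fun t => endVec r (T t)) ↔ ∀ v, ContDiff ℝ ∞ fun t => T t v := by
  constructor
  · intro h v
    let f : Cvec (r * r) →ₗ[ℂ] Cvec r :=
      (LinearMap.applyₗ v) ∘ₗ ((endVec r).symm : Cvec (r * r) →ₗ[ℂ] (Cvec r →ₗ[ℂ] Cvec r))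
    have h1 : ContDiff ℝ ∞ f := ((LinearMap.toContinuousLinearMap f).restrictScalars ℝ).contDiff
    refine contDiff_congr (h1.comp h) fun t => ?_
    simp [f]
  · intro h
    let b := (EuclideanSpace.basisFun (Fin r) ℂ).toBasis
    let f : Fin r → Cvec r →ₗ[ℂ] Cvec (r * r) := fun i =>
      (endVec r : (Cvec r →ₗ[ℂ] Cvec r) →ₗ[ℂ] Cvec (r * r)) ∘ₗ
        LinearMap.smulRightₗ (b.coord i)
    have h1 : ∀ T : Cvec r →ₗ[ℂ] Cvec r, endVec r T = ∑ i, f i (T (b i)) := by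
      intro T
      have : T = ∑ i, LinearMap.smulRightₗ (b.coord i) (T (b i)) := by
        ext1 v
        conv_lhs => rw [← b.sum_repr v, map_sum]
        simp only [map_smul, LinearMap.sum_apply, LinearMap.smulRightₗ_apply]
        rfl
      conv_lhs => rw [this, map_sum]
      rfl
    simp_rw [h1]
    refine ContDiff.sum fun i _ => ?_
    exact ((LinearMap.toContinuousLinearMap (f i)).restrictScalars ℝ).contDiff.comp (h _)

/-! ### Testing smoothness on Euclidean families -/

section Plots

variable {E H : Type*} [NormedAddCommGroup E] [NormedSpace ℝ E] [TopologicalSpace H]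
  {I : ModelWithCorners ℝ E H} {M : Type*} [TopologicalSpace M] [ChartedSpace H M]

/-- A finite-dimensional manifold without boundary is locally parametrized by Euclidean spaces. -/
theorem exists_plot [IsManifold I ∞ M] [I.Boundaryless] [FiniteDimensional ℝ E] (m : M)
    {O : Set M} (hO : O ∈ 𝓝 m) : ∃ (k : ℕ) (q : Param k → M) (ρ : M → Param k),
      ContMDiff (𝓡 k) I ∞ q ∧ (∀ t, q t ∈ O) ∧ ContMDiffAt I (𝓡 k) ∞ ρ m ∧
        ∀ᶠ y in 𝓝 m, q (ρ y) = y := by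
  set e := extChartAt I m
  set L : E ≃L[ℝ] Param (Module.finrank ℝ E) := toEuclidean
  have h1 : e.target ∩ e.symm ⁻¹' O ∈ 𝓝 (e m) := by
    refine inter_mem (extChartAt_target_mem_nhds m) ?_
    refine (continuousAt_extChartAt_symm m).preimage_mem_nhds ?_
    rwa [extChartAt_to_inv]
  have h2 : L.symm ⁻¹' (e.target ∩ e.symm ⁻¹' O) ∈ 𝓝 (L (e m)) := by
    refine L.symm.continuous.continuousAt.preimage_mem_nhds ?_
    simpa using h1
  obtain ⟨r, hr, hball⟩ := Metric.mem_nhds_iff.1 h2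
  -- `univBall` is a diffeomorphism of the whole Euclidean space onto a ball, so the parametrization
  -- is defined on all of `Param k` while its image stays in `O`.
  set φ := OpenPartialHomeomorph.univBall (L (e m)) r
  have hmem : ∀ t, φ t ∈ Metric.ball (L (e m)) r := by
    intro t
    have := φ.map_source (x := t) (by simp [φ])
    rwa [OpenPartialHomeomorph.univBall_target _ hr] at this
  refine ⟨_, fun t => e.symm (L.symm (φ t)), fun y => φ.symm (L (e y)), ?_, ?_, ?_, ?_⟩
  · have h3 : ContMDiff (𝓡 _) 𝓘(ℝ, E) ∞ (fun t => L.symm (φ t)) :=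
      (L.symm.contDiff.comp OpenPartialHomeomorph.contDiff_univBall).contMDiff
    exact (contMDiffOn_extChartAt_symm m).comp_contMDiff h3 fun t => (hball (hmem t)).1
  · exact fun t => (hball (hmem t)).2
  · have h3 : ContDiffAt ℝ ∞ φ.symm (L (e m)) :=
      OpenPartialHomeomorph.contDiffOn_univBall_symm.contDiffAt
        (Metric.ball_mem_nhds _ hr)
    have h4 : ContMDiffAt I 𝓘(ℝ, E) ∞ e m := contMDiffAt_extChartAt
    have h5 : ContDiffAt ℝ ∞ (fun y => φ.symm (L y)) (e m) :=
      h3.comp (e m) L.contDiff.contDiffAt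
    exact ContMDiffAt.comp m (g := fun y => φ.symm (L y)) h5.contMDiffAt h4
  · have h3 : ContinuousAt (fun y => L (e y)) m :=
      L.continuous.continuousAt.comp (continuousAt_extChartAt m)
    filter_upwards [h3.eventually (Metric.ball_mem_nhds _ hr), extChartAt_source_mem_nhds (I := I) m]
      with y hy hy'
    have : φ (φ.symm (L (e y))) = L (e y) :=
      φ.right_inv (by rw [OpenPartialHomeomorph.univBall_target _ hr]; exact hy)
    simp only [this, ContinuousLinearEquiv.symm_apply_apply]
    exact e.left_inv hy'

theorem contMDiffAt_opens_iff {E' H' X : Type*} [NormedAddCommGroup E'] [NormedSpace ℝ E']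
    [TopologicalSpace H'] {I' : ModelWithCorners ℝ E' H'} [TopologicalSpace X] [ChartedSpace H' X]
    {U : TopologicalSpace.Opens M} {f : X → U} {x : X} :
    ContMDiffAt I' I ∞ f x ↔ ContMDiffAt I' I ∞ (fun y => (f y : M)) x := by
  rw [contMDiffAt_iff_target (f := f), contMDiffAt_iff_target (f := fun y => (f y : M)),
    Topology.IsInducing.subtypeVal.continuousAt_iff]
  rfl

theorem contMDiff_opens_iff {E' H' X : Type*} [NormedAddCommGroup E'] [NormedSpace ℝ E']
    [TopologicalSpace H'] {I' : ModelWithCorners ℝ E' H'} [TopologicalSpace X] [ChartedSpace H' X]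
    {U : TopologicalSpace.Opens M} {f : X → U} :
    ContMDiff I' I ∞ f ↔ ContMDiff I' I ∞ (fun y => (f y : M)) :=
  forall_congr' fun _ => contMDiffAt_opens_iff

/-- Smoothness of a map on a parameter space may be tested after reparametrizations with arbitrarily
small range. -/
theorem contMDiff_of_local {k : ℕ} {f : Param k → M}
    (h : ∀ t₀, ∃ s ∈ 𝓝 t₀, ∀ ψ : Param k → Param k, ContDiff ℝ ∞ ψ → (∀ t, ψ t ∈ s) →
      ContMDiff (𝓡 k) I ∞ (fun t => f (ψ t))) : ContMDiff (𝓡 k) I ∞ f := by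
  intro t₀
  obtain ⟨s, hs, h⟩ := h t₀
  obtain ⟨r, hr, hball⟩ := Metric.mem_nhds_iff.1 hs
  set φ := OpenPartialHomeomorph.univBall t₀ r
  have hmem : ∀ t, φ t ∈ Metric.ball t₀ r := by
    intro t
    have := φ.map_source (x := t) (by simp [φ])
    rwa [OpenPartialHomeomorph.univBall_target _ hr] at this
  have h1 := h φ OpenPartialHomeomorph.contDiff_univBall fun t => hball (hmem t)
  have h2 : ContDiffAt ℝ ∞ φ.symm t₀ :=
    OpenPartialHomeomorph.contDiffOn_univBall_symm.contDiffAt (Metric.ball_mem_nhds _ hr)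
  refine ((h1 (φ.symm t₀)).comp t₀ h2.contMDiffAt).congr_of_eventuallyEq ?_
  filter_upwards [Metric.ball_mem_nhds t₀ hr] with t ht
  have : φ (φ.symm t) = t :=
      φ.right_inv (by rw [OpenPartialHomeomorph.univBall_target _ hr]; exact ht)
  simp [this]

end Plots

/-! ### Smooth families in vector bundles, and frames along them -/

namespace SmoothBundle

variable {E H : Type*} [NormedAddCommGroup E] [NormedSpace ℝ E] [TopologicalSpace H]
  {I : ModelWithCorners ℝ E H} {M : Type*} [TopologicalSpace M] [ChartedSpace H M]
  {E' H' : Type*} [NormedAddCommGroup E'] [NormedSpace ℝ E'] [TopologicalSpace H']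
  {I' : ModelWithCorners ℝ E' H'} {M' : Type*} [TopologicalSpace M'] [ChartedSpace H' M']

section

variable {V : SmoothBundle I M} {k : ℕ} {x : Param k → M} {v : ∀ t, V.Fib (x t)}

theorem SmoothAlong.base (h : V.SmoothAlong x v) : ContMDiff (𝓡 k) I ∞ x :=
  fun t => (Bundle.contMDiffAt_totalSpace.1 (h t)).1

theorem SmoothAlong.comp (h : V.SmoothAlong x v) {l : ℕ} {ψ : Param l → Param k}
    (hψ : ContDiff ℝ ∞ ψ) : V.SmoothAlong (fun t => x (ψ t)) (fun t => v (ψ t)) :=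
  ContMDiff.comp (g := fun t => (⟨x t, v t⟩ : TotalSpace (Cvec V.rank) V.Fib)) h hψ.contMDiff

theorem smoothAlong_of_local (h : ∀ t₀, ∃ s ∈ 𝓝 t₀, ∀ ψ : Param k → Param k, ContDiff ℝ ∞ ψ →
    (∀ t, ψ t ∈ s) → V.SmoothAlong (fun t => x (ψ t)) (fun t => v (ψ t))) : V.SmoothAlong x v :=
  contMDiff_of_local (f := fun t => (⟨x t, v t⟩ : TotalSpace (Cvec V.rank) V.Fib)) h

theorem smoothAlong_congr {y : Param k → M} {w : ∀ t, V.Fib (y t)}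
    (h : ∀ t, (⟨x t, v t⟩ : TotalSpace (Cvec V.rank) V.Fib) = ⟨y t, w t⟩)
    (hv : V.SmoothAlong x v) : V.SmoothAlong y w :=
  ContMDiff.congr hv fun t => (h t).symm

end

variable (V : SmoothBundle I M)

/-- The coordinates on the fibres given by the distinguished trivialization at a point. -/
def coord (m : M) {y : M} (hy : y ∈ (trivializationAt (Cvec V.rank) V.Fib m).baseSet) :
    V.Fib y ≃ₗ[ℂ] Cvec V.rank :=
  (trivializationAt (Cvec V.rank) V.Fib m).linearEquivAt ℂ y hy

theorem smoothAlong_iff_coord {k : ℕ} {x : Param k → M} {v : ∀ t, V.Fib (x t)} {m : M}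
    (hx : ∀ t, x t ∈ (trivializationAt (Cvec V.rank) V.Fib m).baseSet) :
    V.SmoothAlong x v ↔ ContMDiff (𝓡 k) I ∞ x ∧ ContDiff ℝ ∞ fun t => V.coord m (hx t) (v t) := by
  rw [SmoothAlong, (trivializationAt (Cvec V.rank) V.Fib m).contMDiff_iff
    (fun t => (Trivialization.mem_source _).2 (hx t)), ← contMDiff_iff_contDiff]
  rfl

theorem baseSet_mem_nhds (m : M) :
    (trivializationAt (Cvec V.rank) V.Fib m).baseSet ∈ 𝓝 m :=
  (trivializationAt (Cvec V.rank) V.Fib m).open_baseSet.mem_nhds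
    (FiberBundle.mem_baseSet_trivializationAt' m)

/-- Coordinates on the fibres along a family of points which detect smoothness. -/
structure Frame {k : ℕ} (x : Param k → M) where
  coord : ∀ t, V.Fib (x t) ≃ₗ[ℂ] Cvec V.rank
  smooth_iff : ∀ v, V.SmoothAlong x v ↔ ContDiff ℝ ∞ fun t => coord t (v t)

theorem nonempty_frame {k : ℕ} {x : Param k → M} (hx : ContMDiff (𝓡 k) I ∞ x) {m : M}
    (h : ∀ t, x t ∈ (trivializationAt (Cvec V.rank) V.Fib m).baseSet) : Nonempty (V.Frame x) :=
  ⟨⟨fun t => V.coord m (h t), fun v => by rw [V.smoothAlong_iff_coord h, and_iff_right hx]⟩⟩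

/-- Since families are always defined on a full Euclidean space, restriction to a small set is
expressed by reparametrizations `ψ` with values in that set. -/
theorem exists_frame {k : ℕ} {x : Param k → M} (hx : ContMDiff (𝓡 k) I ∞ x) (t₀ : Param k) :
    ∃ s ∈ 𝓝 t₀, ∀ (l : ℕ) (ψ : Param l → Param k), ContDiff ℝ ∞ ψ → (∀ t, ψ t ∈ s) →
      Nonempty (V.Frame fun t => x (ψ t)) :=
  ⟨_, hx.continuous.continuousAt.preimage_mem_nhds (V.baseSet_mem_nhds (x t₀)),
    fun _ _ hψ h => V.nonempty_frame (hx.comp hψ.contMDiff) h⟩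

variable {V} {V' : SmoothBundle I' M'}

/-- Fibrewise linear isomorphisms which preserve smoothness of families also detect it. -/
theorem smoothAlong_of_equiv {k : ℕ} {x : Param k → M} {x' : Param k → M'}
    (c : V.Frame x) (c' : V'.Frame x') (Φ : ∀ t, V.Fib (x t) ≃ₗ[ℂ] V'.Fib (x' t))
    (hΦ : ∀ v, V.SmoothAlong x v → V'.SmoothAlong x' fun t => Φ t (v t)) {v : ∀ t, V.Fib (x t)}
    (hv : V'.SmoothAlong x' fun t => Φ t (v t)) : V.SmoothAlong x v := by
  rw [c.smooth_iff]
  rw [c'.smooth_iff] at hv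
  -- `Ψ` is `Φ` in the two frames. Applying `hΦ` to families with constant coordinates shows that it
  -- is a smooth family of invertible matrices, so its inverse is smooth too.
  let Ψ : Param k → Cvec V.rank ≃ₗ[ℝ] Cvec V'.rank := fun t =>
    (((c.coord t).symm.trans (Φ t)).trans (c'.coord t)).restrictScalars ℝ
  have h1 : ∀ w, ContDiff ℝ ∞ fun t => Ψ t w := by
    intro w
    refine (c'.smooth_iff _).1 (hΦ (fun t => (c.coord t).symm w) ((c.smooth_iff _).2 ?_))
    simpa using contDiff_const
  refine contDiff_congr (contDiff_linear_symm_apply h1 hv) fun t => ?_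
  rw [LinearEquiv.eq_symm_apply]
  simp [Ψ]

/-- Fibrewise linear isomorphisms with bundles of homomorphisms which preserve smoothness of
families also detect it. -/
theorem smoothAlong_of_equiv_hom {k : ℕ} {x : Param k → M} {y y' : Param k → M'}
    (c : V.Frame x) (d : V'.Frame y) (d' : V'.Frame y')
    (Φ : ∀ t, V.Fib (x t) ≃ₗ[ℂ] (V'.Fib (y' t) →ₗ[ℂ] V'.Fib (y t)))
    (hΦ : ∀ v w, V.SmoothAlong x v → V'.SmoothAlong y' w →
      V'.SmoothAlong y fun t => Φ t (v t) (w t)) {v : ∀ t, V.Fib (x t)}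
    (hv : ∀ w, V'.SmoothAlong y' w → V'.SmoothAlong y fun t => Φ t (v t) (w t)) :
    V.SmoothAlong x v := by
  rw [c.smooth_iff]
  let Θ : ∀ t, V.Fib (x t) ≃ₗ[ℂ] (Cvec V'.rank →ₗ[ℂ] Cvec V'.rank) := fun t =>
    (Φ t).trans (LinearEquiv.arrowCongr (d'.coord t) (d.coord t))
  have hΘ : ∀ (t) (b : V.Fib (x t)) (w : Cvec V'.rank),
      Θ t b w = d.coord t (Φ t b ((d'.coord t).symm w)) := fun t b w => rfl
  have hc : ∀ w : Cvec V'.rank, V'.SmoothAlong y' fun t => (d'.coord t).symm w := by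
    intro w
    rw [d'.smooth_iff]
    simpa using contDiff_const
  -- As for plain isomorphisms, the family becomes one of invertible matrices, now with values in
  -- the coordinates of the endomorphism space; smoothness is tested on constant coordinate vectors
  -- at the far end.
  let Ψ : Param k → Cvec V.rank ≃ₗ[ℝ] Cvec (V'.rank * V'.rank) := fun t =>
    (((c.coord t).symm.trans (Θ t)).trans (endVec _)).restrictScalars ℝ
  have h1 : ∀ w, ContDiff ℝ ∞ fun t => Ψ t w := by
    intro w
    refine contDiff_endVec_iff.2 fun z => ?_
    simp only [LinearEquiv.coe_coe, LinearEquiv.trans_apply, hΘ]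
    refine (d.smooth_iff _).1 (hΦ (fun t => (c.coord t).symm w) _ ((c.smooth_iff _).2 ?_) (hc z))
    simpa using contDiff_const
  have h2 : ContDiff ℝ ∞ fun t => endVec _ (Θ t (v t)) :=
    contDiff_endVec_iff.2 fun z => by
      simp only [hΘ]
      exact (d.smooth_iff _).1 (hv _ (hc z))
  refine contDiff_congr (contDiff_linear_symm_apply h1 h2) fun t => ?_
  rw [LinearEquiv.eq_symm_apply]
  simp [Ψ]

end SmoothBundle

end

/-! ### Vector bundles reconstructed from their smooth families -/

noncomputable section

section Glue

variable {E H : Type*} [NormedAddCommGroup E] [NormedSpace ℝ E] [TopologicalSpace H]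
  (I : ModelWithCorners ℝ E H) {M : Type*} [TopologicalSpace M] [ChartedSpace H M]
  (Fib : M → Type*) [∀ x, AddCommGroup (Fib x)] [∀ x, Module ℂ (Fib x)]

/-- Local coordinates on a family of vector spaces with smooth changes of coordinates. -/
structure FrameAtlas where
  rank : ℕ
  dom : M → Set M
  dom_mem : ∀ m, dom m ∈ 𝓝 m
  coord : ∀ m x, x ∈ dom m → (Fib x ≃ₗ[ℂ] Cvec rank)
  smooth : ∀ (m m' : M) (k : ℕ) (x : Param k → M) (h : ∀ t, x t ∈ dom m) (h' : ∀ t, x t ∈ dom m'),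
    ContMDiff (𝓡 k) I ∞ x → ∀ v : Cvec rank,
      ContDiff ℝ ∞ fun t => coord m' (x t) (h' t) ((coord m (x t) (h t)).symm v)

namespace FrameAtlas

variable {I Fib} (a : FrameAtlas I Fib)

open Classical in
/-- The coordinates, extended by zero. -/
def coordMap (m x : M) : Fib x →ₗ[ℂ] Cvec a.rank :=
  if h : x ∈ a.dom m then (a.coord m x h : Fib x →ₗ[ℂ] Cvec a.rank) else 0

open Classical in
/-- The inverse of the coordinates, extended by zero. -/
def symmMap (m x : M) : Cvec a.rank →ₗ[ℂ] Fib x :=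
  if h : x ∈ a.dom m then ((a.coord m x h).symm : Cvec a.rank →ₗ[ℂ] Fib x) else 0

variable {a}

theorem coordMap_apply {m x : M} (h : x ∈ a.dom m) (v : Fib x) :
    a.coordMap m x v = a.coord m x h v := by rw [coordMap, dif_pos h]; rfl

theorem symmMap_apply {m x : M} (h : x ∈ a.dom m) (v : Cvec a.rank) :
    a.symmMap m x v = (a.coord m x h).symm v := by rw [symmMap, dif_pos h]; rfl

theorem symmMap_coordMap {m x : M} (h : x ∈ a.dom m) (v : Fib x) :
    a.symmMap m x (a.coordMap m x v) = v := by
  rw [coordMap_apply h, symmMap_apply h, LinearEquiv.symm_apply_apply]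

theorem coordMap_symmMap {m x : M} (h : x ∈ a.dom m) (v : Cvec a.rank) :
    a.coordMap m x (a.symmMap m x v) = v := by
  rw [coordMap_apply h, symmMap_apply h, LinearEquiv.apply_symm_apply]

variable (a)

/-- The pretrivialization given by local coordinates. -/
def pretriv (m : M) : Pretrivialization (Cvec a.rank) (π (Cvec a.rank) Fib) where
  toFun p := (p.1, a.coordMap m p.1 p.2)
  invFun q := ⟨q.1, a.symmMap m q.1 q.2⟩
  source := π (Cvec a.rank) Fib ⁻¹' interior (a.dom m)
  target := interior (a.dom m) ×ˢ univ
  map_source' p hp := ⟨hp, mem_univ _⟩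
  map_target' q hq := hq.1
  left_inv' p hp := by
    simp only
    rw [symmMap_coordMap (interior_subset hp)]
  right_inv' q hq := by
    simp only
    rw [coordMap_symmMap (interior_subset hq.1)]
  open_target := isOpen_interior.prod isOpen_univ
  baseSet := interior (a.dom m)
  open_baseSet := isOpen_interior
  source_eq := rfl
  target_eq := rfl
  proj_toFun _ _ := rfl

/-- The topology on the fibres. -/
abbrev fibTop (x : M) : TopologicalSpace (Fib x) :=
  TopologicalSpace.induced (a.coordMap x x) inferInstance

theorem pretriv_symm_apply {m x : M} (h : x ∈ interior (a.dom m)) (v : Cvec a.rank) :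
    (a.pretriv m).symm x v = a.symmMap m x v := by
  have h1 := (a.pretriv m).mk_symm h v
  have h2 : (a.pretriv m).toPartialEquiv.symm (x, v)
    = (⟨x, a.symmMap m x v⟩ : TotalSpace (Cvec a.rank) Fib) := rfl
  rw [h2] at h1
  exact eq_of_heq (TotalSpace.mk.inj h1).2

/-- The field `smooth` concerns Euclidean families only. A local parametrization `q` with a smooth
local inverse `ρ` turns it into smoothness on the base. -/
theorem contMDiffOn_coordChange [IsManifold I ∞ M] [I.Boundaryless] [FiniteDimensional ℝ E]
    (m m' : M) : ContMDiffOn I 𝓘(ℝ, Cvec a.rank →L[ℝ] Cvec a.rank) ∞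
      (fun x => LinearMap.toContinuousLinearMap
        ((a.coordMap m' x ∘ₗ a.symmMap m x).restrictScalars ℝ))
      (interior (a.dom m) ∩ interior (a.dom m')) := by
  intro x₀ hx₀
  obtain ⟨k, q, ρ, h1, h2, h3, h4⟩ := exists_plot (I := I) x₀
    ((isOpen_interior.inter isOpen_interior).mem_nhds hx₀)
  have hd : ∀ t, q t ∈ a.dom m := fun t => interior_subset (h2 t).1
  have hd' : ∀ t, q t ∈ a.dom m' := fun t => interior_subset (h2 t).2
  have h5 : ContDiff ℝ ∞ fun t => LinearMap.toContinuousLinearMap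
      ((a.coordMap m' (q t) ∘ₗ a.symmMap m (q t)).restrictScalars ℝ) := by
    refine contDiff_toContinuousLinearMap fun v => ?_
    refine contDiff_congr (a.smooth m m' k q hd hd' h1 v) fun t => ?_
    rw [LinearMap.restrictScalars_apply, LinearMap.comp_apply, symmMap_apply (hd t),
      coordMap_apply (hd' t)]
  have h6 := ContMDiffAt.comp x₀ (h5.contMDiff (ρ x₀)) h3
  refine (h6.congr_of_eventuallyEq ?_).contMDiffWithinAt
  filter_upwards [h4] with y hy
  simp only [Function.comp_apply]
  rw [hy]

section

variable [IsManifold I ∞ M] [I.Boundaryless] [FiniteDimensional ℝ E]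

/-- The vector prebundle given by local coordinates. -/
def prebundle (𝕜 : Type*) [NontriviallyNormedField 𝕜] [NormedAlgebra 𝕜 ℂ] [CompleteSpace 𝕜]
    [∀ x, Module 𝕜 (Fib x)] [∀ x, IsScalarTower 𝕜 ℂ (Fib x)]
    [FiniteDimensional 𝕜 (Cvec a.rank)] :
    letI := a.fibTop
    VectorPrebundle 𝕜 (Cvec a.rank) Fib :=
  letI := a.fibTop
  { pretrivializationAtlas := range a.pretriv
    pretrivialization_linear' := by
      rintro _ ⟨m, rfl⟩
      exact ⟨fun b hb => ((a.coordMap m b).restrictScalars 𝕜).isLinear⟩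
    pretrivializationAt := a.pretriv
    mem_base_pretrivializationAt := fun m => mem_interior_iff_mem_nhds.2 (a.dom_mem m)
    pretrivialization_mem_atlas := fun m => ⟨m, rfl⟩
    exists_coordChange := by
      rintro _ ⟨m, rfl⟩ _ ⟨m', rfl⟩
      refine ⟨fun x => LinearMap.toContinuousLinearMap
        ((a.coordMap m' x ∘ₗ a.symmMap m x).restrictScalars 𝕜), ?_, ?_⟩
      · refine continuousOn_clm_apply.2 fun v => ?_
        exact (a.contMDiffOn_coordChange m m').continuousOn.clm_apply continuousOn_const
      · rintro b ⟨hb, -⟩ v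
        rw [pretriv_symm_apply a hb]
        rfl
    totalSpaceMk_isInducing := by
      intro x
      change Topology.IsInducing (Prod.mk x ∘ a.coordMap x x)
      exact (Topology.isInducing_const_prod.2 Topology.IsInducing.id).comp ⟨rfl⟩ }

/-- The smooth vector bundle given by local coordinates. -/
def toBundle : SmoothBundle I M :=
  letI := a.fibTop
  letI : TopologicalSpace (TotalSpace (Cvec a.rank) Fib) := (a.prebundle ℂ).totalSpaceTopology
  letI : FiberBundle (Cvec a.rank) Fib := (a.prebundle ℂ).toFiberBundle
  haveI : VectorBundle ℂ (Cvec a.rank) Fib := (a.prebundle ℂ).toVectorBundle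
  -- The real and the complex prebundle have the same pretrivializations, so the topology on the
  -- total space fixed by the complex one serves for both.
  haveI : VectorBundle ℝ (Cvec a.rank) Fib := (a.prebundle ℝ).toVectorBundle
  haveI : (a.prebundle ℝ).IsContMDiff I ∞ := ⟨by
    rintro _ ⟨m, rfl⟩ _ ⟨m', rfl⟩
    refine ⟨_, a.contMDiffOn_coordChange m m', ?_⟩
    rintro b ⟨hb, -⟩ v
    rw [pretriv_symm_apply a hb]
    rfl⟩
  haveI : ContMDiffVectorBundle ∞ (Cvec a.rank) Fib I := (a.prebundle ℝ).contMDiffVectorBundle I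
  { rank := a.rank, Fib := Fib }

theorem smoothAlong_toBundle {k : ℕ} {x : Param k → M} {v : ∀ t, Fib (x t)} {m : M}
    (hx : ∀ t, x t ∈ interior (a.dom m)) :
    a.toBundle.SmoothAlong x v ↔ ContMDiff (𝓡 k) I ∞ x ∧
      ContDiff ℝ ∞ fun t => a.coord m (x t) (interior_subset (hx t)) (v t) := by
  let := a.fibTop
  let : TopologicalSpace (TotalSpace (Cvec a.rank) Fib) := (a.prebundle ℂ).totalSpaceTopology
  let : FiberBundle (Cvec a.rank) Fib := (a.prebundle ℂ).toFiberBundle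
  have : VectorBundle ℝ (Cvec a.rank) Fib := a.toBundle.vectorBundleReal
  have : ContMDiffVectorBundle ∞ (Cvec a.rank) Fib I := a.toBundle.smooth
  let e : Trivialization (Cvec a.rank) (π (Cvec a.rank) Fib) :=
    (a.prebundle ℂ).trivializationOfMemPretrivializationAtlas ⟨m, rfl⟩
  have : MemTrivializationAtlas e := ⟨⟨_, ⟨m, rfl⟩, rfl⟩⟩
  rw [← contMDiff_iff_contDiff]
  have h := e.contMDiff_iff (IM := 𝓡 k) (IB := I) (n := ∞)
    (f := fun t => (⟨x t, v t⟩ : TotalSpace (Cvec a.rank) Fib)) hx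
  refine h.trans (and_congr_right fun _ => ?_)
  have : ∀ t, (e ⟨x t, v t⟩).2 = a.coord m (x t) (interior_subset (hx t)) (v t) :=
    fun t => coordMap_apply _ _
  simp_rw [← this]

end

end FrameAtlas

/-- A notion of smooth families of elements of the spaces `Fib x` which is local and which is,
locally, described by coordinates. -/
structure SmoothFamilies where
  rank : ℕ
  Smooth : ∀ {k : ℕ} (x : Param k → M), (∀ t, Fib (x t)) → Prop
  base : ∀ {k : ℕ} {x : Param k → M} {v : ∀ t, Fib (x t)}, Smooth x v → ContMDiff (𝓡 k) I ∞ x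
  comp : ∀ {k l : ℕ} {x : Param k → M} {v : ∀ t, Fib (x t)} {ψ : Param l → Param k}, Smooth x v →
    ContDiff ℝ ∞ ψ → Smooth (fun t => x (ψ t)) (fun t => v (ψ t))
  of_local : ∀ {k : ℕ} {x : Param k → M} {v : ∀ t, Fib (x t)}, (∀ t₀, ∃ s ∈ 𝓝 t₀, ∀ (l : ℕ)
    (ψ : Param l → Param k), ContDiff ℝ ∞ ψ → (∀ t, ψ t ∈ s) →
      Smooth (fun t => x (ψ t)) (fun t => v (ψ t))) → Smooth x v
  coord : ∀ m, ∃ O ∈ 𝓝 m, ∃ c : ∀ x, x ∈ O → (Fib x ≃ₗ[ℂ] Cvec rank), ∀ (k : ℕ) (x : Param k → M)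
    (h : ∀ t, x t ∈ O), ContMDiff (𝓡 k) I ∞ x → ∀ v : ∀ t, Fib (x t),
      (Smooth x v ↔ ContDiff ℝ ∞ fun t => c (x t) (h t) (v t))

namespace SmoothFamilies

variable {I Fib} (S : SmoothFamilies I Fib)

/-- Local coordinates. -/
def frameAtlas : FrameAtlas I Fib where
  rank := S.rank
  dom m := (S.coord m).choose
  dom_mem m := (S.coord m).choose_spec.1
  coord m := (S.coord m).choose_spec.2.choose
  smooth m m' k x h h' hx v := by
    refine ((S.coord m').choose_spec.2.choose_spec k x h' hx _).1 ?_
    refine ((S.coord m).choose_spec.2.choose_spec k x h hx _).2 ?_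
    simpa using contDiff_const

variable [IsManifold I ∞ M] [I.Boundaryless] [FiniteDimensional ℝ E]

/-- The smooth vector bundle with given smooth families. -/
def toBundle : SmoothBundle I M := S.frameAtlas.toBundle

/-- Both notions of smoothness are local, and on families that stay in one coordinate domain they
are described by the same coordinates. -/
theorem smoothAlong_toBundle {k : ℕ} {x : Param k → M} {v : ∀ t, Fib (x t)} :
    S.toBundle.SmoothAlong x v ↔ S.Smooth x v := by
  have key : ∀ (l : ℕ) (ψ : Param l → Param k) (m : M),
      (∀ t, x (ψ t) ∈ interior (S.frameAtlas.dom m)) →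
      ContMDiff (𝓡 l) I ∞ (fun t => x (ψ t)) →
      (S.toBundle.SmoothAlong (fun t => x (ψ t)) (fun t => v (ψ t)) ↔
        S.Smooth (fun t => x (ψ t)) (fun t => v (ψ t))) := by
    intro l ψ m h hx
    refine (S.frameAtlas.smoothAlong_toBundle h).trans ?_
    rw [and_iff_right hx]
    exact ((S.coord m).choose_spec.2.choose_spec l _ (fun t => interior_subset (h t)) hx _).symm
  have hnhds : ∀ m, interior (S.frameAtlas.dom m) ∈ 𝓝 m := fun m =>
    interior_mem_nhds.2 (S.frameAtlas.dom_mem m)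
  constructor
  · intro h
    refine S.of_local fun t₀ => ?_
    refine ⟨_, h.base.continuous.continuousAt.preimage_mem_nhds (hnhds (x t₀)),
      fun l ψ hψ hmem => (key l ψ _ hmem ?_).1 (h.comp hψ)⟩
    exact h.base.comp hψ.contMDiff
  · intro h
    refine SmoothBundle.smoothAlong_of_local (V := S.toBundle) fun t₀ => ?_
    refine ⟨_, (S.base h).continuous.continuousAt.preimage_mem_nhds (hnhds (x t₀)),
      fun ψ hψ hmem => (key k ψ _ hmem ?_).2 (S.comp h hψ)⟩
    exact (S.base h).comp hψ.contMDiff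

end SmoothFamilies

end Glue

end

/-! ### Automorphisms of the matrix algebra as conjugations by special unitary matrices -/

noncomputable section

namespace MatAlg

variable {N : ℕ}

theorem det_eq_matrix (a : MatAlg N) :
    a.det = (Matrix.of fun i j => a (EuclideanSpace.single j 1) i).det := by
  rw [MatAlg.det, ← LinearMap.det_toMatrix (EuclideanSpace.basisFun (Fin N) ℂ).toBasis]
  congr 1

theorem det_smul (c : ℂ) (a : MatAlg N) : (c • a).det = c ^ N * a.det := by
  have h : ContinuousLinearMap.toLinearMap ((c • a : MatAlg N) : Cvec N →L[ℂ] Cvec N)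
    = c • ContinuousLinearMap.toLinearMap (a : Cvec N →L[ℂ] Cvec N) := rfl
  rw [MatAlg.det, h, LinearMap.det_smul]
  simp [MatAlg.det]

theorem det_star (a : MatAlg N) : (star a).det = star a.det := by
  rw [det_eq_matrix, det_eq_matrix, ← Matrix.det_conjTranspose]
  congr 1
  ext i j
  have h := inner_star_right a (EuclideanSpace.single i 1) (EuclideanSpace.single j 1)
  simpa [EuclideanSpace.inner_single_left, EuclideanSpace.inner_single_right] using h

theorem contDiff_entry (i j : Fin N) :
    ContDiff ℝ ∞ fun a : MatAlg N => a (EuclideanSpace.single j 1) i :=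
  ((EuclideanSpace.proj (𝕜 := ℂ) i).restrictScalars ℝ).contDiff.comp
    ((LinearMap.toContinuousLinearMap
      (evalL (EuclideanSpace.single j (1 : ℂ)))).restrictScalars ℝ).contDiff

theorem contDiff_det : ContDiff ℝ ∞ (MatAlg.det : MatAlg N → ℂ) := by
  refine contDiff_congr (f := fun a : MatAlg N => ∑ σ : Equiv.Perm (Fin N),
    Equiv.Perm.sign σ • ∏ i, a (EuclideanSpace.single i 1) (σ i)) ?_ fun a => ?_
  · refine ContDiff.sum fun σ _ => ?_
    refine ContDiff.const_smul (R := ℤˣ) _ ?_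
    exact contDiff_prod fun i _ => contDiff_entry _ _
  · rw [det_eq_matrix, Matrix.det_apply]
    rfl

variable [NeZero N]

/-- The relation and its adjoint show that `star U * U` commutes with every matrix. Commutation with
the rank one matrices `col v` forces it to be a scalar, whose value is read off at `e₀`. -/
theorem star_mul_of_intertwine {α : MatAlg N ≃⋆ₐ[ℂ] MatAlg N} {U : MatAlg N}
    (h : ∀ a, α a * U = U * a) :
    star U * U = ((‖U (e0 N)‖ ^ 2 : ℝ) : ℂ) • (1 : MatAlg N) := by
  have h1 : ∀ a, star U * α a = a * star U := by
    intro a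
    have := congrArg star (h (star a))
    rwa [star_mul, star_mul, map_star, star_star, star_star] at this
  have h2 : ∀ a, star U * U * a = a * (star U * U) := by
    intro a
    rw [mul_assoc, ← h, ← mul_assoc, h1, mul_assoc]
  apply ext; intro v
  have h3 := congrArg (fun f : MatAlg N => f (e0 N)) (h2 (col v))
  simp only [mul_apply, col_e0] at h3
  rw [mul_apply, h3, col, rankOneL_apply, inner_star_right, inner_self_eq_norm_sq_to_K,
    smul_apply, one_apply]
  simp

/-- With `star U * U = s`, determinants give `s ^ N = 1`; as `s ≥ 0`, it follows that `s = 1`. So an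
intertwiner of determinant one is automatically unitary. -/
theorem exists_su_of_intertwine {α : MatAlg N ≃⋆ₐ[ℂ] MatAlg N} {U : MatAlg N}
    (h : ∀ a, α a * U = U * a) (hdet : U.det = 1) :
    ∃ g : SU N, SU.mat g = U ∧ SU.conj g = α := by
  have h1 := star_mul_of_intertwine h
  set s := ‖U (e0 N)‖ ^ 2
  have hs : 0 ≤ s := by positivity
  have h2 := congrArg MatAlg.det h1
  rw [det_mul, det_star, hdet, det_smul, det_one] at h2
  have h3 : s ^ N = 1 := by
    have : ((s ^ N : ℝ) : ℂ) = 1 := by simpa using h2.symm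
    exact_mod_cast this
  have h4 : s = 1 := (pow_eq_one_iff_of_nonneg hs (NeZero.ne N)).1 h3
  rw [h4] at h1
  have h5 : star U * U = 1 := by simpa using h1
  have h6 : U * star U = 1 :=
    ContinuousLinearMap.coe_injective ((mul_eq_one_comm (M := Module.End ℂ (Cvec N))
      (a := ContinuousLinearMap.toLinearMap (U : Cvec N →L[ℂ] Cvec N))
      (b := ContinuousLinearMap.toLinearMap (star U : Cvec N →L[ℂ] Cvec N))).2
        (congrArg (fun f : Cvec N →L[ℂ] Cvec N => ContinuousLinearMap.toLinearMap f) h5))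
  refine ⟨⟨⟨U, h5, h6⟩, hdet⟩, rfl, ?_⟩
  apply StarAlgEquiv.ext
  intro a
  rw [SU.conj_apply]
  change U * a * star U = α a
  rw [← h, mul_assoc, h6, mul_one]

/-- All automorphisms of the star algebra of matrices are conjugations by special unitary
matrices. -/
theorem exists_su_conj (α : MatAlg N ≃⋆ₐ[ℂ] MatAlg N) : ∃ g : SU N, SU.conj g = α := by
  have h0 : α (col (e0 N)) ≠ 0 := by
    intro h
    have h1 : col (e0 N) = 0 := by simpa using h
    have h2 := col_e0 (e0 N)
    rw [h1, zero_apply] at h2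
    have := inner_e0 (N := N)
    rw [← h2] at this
    simp at this
  obtain ⟨y, hy⟩ : ∃ y, α (col (e0 N)) y ≠ 0 := by
    by_contra! h
    exact h0 (MatAlg.ext fun v => by rw [h v, zero_apply])
  -- Since `a * col v = col (a v)`, the map `v ↦ α (col v) y` intertwines for every `y`; the choice
  -- of `y` makes it nonzero at `e₀`, hence invertible.
  let U : MatAlg N := LinearMap.toContinuousLinearMap
    ((evalL y) ∘ₗ (α.toAlgEquiv.toLinearMap) ∘ₗ col)
  have hU : ∀ v, U v = α (col v) y := fun v => rfl
  have h1 : ∀ a, α a * U = U * a := by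
    intro a
    apply MatAlg.ext; intro v
    rw [mul_apply, mul_apply, hU, hU, ← mul_col, map_mul, mul_apply]
  have h2 := star_mul_of_intertwine h1
  have hs : ((‖U (e0 N)‖ ^ 2 : ℝ) : ℂ) ≠ 0 := by
    rw [hU]
    simpa using hy
  have hd : U.det ≠ 0 := by
    intro h
    have h3 := congrArg MatAlg.det h2
    rw [det_mul, h, mul_zero, det_smul, det_one, mul_one] at h3
    exact pow_ne_zero N hs h3.symm
  -- Rescaling by an `N`-th root of the inverse determinant leaves the intertwining relation intact.
  obtain ⟨c, hc⟩ := IsAlgClosed.exists_pow_nat_eq (U.det)⁻¹ (NeZero.pos N)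
  obtain ⟨g, -, hg⟩ := exists_su_of_intertwine (α := α) (U := c • U)
    (fun a => by rw [mul_smul_comm, smul_mul_assoc, h1])
    (by rw [det_smul, hc, inv_mul_cancel₀ hd])
  exact ⟨g, hg⟩

/-- Smooth families of automorphisms lift locally to smooth families of special unitary
matrices. -/
theorem exists_smooth_su {k : ℕ} {β : Param k → (MatAlg N ≃⋆ₐ[ℂ] MatAlg N)}
    (hβ : ∀ a, ContDiff ℝ ∞ fun t => β t a) {t₀ : Param k}
    (h0 : β t₀ = StarAlgEquiv.refl ℂ (MatAlg N)) :
    ∃ (s : Set (Param k)) (g : Param k → SU N), IsOpen s ∧ t₀ ∈ s ∧ g t₀ = 1 ∧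
      ContDiffOn ℝ ∞ (fun t => SU.mat (g t)) s ∧ ∀ t ∈ s, SU.conj (g t) = β t := by
  -- The intertwiner with `y = e₀` is linear in the values of `β t`, hence smooth in `t`, and equals
  -- `1` at `t₀`; so it has determinant near `1` for `t` near `t₀`.
  let U : Param k → MatAlg N := fun t => implement (β t)
  have hU : ContDiff ℝ ∞ U := by
    refine ContDiff.sum fun i _ => ?_
    refine ((LinearMap.toContinuousLinearMap (rankOneL (EuclideanSpace.single i (1 : ℂ)) :
      Cvec N →ₗ[ℂ] MatAlg N)).restrictScalars ℝ).contDiff.comp ?_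
    exact ((LinearMap.toContinuousLinearMap (evalL (e0 N))).restrictScalars ℝ).contDiff.comp (hβ _)
  have hd : ContDiff ℝ ∞ fun t => (U t).det := contDiff_det.comp hU
  have hU0 : U t₀ = 1 := by simp only [U]; rw [h0, implement_refl]
  -- The principal branch of `det ^ (-1 / N)`, smooth where the determinant lies in the slit plane.
  let c : Param k → ℂ := fun t => Complex.exp (-(Complex.log (U t).det) / N)
  let s : Set (Param k) := (fun t => (U t).det) ⁻¹' Complex.slitPlane
  have hs : IsOpen s := Complex.isOpen_slitPlane.preimage hd.continuous
  have hcs : ContDiffOn ℝ ∞ c s := by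
    intro t ht
    have h1 : ContDiffAt ℝ ∞ (fun t => Complex.log (U t).det) t :=
      ContDiffAt.comp t (g := Complex.log) (f := fun t => (U t).det)
        ((Complex.contDiffAt_log ht).restrict_scalars ℝ) hd.contDiffAt
    exact (Complex.contDiff_exp.contDiffAt.comp t (h1.neg.div_const _)).contDiffWithinAt
  have hN : (N : ℂ) ≠ 0 := Nat.cast_ne_zero.2 (NeZero.ne N)
  have hc : ∀ t ∈ s, (c t • U t).det = 1 := by
    intro t ht
    have h1 : (c t) ^ N = Complex.exp (-(Complex.log (U t).det)) := by
      simp only [c]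
      rw [← Complex.exp_nat_mul]
      congr 1
      field_simp
    rw [det_smul, h1, Complex.exp_neg, Complex.exp_log (Complex.slitPlane_ne_zero ht),
      inv_mul_cancel₀ (Complex.slitPlane_ne_zero ht)]
  -- Outside `s` the value is irrelevant and is set to `1`.
  have hex : ∀ t, ∃ g : SU N, t ∈ s → SU.mat g = c t • U t ∧ SU.conj g = β t := by
    intro t
    by_cases ht : t ∈ s
    · obtain ⟨g, h1, h2⟩ := exists_su_of_intertwine (α := β t) (U := c t • U t)
        (fun a => by rw [mul_smul_comm, smul_mul_assoc, map_mul_implement]) (hc t ht)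
      exact ⟨g, fun _ => ⟨h1, h2⟩⟩
    · exact ⟨1, fun h => absurd h ht⟩
  choose g hg using hex
  have ht₀ : t₀ ∈ s := by
    simp only [s, mem_preimage]
    rw [hU0, det_one]
    exact Complex.one_mem_slitPlane
  refine ⟨s, g, hs, ht₀, ?_, ?_, fun t ht => (hg t ht).2⟩
  · apply Subtype.ext
    apply Subtype.ext
    refine ((hg t₀ ht₀).1).trans ?_
    simp only [c]
    rw [hU0, det_one]
    simp
  · exact (hcs.smul hU.contDiffOn).congr fun t ht => (hg t ht).1

end MatAlg

/-! ### Norm distance, compactness and finite centre of the special unitary group -/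

namespace SU

section

variable {N : ℕ}

/-- The elements of the centre: special unitary scalar matrices. -/
def IsCentral (g : SU N) : Prop := ∃ ζ : ℂ, mat g = ζ • 1

theorem mat_mul (g h : SU N) : mat (g * h) = mat g * mat h := rfl

theorem mat_one : mat (1 : SU N) = 1 := rfl

theorem mat_inv (g : SU N) : mat g⁻¹ = star (mat g) := rfl

theorem mat_injective : Function.Injective (mat (N := N)) := fun _ _ h =>
  Subtype.ext (Subtype.ext h)

theorem star_mul_self (g : SU N) : star (mat g) * mat g = 1 := (g : unitary (MatAlg N)).2.1

theorem mul_star_self (g : SU N) : mat g * star (mat g) = 1 := (g : unitary (MatAlg N)).2.2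

theorem IsCentral.inv {g : SU N} (hg : IsCentral g) : IsCentral g⁻¹ := by
  obtain ⟨ζ, hζ⟩ := hg
  exact ⟨star ζ, by rw [mat_inv, hζ, star_smul, star_one]⟩

theorem root_of_mat_eq {g : SU N} {ζ : ℂ} (h : mat g = ζ • 1) : ζ ^ N = 1 := by
  have h1 : (mat g).det = 1 := g.2
  rwa [h, MatAlg.det_smul, MatAlg.det_one, mul_one] at h1

theorem isInducing_mat : Topology.IsInducing (mat (N := N)) :=
  Topology.IsInducing.subtypeVal.comp Topology.IsInducing.subtypeVal

theorem continuous_mat : Continuous (mat (N := N)) := isInducing_mat.continuous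

theorem norm_mul_mat (g : SU N) (a : MatAlg N) : ‖mat g * a‖ = ‖a‖ :=
  CStarRing.norm_coe_unitary_mul (g : unitary (MatAlg N)) a

theorem norm_mat_mul (g : SU N) (a : MatAlg N) : ‖a * mat g‖ = ‖a‖ :=
  CStarRing.norm_mul_coe_unitary a (g : unitary (MatAlg N))

/-- Multiplication by unitaries is isometric on either side, so the discrepancies of pairs of group
elements add up under products. All estimates with multiples of `ε` below rest on this. -/
theorem norm_mul_sub_mul_le (g g' h h' : SU N) :
    ‖mat (g' * h') - mat (g * h)‖ ≤ ‖mat g' - mat g‖ + ‖mat h' - mat h‖ := by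
  have : mat (g' * h') - mat (g * h) = (mat g' - mat g) * mat h' + mat g * (mat h' - mat h) := by
    rw [mat_mul, mat_mul]; noncomm_ring
  rw [this]
  refine (norm_add_le _ _).trans ?_
  rw [norm_mat_mul, norm_mul_mat]

theorem norm_inv_sub_inv (g g' : SU N) : ‖mat g'⁻¹ - mat g⁻¹‖ = ‖mat g' - mat g‖ := by
  rw [mat_inv, mat_inv, ← star_sub, norm_star]

theorem norm_mul_inv_sub_one (g g' : SU N) : ‖mat (g' * g⁻¹) - 1‖ = ‖mat g' - mat g‖ := by
  rw [← norm_mat_mul g, sub_mul, one_mul, ← mat_mul, inv_mul_cancel_right]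

/-- Because `‖g' g⁻¹ - 1‖ = ‖g' - g‖`, the condition `g' * g⁻¹ ∈ O` of a descent can be replaced by
closeness of `g` and `g'` in norm. -/
theorem mem_nhds_one_iff {O : Set (SU N)} :
    O ∈ 𝓝 1 ↔ ∃ ε > 0, ∀ g g' : SU N, ‖mat g' - mat g‖ < ε → g' * g⁻¹ ∈ O := by
  rw [isInducing_mat.nhds_eq_comap, (Metric.nhds_basis_ball.comap mat).mem_iff]
  refine exists_congr fun ε => and_congr_right fun _ => ?_
  simp only [Set.subset_def, mem_preimage, mem_ball_iff_norm, mat_one]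
  constructor
  · intro h g g' hg
    exact h _ (by rwa [norm_mul_inv_sub_one])
  · intro h g hg
    simpa using h 1 g (by rwa [mat_one])

instance : CompactSpace (SU N) := by
  have : ProperSpace (MatAlg N) := FiniteDimensional.proper ℂ _
  have h1 : range (mat (N := N)) = {a | star a * a = 1 ∧ a * star a = 1 ∧ a.det = 1} := by
    ext a
    constructor
    · rintro ⟨g, rfl⟩
      exact ⟨star_mul_self g, mul_star_self g, g.2⟩
    · rintro ⟨h1, h2, h3⟩
      exact ⟨⟨⟨a, h1, h2⟩, h3⟩, rfl⟩
  have h2 : IsClosed (range (mat (N := N))) := by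
    rw [h1]
    refine IsClosed.inter ?_ (IsClosed.inter ?_ ?_)
    · exact isClosed_eq (by fun_prop) continuous_const
    · exact isClosed_eq (by fun_prop) continuous_const
    · exact isClosed_eq MatAlg.contDiff_det.continuous continuous_const
  have h3 : Bornology.IsBounded (range (mat (N := N))) := by
    refine isBounded_iff_forall_norm_le.2 ⟨‖(1 : MatAlg N)‖, ?_⟩
    rintro _ ⟨g, rfl⟩
    have := norm_mul_mat g 1
    rw [mul_one] at this
    exact this.le
  rw [← isCompact_univ_iff, isInducing_mat.isCompact_iff, image_univ]
  exact Metric.isCompact_of_isClosed_isBounded h2 h3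

end

variable {N : ℕ} [NeZero N]

/-- Commutation with the rank one matrices `col v`, evaluated at `e₀`, exhibits the scalar. -/
theorem isCentral_of_conj_eq {g : SU N} (h : ∀ a, conj g a = a) : IsCentral g := by
  have h1 : ∀ a, mat g * a = a * mat g := by
    intro a
    have h2 : mat g * a * star (mat g) = a := by
      rw [← conj_apply, h]
    conv_rhs => rw [← h2]
    rw [mul_assoc _ (star _), star_mul_self, mul_one]
  refine ⟨inner ℂ (MatAlg.e0 N) (mat g (MatAlg.e0 N)), MatAlg.ext fun v => ?_⟩
  have h3 := congrArg (fun f : MatAlg N => f (MatAlg.e0 N)) (h1 (MatAlg.col v))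
  simp only [MatAlg.mul_apply, MatAlg.col_e0] at h3
  rw [h3, MatAlg.smul_apply, MatAlg.one_apply, MatAlg.col, MatAlg.rankOneL_apply]

theorem finite_roots (N : ℕ) [NeZero N] : {ζ : ℂ | ζ ^ N = 1}.Finite := by
  refine (Polynomial.nthRoots N (1 : ℂ)).toFinset.finite_toSet.subset fun ζ hζ => ?_
  simpa [Polynomial.mem_nthRoots (NeZero.pos N)] using hζ

theorem finite_central : {g : SU N | IsCentral g}.Finite := by
  refine Set.Finite.of_finite_image (f := mat)
    (((finite_roots N).image fun ζ => ζ • (1 : MatAlg N)).subset ?_) mat_injective.injOn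
  rintro _ ⟨g, ⟨ζ, hζ⟩, rfl⟩
  exact ⟨ζ, root_of_mat_eq hζ, hζ.symm⟩

/-- The centre is discrete. -/
theorem exists_central_gap (N : ℕ) [NeZero N] : ∃ δ > 0, ∀ g h : SU N, IsCentral g → IsCentral h →
    ‖mat h - mat g‖ < δ → g = h := by
  have h1 : ({g : SU N | IsCentral g} ×ˢ {g : SU N | IsCentral g}).Finite :=
    finite_central.prod finite_central
  have h2 : ∀ᶠ δ : ℝ in 𝓝[>] 0, ∀ p ∈ {g : SU N | IsCentral g} ×ˢ {g : SU N | IsCentral g},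
      ‖mat p.2 - mat p.1‖ < δ → p.1 = p.2 := by
    refine (Filter.eventually_all_finite h1).2 fun p _ => ?_
    by_cases hp : p.1 = p.2
    · exact Filter.Eventually.of_forall fun _ _ => hp
    · have h3 : 0 < ‖mat p.2 - mat p.1‖ :=
        norm_pos_iff.2 (sub_ne_zero.2 fun h => hp (mat_injective h).symm)
      filter_upwards [Ioo_mem_nhdsGT h3] with δ hδ h
      exact absurd h hδ.2.le.not_gt
  obtain ⟨δ, hδ, hδ0⟩ := (h2.and self_mem_nhdsWithin).exists
  exact ⟨δ, hδ0, fun g h hg hh => hδ (g, h) ⟨hg, hh⟩⟩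

end SU

end

/-! ### The topology of `𝒫` and the action of the special unitary group on it -/

noncomputable section

/-- Expanding `m` in a fixed finite basis reduces joint continuity to continuity of `Φ` on each
basis vector. -/
theorem continuousAt_linear_apply {X F F' : Type*} [TopologicalSpace X] [NormedAddCommGroup F]
    [NormedSpace ℂ F] [FiniteDimensional ℂ F] [NormedAddCommGroup F'] [NormedSpace ℂ F']
    {Φ : X → F →ₗ[ℂ] F'} {x₀ : X} (hΦ : ∀ a, ContinuousAt (fun x => Φ x a) x₀) {m : X → F}
    (hm : ContinuousAt m x₀) : ContinuousAt (fun x => Φ x (m x)) x₀ := by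
  let b := Module.finBasis ℂ F
  have h : (fun x => Φ x (m x)) =
      fun x => ∑ i, LinearMap.toContinuousLinearMap (b.coord i) (m x) • Φ x (b i) := by
    funext x
    conv_lhs => rw [← b.sum_repr (m x), map_sum]
    simp only [map_smul]
    rfl
  rw [h]
  refine tendsto_finsetSum _ fun i _ => ?_
  exact ((ContinuousLinearMap.continuous _).continuousAt.comp hm).smul (hΦ (b i))

namespace AzumayaBundle

variable {N d : ℕ} {Z : Type u} [TopologicalSpace Z] [ChartedSpace (EuclideanSpace ℝ (Fin d)) Z]
  {A : AzumayaBundle.{u, v} N d Z}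

theorem smul_iso_apply (g : SU N) (p : A.Triv) (a : A.Fib p.base) :
    (g • p).iso a = SU.mat g * p.iso a * star (SU.mat g) := rfl

theorem smul_iso_symm_apply (g : SU N) (p : A.Triv) (a : MatAlg N) :
    (g • p).iso.symm a = p.iso.symm (star (SU.mat g) * a * SU.mat g) := by
  have h : (g • p).iso (p.iso.symm (star (SU.mat g) * a * SU.mat g)) = a := by
    rw [smul_iso_apply, StarAlgEquiv.apply_symm_apply]
    calc _ = (SU.mat g * star (SU.mat g)) * a * (SU.mat g * star (SU.mat g)) := by
          simp only [mul_assoc]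
      _ = a := by rw [SU.mul_star_self, one_mul, mul_one]
  conv_lhs => rw [← h]
  exact StarAlgEquiv.symm_apply_apply _ _

theorem smul_eq_of_isCentral {c : SU N} (hc : SU.IsCentral c) (p : A.Triv) : c • p = p := by
  obtain ⟨ζ, hζ⟩ := hc
  have h : p.iso.trans (SU.conj c) = p.iso := by
    apply StarAlgEquiv.ext; intro a
    rw [StarAlgEquiv.trans_apply, SU.conj_apply]
    have hcomm : SU.mat c * p.iso a = p.iso a * SU.mat c := by rw [hζ]; simp
    rw [hcomm, mul_assoc, SU.mul_star_self, mul_one]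
  exact congrArg (AzumayaBundle.Triv.mk p.base) h

theorem isCentral_of_smul_eq [NeZero N] {g : SU N} {p : A.Triv} (h : g • p = p) :
    SU.IsCentral g := by
  have h1 : (⟨p.base, p.iso.trans (SU.conj g)⟩ : A.Triv) = ⟨p.base, p.iso⟩ := h
  have h2 : p.iso.trans (SU.conj g) = p.iso := eq_of_heq (Triv.mk.inj h1).2
  refine SU.isCentral_of_conj_eq fun a => ?_
  have h3 := congrArg (fun f : A.Fib p.base ≃⋆ₐ[ℂ] MatAlg N => f (p.iso.symm a)) h2
  simpa using h3

/-- The identification of the fibres at equal points. -/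
def fibCast {y z : Z} (h : y = z) : A.Fib y ≃⋆ₐ[ℂ] A.Fib z := by
  subst h; exact StarAlgEquiv.refl ℂ _

theorem mk_fibCast {y z : Z} (h : y = z) (a : A.Fib y) :
    (⟨z, fibCast h a⟩ : A.Total) = ⟨y, a⟩ := by
  subst h; rfl

/-- The automorphism of the matrix algebra which relates two points of `𝒫` in the same fibre. -/
def Triv.diff (p q : A.Triv) (h : p.base = q.base) : MatAlg N ≃⋆ₐ[ℂ] MatAlg N :=
  p.iso.symm.trans ((fibCast h).trans q.iso)

/-- Moving one point of `𝒫` to another in the same fibre amounts to lifting an automorphism of the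
matrix algebra to `SU N`. -/
theorem Triv.smul_eq_iff {p q : A.Triv} (h : p.base = q.base) {g : SU N} :
    g • p = q ↔ SU.conj g = p.diff q h := by
  obtain ⟨z, p⟩ := p
  obtain ⟨y, q⟩ := q
  obtain rfl : z = y := h
  constructor
  · intro h1
    have h1 : (⟨z, p.trans (SU.conj g)⟩ : A.Triv) = ⟨z, q⟩ := h1
    have h2 : p.trans (SU.conj g) = q := eq_of_heq (Triv.mk.inj h1).2
    subst h2
    apply StarAlgEquiv.ext; intro a
    change _ = SU.conj g (p (p.symm a))
    simp
  · intro h1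
    refine congrArg (Triv.mk z) ?_
    apply StarAlgEquiv.ext; intro a
    rw [StarAlgEquiv.trans_apply, h1]
    change q (p.symm (p a)) = q a
    simp

variable [NeZero N]

theorem exists_smul_eq {p q : A.Triv} (h : p.base = q.base) : ∃ g : SU N, g • p = q := by
  obtain ⟨g, hg⟩ := MatAlg.exists_su_conj (p.diff q h)
  exact ⟨g, (Triv.smul_eq_iff h).2 hg⟩

variable [IsManifold (𝓡 d) ∞ Z]

theorem smoothFamilyAt_id (p : A.Triv) : SmoothFamilyAt 𝓘(ℝ, TrivModel N d) (id : A.Triv → _) p :=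
  contMDiffAt_triv_iff.1 contMDiffAt_id

theorem continuous_base : Continuous fun p : A.Triv => p.base :=
  continuous_iff_continuousAt.2 fun p => (smoothFamilyAt_id p).base.continuousAt

theorem contMDiff_base : ContMDiff 𝓘(ℝ, TrivModel N d) (𝓡 d) ∞ fun p : A.Triv => p.base :=
  fun p => (smoothFamilyAt_id p).base

theorem continuousAt_rel (τ : A.LocalTriv) {p : A.Triv} (h : p.base ∈ τ.O) (a : MatAlg N) :
    ContinuousAt (fun q => τ.rel q a) p :=
  ((τ.contMDiffAt_iff (s := fun q : A.Triv => (⟨q.base, q.iso.symm a⟩ : A.Total)) h).1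
    (smoothFamilyAt_id p a)).2.continuousAt

/-- A criterion for the continuity of maps to `𝒫`. -/
theorem continuousAt_triv {X : Type*} [TopologicalSpace X] {f : X → A.Triv} {x₀ : X}
    (hb : ContinuousAt (fun x => (f x).base) x₀) (τ : A.LocalTriv) (h : (f x₀).base ∈ τ.O)
    (hr : ∀ a, ContinuousAt (fun x => τ.rel (f x) a) x₀) : ContinuousAt f x₀ := by
  have hc := chart_mem_atlas (TrivModel N d) (f x₀)
  obtain ⟨τ', e, he, hce⟩ := mem_atlas_triv hc
  have hs : f x₀ ∈ (chartAt (TrivModel N d) (f x₀)).source := mem_chart_source _ _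
  have hcoe : ∀ p, chartAt (TrivModel N d) (f x₀) p = trivChart τ' e p := fun p =>
    congrFun (congrArg (fun c : PartialEquiv A.Triv (TrivModel N d) => (c : A.Triv → _)) hce) p
  have hsrc : (chartAt (TrivModel N d) (f x₀)).source = (trivChart τ' e).source :=
    congrArg PartialEquiv.source hce
  obtain ⟨h1, h2, h3⟩ : f x₀ ∈ (trivChart τ' e).source := hsrc ▸ hs
  -- The given `τ` need not be the trivialization `τ'` underlying the chart. The relative positions
  -- differ by the transition automorphisms, which vary continuously with the base point.
  have hr' : ∀ a, ContinuousAt (fun x => τ'.rel (f x) a) x₀ := by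
    intro a
    have h4 : ∀ b, ContinuousAt (fun z => τ'.iso z ((τ.iso z).symm b)) (f x₀).base := fun b =>
      ((τ'.contMDiffAt_iff (s := fun z => (⟨z, (τ.iso z).symm b⟩ : A.Total)) h1).1
        ((τ.smooth b).contMDiffAt (τ.isOpen.mem_nhds h))).2.continuousAt
    have h5 := continuousAt_linear_apply
      (Φ := fun x => ((τ.iso (f x).base).symm.trans (τ'.iso (f x).base)).toAlgEquiv.toLinearMap)
      (fun b => ContinuousAt.comp (f := fun x => (f x).base) (h4 b) hb) (hr a)
    refine h5.congr (Filter.Eventually.of_forall fun x => ?_)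
    change τ'.iso _ ((τ.iso _).symm (τ.iso _ ((f x).iso.symm a))) = _
    rw [StarAlgEquiv.symm_apply_apply]
    rfl
  have hi : ContinuousAt (fun x => MatAlg.implement (τ'.rel (f x))) x₀ := by
    refine tendsto_finsetSum _ fun i _ => ?_
    refine ((MatAlg.rankOneL (EuclideanSpace.single i (1 : ℂ)) :
      Cvec N →ₗ[ℂ] MatAlg N).continuous_of_finiteDimensional).continuousAt.comp ?_
    exact ((MatAlg.evalL (MatAlg.e0 N)).continuous_of_finiteDimensional).continuousAt.comp (hr' _)
  refine ((chartAt (TrivModel N d) (f x₀)).continuousAt_iff_continuousAt_comp_left ?_).2 ?_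
  · rw [hsrc]
    filter_upwards [hb.eventually (τ'.isOpen.mem_nhds h1),
      hb.eventually (e.open_source.mem_nhds h2),
      hi.eventually (aut_spec.1.mem_nhds h3)] with x a b c
    exact ⟨a, b, c⟩
  · have h4 : ContinuousAt (fun x => (e (f x).base,
        autCoord (MatAlg.implement (τ'.rel (f x))))) x₀ := by
      refine ContinuousAt.prodMk ?_ ?_
      · exact ContinuousAt.comp (f := fun x => (f x).base) (e.continuousAt h2) hb
      · exact ContinuousAt.comp (f := fun x => MatAlg.implement (τ'.rel (f x)))
          (aut_spec.2.2.1.continuousOn.continuousAt (aut_spec.1.mem_nhds h3)) hi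
    exact h4.congr (Filter.Eventually.of_forall fun x => (hcoe _).symm)

instance : ContinuousSMul (SU N) A.Triv where
  continuous_smul := by
    refine continuous_iff_continuousAt.2 fun ⟨g, p⟩ => ?_
    obtain ⟨τ, h, -⟩ := exists_localTriv p
    refine continuousAt_triv (x₀ := (g, p))
      (continuous_base.comp continuous_snd).continuousAt τ h fun a => ?_
    have h1 : ContinuousAt (fun x : SU N × A.Triv => star (SU.mat x.1) * a * SU.mat x.1) (g, p) := by
      have := SU.continuous_mat (N := N)
      fun_prop
    have h2 := continuousAt_linear_apply
      (Φ := fun x : SU N × A.Triv => (τ.rel x.2).toAlgEquiv.toLinearMap)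
      (fun b => ContinuousAt.comp (f := Prod.snd) (x := (g, p)) (continuousAt_rel τ h b)
        continuousAt_snd) h1
    refine h2.congr (Filter.Eventually.of_forall fun x => ?_)
    change τ.iso _ (x.2.iso.symm _) = τ.iso _ ((x.1 • x.2).iso.symm a)
    rw [smul_iso_symm_apply]
    rfl

/-- Points in different fibres are separated in the base, points in one fibre by their positions
relative to a local trivialization. -/
instance [T2Space Z] : T2Space A.Triv := by
  refine t2Space_iff_disjoint_nhds.2 fun p q hpq => ?_
  by_cases hb : p.base = q.base
  · obtain ⟨τ, h, -⟩ := exists_localTriv p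
    obtain ⟨a, ha⟩ : ∃ a, τ.rel p a ≠ τ.rel q a := by
      by_contra! hcon
      apply hpq
      obtain ⟨z, p⟩ := p
      obtain ⟨y, q⟩ := q
      obtain rfl : z = y := hb
      refine congrArg (Triv.mk z) ?_
      have h1 : p.symm = q.symm := by
        apply StarAlgEquiv.ext; intro a
        exact (τ.iso z).injective (hcon a)
      rw [← StarAlgEquiv.symm_symm p, h1, StarAlgEquiv.symm_symm]
    exact (continuousAt_rel τ h a).disjoint (disjoint_nhds_nhds.2 ha)
      (continuousAt_rel τ (hb ▸ h) a)
  · exact (continuous_base.tendsto p).disjoint (disjoint_nhds_nhds.2 hb) (continuous_base.tendsto q)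

/-- The local section of `𝒫` given by a local trivialization. -/
def LocalTriv.sec (τ : A.LocalTriv) (z : Z) : A.Triv := ⟨z, τ.iso z⟩

theorem LocalTriv.contMDiffAt_sec (τ : A.LocalTriv) {z : Z} (h : z ∈ τ.O) :
    ContMDiffAt (𝓡 d) 𝓘(ℝ, TrivModel N d) ∞ τ.sec z :=
  contMDiffAt_triv_iff.2 fun a => (τ.smooth a).contMDiffAt (τ.isOpen.mem_nhds h)

omit [NeZero N] [IsManifold (𝓡 d) ∞ Z] in
/-- There are smooth local sections of `𝒫` through all points. -/
theorem exists_localTriv_sec (p : A.Triv) : ∃ τ : A.LocalTriv, p.base ∈ τ.O ∧ τ.sec p.base = p := by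
  obtain ⟨τ, h1, h2⟩ := exists_localTriv p
  exact ⟨τ, h1, congrArg (Triv.mk p.base) h2⟩

/-- `Z` is covered by finitely many compact sets with sections of `𝒫` over them. Since `SU N` is
compact and transitive on the fibres, the orbits of these sections are compact and cover `𝒫`. -/
instance [T2Space Z] [CompactSpace Z] : CompactSpace A.Triv := by
  have h1 : ∀ z : Z, ∃ K ∈ 𝓝 z, ∃ τ : A.LocalTriv, IsCompact K ∧ K ⊆ τ.O := by
    intro z
    obtain ⟨O, φ, hO, hz, hφ⟩ := A.locTriv z
    obtain ⟨K, hK, hzK, hKO⟩ := exists_compact_subset hO hz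
    exact ⟨K, mem_interior_iff_mem_nhds.1 hzK, ⟨O, φ, hO, hφ⟩, hK, hKO⟩
  choose K hK τ hKc hKO using h1
  obtain ⟨s, -, hs⟩ := isCompact_univ.elim_nhds_subcover K fun z _ => hK z
  have h2 : ∀ z, IsCompact ((fun x : SU N × Z => x.1 • (τ z).sec x.2) '' (univ ×ˢ K z)) := by
    intro z
    refine (isCompact_univ.prod (hKc z)).image_of_continuousOn ?_
    refine ContinuousOn.smul continuousOn_fst ?_
    refine ContinuousOn.comp (g := (τ z).sec) (f := Prod.snd) (s := univ ×ˢ K z) (t := K z)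
      (fun y hy => ?_) continuousOn_snd fun x hx => hx.2
    exact ((τ z).contMDiffAt_sec (hKO z hy)).continuousAt.continuousWithinAt
  refine ⟨(s.isCompact_biUnion fun z _ => h2 z).of_isClosed_subset isClosed_univ fun p _ => ?_⟩
  obtain ⟨z, hz, hp⟩ := mem_iUnion₂.1 (hs (mem_univ p.base))
  obtain ⟨g, hg⟩ := exists_smul_eq (p := (τ z).sec p.base) (q := p) rfl
  exact mem_iUnion₂.2 ⟨z, hz, (g, p.base), ⟨mem_univ _, hp⟩, hg⟩

/-- Continuous local sections through every point make the projection open; this holds for pairs as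
well. -/
theorem isOpen_image_base {W : Set (A.Triv × A.Triv)} (hW : IsOpen W) :
    IsOpen ((fun p : A.Triv × A.Triv => (p.1.base, p.2.base)) '' W) := by
  rw [isOpen_iff_mem_nhds]
  rintro _ ⟨⟨p, p'⟩, h, rfl⟩
  obtain ⟨τ, h1, h2⟩ := exists_localTriv_sec p
  obtain ⟨τ', h1', h2'⟩ := exists_localTriv_sec p'
  have h3 : ContinuousAt (fun z : Z × Z => (τ.sec z.1, τ'.sec z.2)) (p.base, p'.base) :=
    (ContinuousAt.comp (f := Prod.fst) (x := (p.base, p'.base))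
      (τ.contMDiffAt_sec h1).continuousAt continuousAt_fst).prodMk
      (ContinuousAt.comp (f := Prod.snd) (x := (p.base, p'.base))
        (τ'.contMDiffAt_sec h1').continuousAt continuousAt_snd)
  filter_upwards [h3.preimage_mem_nhds (hW.mem_nhds (by simpa only [h2, h2'] using h))] with z hz
  exact ⟨_, hz, rfl⟩

theorem contDiff_iso_apply {k : ℕ} {p : Param k → A.Triv}
    (hp : ContMDiff (𝓡 k) 𝓘(ℝ, TrivModel N d) ∞ p) {a : ∀ t, A.Fib (p t).base}
    (ha : A.SmoothAlong (fun t => (p t).base) a) : ContDiff ℝ ∞ fun t => (p t).iso (a t) := by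
  rw [← contMDiff_iff_contDiff]
  exact fun t => (contMDiffAt_triv_iff.1 (hp t)).apply (ha t)

theorem smoothAlong_iso_symm {k : ℕ} {p : Param k → A.Triv}
    (hp : ContMDiff (𝓡 k) 𝓘(ℝ, TrivModel N d) ∞ p) {m : Param k → MatAlg N}
    (hm : ContDiff ℝ ∞ m) :
    A.SmoothAlong (fun t => (p t).base) fun t => (p t).iso.symm (m t) :=
  fun t => (contMDiffAt_triv_iff.1 (hp t)).symm_apply (hm.contMDiff t)

/-- Smooth families of points of `𝒫` with the same base points are related, locally, by smooth
families of special unitary matrices. -/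
theorem exists_smooth_smul_eq {k : ℕ} {p q : Param k → A.Triv}
    (hp : ContMDiff (𝓡 k) 𝓘(ℝ, TrivModel N d) ∞ p)
    (hq : ContMDiff (𝓡 k) 𝓘(ℝ, TrivModel N d) ∞ q) (h : ∀ t, (p t).base = (q t).base)
    {t₀ : Param k} {g₀ : SU N} (h0 : g₀ • p t₀ = q t₀) :
    ∃ (s : Set (Param k)) (g : Param k → SU N), IsOpen s ∧ t₀ ∈ s ∧ g t₀ = g₀ ∧
      ContDiffOn ℝ ∞ (fun t => SU.mat (g t)) s ∧ ∀ t ∈ s, g t • p t = q t := by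
  -- Translation by `g₀` makes the relating automorphism the identity at `t₀`, where the local lift
  -- to `SU N` is available.
  have hp' : ContMDiff (𝓡 k) 𝓘(ℝ, TrivModel N d) ∞ fun t => g₀ • p t :=
    contMDiff_smul_triv (g := fun _ => g₀) contDiff_const hp
  have h' : ∀ t, (g₀ • p t).base = (q t).base := h
  have hβ : ∀ a, ContDiff ℝ ∞ fun t => (g₀ • p t).diff (q t) (h' t) a := by
    intro a
    refine contDiff_iso_apply hq ?_
    refine ContMDiff.congr (smoothAlong_iso_symm hp' (m := fun _ => a) contDiff_const) fun t => ?_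
    exact mk_fibCast _ _
  obtain ⟨s, g, h1, h2, h3, h4, h5⟩ := MatAlg.exists_smooth_su hβ (t₀ := t₀) (by
    rw [← (Triv.smul_eq_iff (g := 1) (h' t₀)).1 (by rw [one_smul, h0]), map_one]; rfl)
  refine ⟨s, fun t => g t * g₀, h1, h2, by simp only [h3, one_mul], ?_, fun t ht => ?_⟩
  · exact h4.mul contDiffOn_const
  · rw [mul_smul]
    exact (Triv.smul_eq_iff (h' t)).2 (h5 t ht)

end AzumayaBundle

end

/-! ### Invariant neighbourhoods of the diagonal -/

noncomputable section

/-- In a compact Hausdorff space, neighbourhoods of the diagonal have cube roots. -/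
theorem exists_open_comp_subset {X : Type*} [TopologicalSpace X] [CompactSpace X] [T2Space X]
    {W : Set (X × X)} (hW : W ∈ 𝓝ˢ (diagonal X)) : ∃ W' : Set (X × X), IsOpen W' ∧
      (∀ x, (x, x) ∈ W') ∧ (∀ a b c, (a, b) ∈ W' → (a, c) ∈ W' → (b, c) ∈ W) ∧
      ∀ a b c d, (a, b) ∈ W' → (b, c) ∈ W' → (c, d) ∈ W' → (a, d) ∈ W := by
  -- In the uniformity of a compact Hausdorff space the entourages are exactly the neighbourhoods of
  -- the diagonal, and entourages have symmetric cube roots.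
  let _ : UniformSpace X := uniformSpaceOfCompactR1
  rw [nhdsSet_diagonal_eq_uniformity] at hW
  obtain ⟨t, ht, hts, htW⟩ := comp_comp_symm_mem_uniformity_sets hW
  have hd : ∀ x, (x, x) ∈ interior t := fun x =>
    mem_interior_iff_mem_nhds.2 ((nhds_le_uniformity x) ht)
  refine ⟨interior t, isOpen_interior, hd, fun a b c h1 h2 => ?_, fun a b c d h1 h2 h3 => ?_⟩
  · refine htW ⟨c, ⟨a, hts.symm _ _ (interior_subset h1), interior_subset h2⟩, ?_⟩
    exact interior_subset (hd c)
  · exact htW ⟨c, ⟨b, interior_subset h1, interior_subset h2⟩, interior_subset h3⟩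

namespace AzumayaBundle

variable {N d : ℕ} {Z : Type u} [TopologicalSpace Z] [ChartedSpace (EuclideanSpace ℝ (Fin d)) Z]
  {A : AzumayaBundle.{u, v} N d Z} [NeZero N] [IsManifold (𝓡 d) ∞ Z]

/-- The complement is the projection of a closed set along the compact group, hence closed. In this
way open neighbourhoods of the diagonal are made invariant. -/
theorem isOpen_forall_smul_mem {W : Set (A.Triv × A.Triv)} (hW : IsOpen W) :
    IsOpen {x : A.Triv × A.Triv | ∀ g : SU N, (g • x.1, g • x.2) ∈ W} := by
  have h1 : Continuous fun y : SU N × (A.Triv × A.Triv) => (y.1 • y.2.1, y.1 • y.2.2) := by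
    fun_prop
  have h2 := isClosedMap_snd_of_compactSpace _ ((hW.preimage h1).isClosed_compl)
  rw [← isOpen_compl_iff] at h2
  convert h2 using 1
  ext x
  simp

variable [T2Space Z] [CompactSpace Z]

/-- The elements `h` such that no central multiple of `h` is `ε`-close to `1` form a compact set
`K`. The pairs `(q, h • q)` with `h ∈ K` form a compact set, which misses the diagonal because
stabilizers are central; its complement is the required neighbourhood. -/
theorem exists_open_norm_lt {ε : ℝ} (hε : 0 < ε) :
    ∃ W : Set (A.Triv × A.Triv), W ∈ 𝓝ˢ (diagonal A.Triv) ∧ ∀ (h : SU N) (q : A.Triv),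
      (q, h • q) ∈ W → ∃ c : SU N, SU.IsCentral c ∧ ‖SU.mat (c * h) - 1‖ < ε := by
  let K : Set (SU N) := ⋂ c ∈ {c : SU N | SU.IsCentral c}, {h | ε ≤ ‖SU.mat (c * h) - 1‖}
  have hK : IsClosed K := by
    refine isClosed_biInter fun c _ => isClosed_le continuous_const ?_
    have := SU.continuous_mat (N := N)
    fun_prop
  let C := (fun x : A.Triv × SU N => (x.1, x.2 • x.1)) '' (univ ×ˢ K)
  have hC : IsClosed C := by
    refine ((isCompact_univ.prod hK.isCompact).image ?_).isClosed
    fun_prop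
  refine ⟨Cᶜ, hC.isOpen_compl.mem_nhdsSet.2 ?_, fun h q hq => ?_⟩
  · rintro ⟨p, p'⟩ hp ⟨⟨q, h⟩, ⟨-, hh⟩, heq⟩
    obtain rfl : p = p' := hp
    obtain ⟨rfl, h2⟩ := Prod.mk.inj heq
    have h3 : SU.IsCentral h⁻¹ := (isCentral_of_smul_eq h2).inv
    have h4 : ε ≤ ‖SU.mat (h⁻¹ * h) - 1‖ := mem_iInter₂.1 hh _ h3
    rw [inv_mul_cancel, SU.mat_one, sub_self, norm_zero] at h4
    exact absurd h4 hε.not_ge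
  · by_contra! hcon
    exact hq ⟨(q, h), ⟨mem_univ _, mem_iInter₂.2 fun c hc => hcon c hc⟩, rfl⟩

/-- Invariant neighbourhoods of the diagonal of `𝒫 × 𝒫` in which pairs over the same point are
related by pairs of nearby elements of `SU(N)`. -/
theorem exists_related_nhds {W₀ : Set (A.Triv × A.Triv)} (hW₀ : W₀ ∈ 𝓝ˢ (diagonal A.Triv)) {ε : ℝ}
    (hε : 0 < ε) : ∃ W : Set (A.Triv × A.Triv), IsOpen W ∧ (∀ p, (p, p) ∈ W) ∧ W ⊆ W₀ ∧
      (∀ (g : SU N) (p p' : A.Triv), (p, p') ∈ W → (g • p, g • p') ∈ W) ∧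
      ∀ p p' q q' : A.Triv, (p, p') ∈ W → (q, q') ∈ W → p.base = q.base → p'.base = q'.base →
        ∃ g g' : SU N, ‖SU.mat g' - SU.mat g‖ < ε ∧ g • p = q ∧ g' • p' = q' := by
  obtain ⟨W₂, hW₂, h2⟩ := exists_open_norm_lt (A := A) hε
  obtain ⟨W₃, hW₃, h3d, h3, -⟩ := exists_open_comp_subset hW₂
  refine ⟨_, isOpen_forall_smul_mem (hW₃.inter (isOpen_interior (s := W₀))), ?_, ?_, ?_, ?_⟩
  · refine fun p g => ⟨h3d _, mem_interior_iff_mem_nhds.2 ?_⟩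
    exact mem_nhdsSet_iff_forall.1 hW₀ _ rfl
  · rintro ⟨p, p'⟩ h
    simpa using interior_subset (h 1).2
  · intro g p p' h k
    simpa only [mul_smul] using h (k * g)
  · intro p p' q q' h h' hb hb'
    obtain ⟨g, rfl⟩ := exists_smul_eq hb
    obtain ⟨g', rfl⟩ := exists_smul_eq hb'
    -- Both `g • p'` and `g' • p'` are close to `g • p`, hence to each other, so `g' * g⁻¹` is close
    -- to the centre.
    have h4 : (g • p', (g' * g⁻¹) • g • p') ∈ W₂ := by
      refine h3 (g • p) _ _ (h g).1 ?_
      have := (h' 1).1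
      simpa [mul_smul] using this
    obtain ⟨c, hc, hlt⟩ := h2 _ _ h4
    -- The central correction is absorbed into `g'`, as it acts trivially on `𝒫`.
    refine ⟨g, c * g', ?_, rfl, ?_⟩
    · rwa [← SU.norm_mul_inv_sub_one, mul_assoc]
    · rw [mul_smul, smul_eq_of_isCentral hc]

end AzumayaBundle

/-! ### The action on the fibres and the characters of the centre -/

namespace EquivariantBundle

variable {N d : ℕ} {Z : Type u} [TopologicalSpace Z] [ChartedSpace (EuclideanSpace ℝ (Fin d)) Z]
  [NeZero N] [IsManifold (𝓡 d) ∞ Z]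
  {A : AzumayaBundle.{u, v} N d Z} (V : EquivariantBundle.{u, v, w} A)

/-- The total space. -/
abbrev Tot : Type _ := TotalSpace (Cvec V.rank) V.Fib

variable {V} in
theorem mk_inj {p : A.Triv} {v v' : V.Fib p} (h : (⟨p, v⟩ : V.Tot) = ⟨p, v'⟩) : v = v' :=
  eq_of_heq (TotalSpace.mk.inj h).2

/-- The action of `g` between the fibres at `p` and `q = g • p`. -/
def tr {p q : A.Triv} (g : SU N) (h : g • p = q) : V.Fib p →ₗ[ℂ] V.Fib q := by
  subst h; exact V.act g p

theorem mk_tr {p q : A.Triv} {g : SU N} (h : g • p = q) (v : V.Fib p) :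
    (⟨q, V.tr g h v⟩ : V.Tot) = ⟨g • p, V.act g p v⟩ := by
  subst h; rfl

theorem tr_one {p : A.Triv} (h : (1 : SU N) • p = p) (v : V.Fib p) : V.tr 1 h v = v :=
  mk_inj ((V.mk_tr h v).trans (V.act_one p v))

theorem tr_mul {p q r : A.Triv} {g k : SU N} (h : g • p = q) (h' : k • q = r)
    (h'' : (k * g) • p = r) (v : V.Fib p) : V.tr (k * g) h'' v = V.tr k h' (V.tr g h v) := by
  subst h h'
  exact mk_inj ((V.mk_tr h'' v).trans (V.act_mul k g p v))

theorem tr_inv_tr {p q : A.Triv} {g : SU N} (h : g • p = q) (h' : g⁻¹ • q = p) (v : V.Fib p) :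
    V.tr g⁻¹ h' (V.tr g h v) = v := by
  have h1 : (g⁻¹ * g) • p = p := by rw [inv_mul_cancel, one_smul]
  rw [← V.tr_mul h h' h1]
  have : ∀ (k : SU N) (hk : k • p = p), k = 1 → V.tr k hk v = v := by
    rintro k hk rfl
    exact V.tr_one hk v
  exact this _ _ (inv_mul_cancel g)

theorem tr_tr_inv {p q : A.Triv} {g : SU N} (h : g • p = q) (h' : g⁻¹ • q = p) (v : V.Fib q) :
    V.tr g h (V.tr g⁻¹ h' v) = v := by
  have h1 : (g * g⁻¹) • q = q := by rw [mul_inv_cancel, one_smul]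
  rw [← V.tr_mul h' h h1]
  have : ∀ (k : SU N) (hk : k • q = q), k = 1 → V.tr k hk v = v := by
    rintro k hk rfl
    exact V.tr_one hk v
  exact this _ _ (mul_inv_cancel g)

/-- The action of `g` as an isomorphism of fibres. -/
def trEquiv {p q : A.Triv} (g : SU N) (h : g • p = q) : V.Fib p ≃ₗ[ℂ] V.Fib q :=
  LinearEquiv.ofLinearMap (V.tr g h) (V.tr g⁻¹ (by rw [← h, inv_smul_smul]))
    (LinearMap.ext fun v => V.tr_tr_inv h _ v) (LinearMap.ext fun v => V.tr_inv_tr h _ v)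

theorem trEquiv_apply {p q : A.Triv} (g : SU N) (h : g • p = q) (v : V.Fib p) :
    V.trEquiv g h v = V.tr g h v := rfl

theorem smoothAlong_tr {k : ℕ} {p q : Param k → A.Triv} {g : Param k → SU N}
    (hg : ContDiff ℝ ∞ fun t => SU.mat (g t)) (h : ∀ t, g t • p t = q t) {v : ∀ t, V.Fib (p t)}
    (hv : V.SmoothAlong p v) : V.SmoothAlong q fun t => V.tr (g t) (h t) (v t) :=
  SmoothBundle.smoothAlong_congr (fun t => (V.mk_tr (h t) (v t)).symm) (V.act_smooth k g p v hg hv)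

variable {V}

theorem exists_tr_central {c : SU N} (hc : SU.IsCentral c) (p : A.Triv) :
    ∃ χ : ℂ, ∀ (h : c • p = p) (v : V.Fib p), V.tr c h v = χ • v := by
  obtain ⟨ζ, hζ⟩ := hc
  obtain ⟨χ, hχ⟩ := V.act_center c ζ hζ p
  exact ⟨χ, fun h v => mk_inj ((V.mk_tr h v).trans (hχ v))⟩

theorem tr_pow {c : SU N} {p : A.Triv} (h : c • p = p) {χ : ℂ}
    (hχ : ∀ v : V.Fib p, V.tr c h v = χ • v) (n : ℕ) (hn : c ^ n • p = p) (v : V.Fib p) :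
    V.tr (c ^ n) hn v = χ ^ n • v := by
  induction n generalizing v with
  | zero =>
    have : ∀ (k : SU N) (hk : k • p = p), k = 1 → V.tr k hk v = v := by
      rintro k hk rfl
      exact V.tr_one hk v
    rw [this _ _ (pow_zero c), pow_zero, one_smul]
  | succ n ih =>
    have hn' : c ^ n • p = p := by
      rw [pow_succ, mul_smul, h] at hn
      exact hn
    have : ∀ (k : SU N) (hk : k • p = p), k = c ^ n * c → V.tr k hk v = χ ^ (n + 1) • v := by
      rintro k hk rfl
      rw [V.tr_mul h hn', ih hn', hχ, smul_smul, pow_succ]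
    exact this _ _ (pow_succ c n)

/-- The central element `c` is a scalar matrix of determinant one, so `c ^ N = 1`. A nonzero vector
is needed, since on a zero fibre every scalar would qualify. -/
theorem root_of_tr {c : SU N} (hc : SU.IsCentral c) {p : A.Triv} (h : c • p = p) {χ : ℂ}
    (hχ : ∀ v : V.Fib p, V.tr c h v = χ • v) {v : V.Fib p} (hv : v ≠ 0) : χ ^ N = 1 := by
  have h1 : c ^ N = 1 := by
    obtain ⟨ζ, hζ⟩ := hc
    have h2 : ∀ n : ℕ, SU.mat (c ^ n) = ζ ^ n • 1 := by
      intro n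
      induction n with
      | zero => rw [pow_zero, pow_zero, one_smul, SU.mat_one]
      | succ n ih => rw [pow_succ, SU.mat_mul, ih, hζ, pow_succ]; simp [smul_smul, mul_comm]
    apply SU.mat_injective
    rw [h2, SU.root_of_mat_eq hζ, one_smul, SU.mat_one]
  have h2 : c ^ N • p = p := by rw [h1, one_smul]
  have h3 := tr_pow h hχ N h2 v
  have : ∀ (k : SU N) (hk : k • p = p), k = 1 → V.tr k hk v = v := by
    rintro k hk rfl
    exact V.tr_one hk v
  rw [this _ _ h1] at h3
  have h4 : (χ ^ N - 1) • v = 0 := by rw [sub_smul, one_smul, ← h3, sub_self]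
  exact sub_eq_zero.1 ((smul_eq_zero.1 h4).resolve_right hv)

/-- The scalars by which the centre acts are locally constant. -/
theorem eventually_tr_central {c : SU N} (hc : SU.IsCentral c) (p₀ : A.Triv) :
    ∃ χ : ℂ, ∀ᶠ p in 𝓝 p₀, ∀ (h : c • p = p) (v : V.Fib p), V.tr c h v = χ • v := by
  obtain ⟨k, q, ρ, h1, h2, h3, h4⟩ := exists_plot (I := 𝓘(ℝ, AzumayaBundle.TrivModel N d)) p₀
    (V.baseSet_mem_nhds p₀)
  have hcp : ∀ p : A.Triv, c • p = p := AzumayaBundle.smul_eq_of_isCentral hc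
  choose χ hχ using fun p => exists_tr_central (V := V) hc p
  refine ⟨χ p₀, ?_⟩
  -- Along a local parametrization of `𝒫` by a connected Euclidean space the scalar is constant, not
  -- only locally constant.
  suffices h : ∀ t t', ∀ (h : c • q t = q t) (v : V.Fib (q t)), V.tr c h v = χ (q t') • v by
    filter_upwards [h4] with p hp h' v
    have := h (ρ p) (ρ p₀)
    rw [hp, h4.self_of_nhds] at this
    exact this h' v
  intro t t' h v
  -- In rank zero the scalars `χ` are arbitrary, but all vectors vanish.
  rcases Nat.eq_zero_or_pos V.rank with hr | hr
  · have : ∀ w : Cvec V.rank, w = 0 := fun w => by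
      ext i; exact absurd i.2 (by omega)
    have hz : ∀ v : V.Fib (q t), v = 0 := fun v =>
      (V.coord p₀ (h2 t)).injective ((this _).trans (this _).symm)
    rw [hz (V.tr c h v), hz (χ (q t') • v)]
  rw [hχ]
  congr 1
  let i : Fin V.rank := ⟨0, hr⟩
  let w₀ : Cvec V.rank := EuclideanSpace.single i 1
  -- A nowhere vanishing smooth family, on which the action of `c` displays the scalar as a
  -- continuous function of `t`.
  let s : ∀ t, V.Fib (q t) := fun t => (V.coord p₀ (h2 t)).symm w₀
  have hs : V.SmoothAlong q s := by
    refine (V.smoothAlong_iff_coord h2).2 ⟨h1, ?_⟩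
    simpa [s] using contDiff_const
  have hs' := V.smoothAlong_tr (g := fun _ => c) contDiff_const (fun t => hcp (q t)) hs
  have hcont : ContDiff ℝ ∞ fun t => χ (q t) • w₀ := by
    refine contDiff_congr ((V.smoothAlong_iff_coord h2).1 hs').2 fun t => ?_
    rw [hχ, map_smul]
    simp [s]
  have hcont' : Continuous fun t => χ (q t) := by
    have := ((EuclideanSpace.proj (𝕜 := ℂ) i).continuous).comp hcont.continuous
    refine this.congr fun t => ?_
    simp [w₀]
  have hroot : ∀ t, χ (q t) ^ N = 1 := by
    intro t
    refine root_of_tr (v := s t) hc (hcp _) (hχ _ _) ?_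
    simp [s, w₀]
  -- A continuous function from a connected space to the finite set of `N`-th roots of unity is
  -- constant.
  exact isPreconnected_univ.constant_of_mapsTo (SU.finite_roots N).isDiscrete hcont'.continuousOn
    (fun t _ => hroot t) (mem_univ _) (mem_univ _)

variable (V) in
/-- The pairs of points at which the centre acts by the same scalars. -/
def sameCharacter : Set (A.Triv × A.Triv) :=
  {x | ∀ c : SU N, SU.IsCentral c → ∃ χ : ℂ,
    (∀ (h : c • x.1 = x.1) (v : V.Fib x.1), V.tr c h v = χ • v) ∧
      ∀ (h : c • x.2 = x.2) (v : V.Fib x.2), V.tr c h v = χ • v}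

/-- The scalars are locally constant for each central element, and there are only finitely many
central elements. -/
theorem sameCharacter_mem_nhdsSet : V.sameCharacter ∈ 𝓝ˢ (diagonal A.Triv) := by
  refine mem_nhdsSet_iff_forall.2 ?_
  rintro ⟨p, p'⟩ hp
  obtain rfl : p = p' := hp
  refine (Filter.eventually_all_finite SU.finite_central).2 fun c hc => ?_
  obtain ⟨χ, hχ⟩ := eventually_tr_central (V := V) hc p
  filter_upwards [(continuous_fst.tendsto (p, p)).eventually hχ,
    (continuous_snd.tendsto (p, p)).eventually hχ] with x h1 h2
  exact ⟨χ, h1, h2⟩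

end EquivariantBundle

end

/-! ### Descent of `Hom(V)`: fibres, lifts and smooth structure -/

noncomputable section

open TopologicalSpace (Opens)

variable {N d : ℕ} {Z : Type u} [TopologicalSpace Z] [ChartedSpace (EuclideanSpace ℝ (Fin d)) Z]
  [NeZero N] [IsManifold (𝓡 d) ∞ Z] {A : AzumayaBundle.{u, v} N d Z}

/-- A local section through `p₀` is composed with `x`. The resulting `σ` lies over `x` everywhere,
but smoothness is only known where `x` stays in the domain of the section. -/
theorem AzumayaBundle.exists_smooth_section {k : ℕ} {x : Param k → Z}
    (hx : ContMDiff (𝓡 k) (𝓡 d) ∞ x) {t₀ : Param k} {p₀ : A.Triv} (h : p₀.base = x t₀) :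
    ∃ σ : Param k → A.Triv, σ t₀ = p₀ ∧ (∀ t, (σ t).base = x t) ∧ ContinuousAt σ t₀ ∧
      ∃ s ∈ 𝓝 t₀, ∀ (l : ℕ) (ψ : Param l → Param k), ContDiff ℝ ∞ ψ → (∀ t, ψ t ∈ s) →
        ContMDiff (𝓡 l) 𝓘(ℝ, AzumayaBundle.TrivModel N d) ∞ fun t => σ (ψ t) := by
  obtain ⟨τ, h1, h2⟩ := AzumayaBundle.exists_localTriv_sec p₀
  rw [h] at h1 h2
  refine ⟨fun t => τ.sec (x t), h2, fun t => rfl, ?_, x ⁻¹' τ.O,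
    hx.continuous.continuousAt.preimage_mem_nhds (τ.isOpen.mem_nhds h1), fun l ψ hψ hs t => ?_⟩
  · exact ContinuousAt.comp (f := x) (τ.contMDiffAt_sec h1).continuousAt hx.continuous.continuousAt
  · exact ContMDiffAt.comp t (g := τ.sec) (f := fun t => x (ψ t)) (τ.contMDiffAt_sec (hs t))
      ((hx.comp hψ.contMDiff) t)

namespace EquivariantBundle

section

variable (V : EquivariantBundle.{u, v, w} A)

theorem tr_tr_eq {p q q' r : A.Triv} {a b a' b' : SU N} (ha : a • p = q) (hb : b • q = r)
    (ha' : a' • p = q') (hb' : b' • q' = r) (h : b * a = b' * a') (v : V.Fib p) :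
    V.tr b hb (V.tr a ha v) = V.tr b' hb' (V.tr a' ha' v) := by
  have h1 : (b * a) • p = r := by rw [mul_smul, ha, hb]
  have h2 : (b' * a') • p = r := by rw [← h, h1]
  rw [← V.tr_mul ha hb h1, ← V.tr_mul ha' hb' h2]
  congr 1
  simp only [h]

/-- Neighbourhoods of the diagonal of `𝒫 × 𝒫` to which the homomorphisms of `V` descend. -/
structure DescentDomain where
  W : Set (A.Triv × A.Triv)
  W₁ : Set (A.Triv × A.Triv)
  isOpen_W : IsOpen W
  isOpen_W₁ : IsOpen W₁
  diag_mem : ∀ p, (p, p) ∈ W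
  smul_mem : ∀ (g : SU N) (p p' : A.Triv), (p, p') ∈ W → (g • p, g • p') ∈ W
  comp_mem : ∀ a b c e, (a, b) ∈ W → (b, c) ∈ W → (c, e) ∈ W → (a, e) ∈ W₁
  ε : ℝ
  ε_pos : 0 < ε
  related : ∀ {p p' q q' : A.Triv}, (p, p') ∈ W₁ → (q, q') ∈ W₁ → p.base = q.base →
    p'.base = q'.base → ∃ g g' : SU N, ‖SU.mat g' - SU.mat g‖ < ε ∧ g • p = q ∧ g' • p' = q'
  fix : ∀ {p p' : A.Triv}, (p, p') ∈ W₁ → ∀ {g g' : SU N} (h : g • p = p) (h' : g' • p' = p'),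
    ‖SU.mat g' - SU.mat g‖ < 4 * ε → ∃ χ : ℂ, (∀ v, V.tr g h v = χ • v) ∧
      ∀ v, V.tr g' h' v = χ • v

theorem nonempty_descentDomain [T2Space Z] [CompactSpace Z] : Nonempty V.DescentDomain := by
  obtain ⟨δ, hδ, hgap⟩ := SU.exists_central_gap N
  -- The estimates for changes of lifts accumulate to less than `4 ε`; with `ε = δ / 4` this is
  -- within the gap that separates distinct central elements.
  have hε : 0 < δ / 4 := by positivity
  obtain ⟨W₁, h1o, h1d, h1s, -, h1r⟩ :=
    AzumayaBundle.exists_related_nhds V.sameCharacter_mem_nhdsSet hε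
  -- `W₁` is the region where pairs are controlled, and `W` will be the invariant part of a cube
  -- root of it, so that composites of up to three pairs from `W` remain controlled.
  obtain ⟨W', ho, hd, -, hc⟩ := exists_open_comp_subset
    (h1o.mem_nhdsSet.2 (by rintro ⟨p, p'⟩ h; obtain rfl : p = p' := h; exact h1d p))
  refine ⟨⟨_, W₁, AzumayaBundle.isOpen_forall_smul_mem ho, h1o, fun p g => hd _,
    fun g p p' h k => ?_, fun a b c e h h' h'' => ?_, δ / 4, hε, fun h h' => h1r _ _ _ _ h h',
    fun {p p'} hW {g g'} h h' hlt => ?_⟩⟩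
  · simpa only [mul_smul] using h (k * g)
  · exact hc a b c e (by simpa using h 1) (by simpa using h' 1) (by simpa using h'' 1)
  · have hg := AzumayaBundle.isCentral_of_smul_eq h
    obtain rfl := hgap g g' hg (AzumayaBundle.isCentral_of_smul_eq h') (by linarith)
    obtain ⟨χ, h1, h2⟩ := h1s hW g hg
    exact ⟨χ, h1 h, h2 h'⟩

end

namespace DescentDomain

variable {V : EquivariantBundle.{u, v, w} A} (D : V.DescentDomain)

theorem subset {p p' : A.Triv} (h : (p, p') ∈ D.W) : (p, p') ∈ D.W₁ :=
  D.comp_mem _ _ _ _ (D.diag_mem p) (D.diag_mem p) h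

theorem comp_mem' {a b c : A.Triv} (h : (a, b) ∈ D.W) (h' : (b, c) ∈ D.W) : (a, c) ∈ D.W₁ :=
  D.comp_mem _ _ _ _ (D.diag_mem a) h h'

/-- The image in `Z × Z`. -/
def U : Opens (Z × Z) :=
  ⟨(fun p : A.Triv × A.Triv => (p.1.base, p.2.base)) '' D.W,
    AzumayaBundle.isOpen_image_base D.isOpen_W⟩

theorem base_mem {p p' : A.Triv} (h : (p, p') ∈ D.W) : (p.base, p'.base) ∈ D.U := ⟨_, h, rfl⟩

theorem exists_mem {z z' : Z} (h : (z, z') ∈ D.U) :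
    ∃ p p' : A.Triv, (p, p') ∈ D.W ∧ p.base = z ∧ p'.base = z' := by
  obtain ⟨⟨p, p'⟩, h1, h2⟩ := h
  obtain ⟨h3, h4⟩ := Prod.mk.inj h2
  exact ⟨p, p', h1, h3, h4⟩

theorem exists_mem_right {z z' : Z} (h : (z, z') ∈ D.U) {p : A.Triv} (hp : p.base = z) :
    ∃ p' : A.Triv, (p, p') ∈ D.W ∧ p'.base = z' := by
  obtain ⟨q, q', h1, h2, h3⟩ := D.exists_mem h
  obtain ⟨g, rfl⟩ := AzumayaBundle.exists_smul_eq (p := q) (q := p) (h2.trans hp.symm)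
  exact ⟨g • q', D.smul_mem g _ _ h1, h3⟩

/-- A chosen point over a point near the diagonal. -/
def pt (x : D.U) : A.Triv × A.Triv := x.2.choose

theorem pt_mem (x : D.U) : ((D.pt x).1, (D.pt x).2) ∈ D.W := x.2.choose_spec.1

theorem pt_fst (x : D.U) : (D.pt x).1.base = x.1.1 := congrArg Prod.fst x.2.choose_spec.2

theorem pt_snd (x : D.U) : (D.pt x).2.base = x.1.2 := congrArg Prod.snd x.2.choose_spec.2

/-- The fibres of the descended bundle. -/
abbrev Fib (x : D.U) : Type w := V.Fib (D.pt x).2 →ₗ[ℂ] V.Fib (D.pt x).1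

/-- `(p, p')` is a point of the larger neighbourhood over `x`. -/
structure Over (x : D.U) (p p' : A.Triv) : Prop where
  mem : (p, p') ∈ D.W₁
  fst : p.base = x.1.1
  snd : p'.base = x.1.2

variable {D}

theorem Over.exists_rel {x : D.U} {p p' q q' : A.Triv} (h : D.Over x p p') (h' : D.Over x q q') :
    ∃ g g' : SU N, ‖SU.mat g' - SU.mat g‖ < D.ε ∧ g • p = q ∧ g' • p' = q' :=
  D.related h.mem h'.mem (h.fst.trans h'.fst.symm) (h.snd.trans h'.snd.symm)

theorem over_pt (x : D.U) : D.Over x (D.pt x).1 (D.pt x).2 :=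
  ⟨D.subset (D.pt_mem x), D.pt_fst x, D.pt_snd x⟩

theorem over_base {p p' : A.Triv} (h : (p, p') ∈ D.W) :
    D.Over ⟨(p.base, p'.base), D.base_mem h⟩ p p' := ⟨D.subset h, rfl, rfl⟩

/-- The isomorphisms of the fibres with spaces of homomorphisms. -/
def lift {x : D.U} {p p' : A.Triv} (h : D.Over x p p') :
    D.Fib x ≃ₗ[ℂ] (V.Fib p' →ₗ[ℂ] V.Fib p) :=
  LinearEquiv.arrowCongr
    (V.trEquiv ((over_pt x).exists_rel h).choose_spec.choose
      ((over_pt x).exists_rel h).choose_spec.choose_spec.2.2)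
    (V.trEquiv ((over_pt x).exists_rel h).choose
      ((over_pt x).exists_rel h).choose_spec.choose_spec.2.1)

theorem lift_spec {x : D.U} {p p' : A.Triv} (h : D.Over x p p') :
    ∃ (g g' : SU N) (hg : g • (D.pt x).1 = p) (hg' : g' • (D.pt x).2 = p'),
      ‖SU.mat g' - SU.mat g‖ < D.ε ∧
        ∀ (b : D.Fib x) (v : V.Fib (D.pt x).2), lift h b (V.tr g' hg' v) = V.tr g hg (b v) := by
  refine ⟨_, _, ((over_pt x).exists_rel h).choose_spec.choose_spec.2.1,
    ((over_pt x).exists_rel h).choose_spec.choose_spec.2.2,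
    ((over_pt x).exists_rel h).choose_spec.choose_spec.1, fun b v => ?_⟩
  rw [lift, LinearEquiv.arrowCongr_apply, ← trEquiv_apply, LinearEquiv.symm_apply_apply]
  rfl

/-- Going from the chosen pair to `(q, q')` directly, or through `(p, p')`, gives group elements
that differ by `m`, `m'` fixing the chosen pair. They are central and close, so they act by a common
scalar `χ`, which cancels in the space of homomorphisms. The bound is `2 ε` instead of `ε` because
compatible triples are only related up to `2 ε`. -/
theorem lift_tr {x : D.U} {p p' q q' : A.Triv} (h : D.Over x p p') (h' : D.Over x q q')
    {g g' : SU N} (hg : g • p = q) (hg' : g' • p' = q') (hlt : ‖SU.mat g' - SU.mat g‖ < 2 * D.ε)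
    (b : D.Fib x) (v : V.Fib p') :
    lift h' b (V.tr g' hg' v) = V.tr g hg (lift h b v) := by
  obtain ⟨k, k', hk, hk', hklt, hkb⟩ := lift_spec h
  obtain ⟨l, l', hl, hl', hllt, hlb⟩ := lift_spec h'
  obtain ⟨w, rfl⟩ : ∃ w, V.tr k' hk' w = v := ⟨_, (V.trEquiv k' hk').apply_symm_apply v⟩
  have hm : (l⁻¹ * (g * k)) • (D.pt x).1 = (D.pt x).1 := by
    rw [mul_smul, mul_smul, hk, hg, ← hl, inv_smul_smul]
  have hm' : (l'⁻¹ * (g' * k')) • (D.pt x).2 = (D.pt x).2 := by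
    rw [mul_smul, mul_smul, hk', hg', ← hl', inv_smul_smul]
  -- Three discrepancies add up: `ε` for `(l, l')`, `2 ε` for `(g, g')` and `ε` for `(k, k')`.
  have hmlt : ‖SU.mat (l'⁻¹ * (g' * k')) - SU.mat (l⁻¹ * (g * k))‖ < 4 * D.ε := by
    have h1 := SU.norm_mul_sub_mul_le l⁻¹ l'⁻¹ (g * k) (g' * k')
    have h2 := SU.norm_mul_sub_mul_le g g' k k'
    rw [SU.norm_inv_sub_inv] at h1
    linarith
  obtain ⟨χ, hχ, hχ'⟩ := D.fix (over_pt x).mem hm hm' hmlt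
  rw [V.tr_tr_eq hk' hg' hm' hl' (by group), hkb, V.tr_tr_eq hk hg hm hl (by group), hχ, hχ',
    map_smul, map_smul, map_smul, hlb]

/-- Smooth families in the fibres of the descended bundle: their lifts are smooth. -/
def IsSmooth {k : ℕ} (x : Param k → D.U) (b : ∀ t, D.Fib (x t)) : Prop :=
  ContMDiff (𝓡 k) ((𝓡 d).prod (𝓡 d)) ∞ x ∧
    ∀ (l : ℕ) (ψ : Param l → Param k) (p p' : Param l → A.Triv) (h : ∀ t, D.Over (x (ψ t)) (p t) (p' t))
      (v : ∀ t, V.Fib (p' t)), ContDiff ℝ ∞ ψ →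
      ContMDiff (𝓡 l) 𝓘(ℝ, AzumayaBundle.TrivModel N d) ∞ p → V.SmoothAlong p' v →
        V.SmoothAlong p fun t => lift (h t) (b (ψ t)) (v t)

theorem IsSmooth.comp {k l : ℕ} {x : Param k → D.U} {b : ∀ t, D.Fib (x t)} (h : IsSmooth x b)
    {ψ : Param l → Param k} (hψ : ContDiff ℝ ∞ ψ) :
    IsSmooth (fun t => x (ψ t)) (fun t => b (ψ t)) :=
  ⟨h.1.comp hψ.contMDiff, fun l' θ p p' ho v hθ hp hv =>
    h.2 l' (fun t => ψ (θ t)) p p' ho v (hψ.comp hθ) hp hv⟩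

theorem isSmooth_of_local {k : ℕ} {x : Param k → D.U} {b : ∀ t, D.Fib (x t)}
    (h : ∀ t₀, ∃ s ∈ 𝓝 t₀, ∀ (l : ℕ) (ψ : Param l → Param k), ContDiff ℝ ∞ ψ → (∀ t, ψ t ∈ s) →
      IsSmooth (fun t => x (ψ t)) (fun t => b (ψ t))) : IsSmooth x b := by
  refine ⟨contMDiff_of_local fun t₀ => ?_, fun l ψ p p' ho v hψ hp hv => ?_⟩
  · obtain ⟨s, hs, h⟩ := h t₀
    exact ⟨s, hs, fun ψ hψ hψs => (h k ψ hψ hψs).1⟩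
  · refine SmoothBundle.smoothAlong_of_local fun t₁ => ?_
    obtain ⟨s, hs, h⟩ := h (ψ t₁)
    refine ⟨ψ ⁻¹' s, hψ.continuous.continuousAt.preimage_mem_nhds hs, fun θ hθ hθs => ?_⟩
    exact (h l (fun t => ψ (θ t)) (hψ.comp hθ) hθs).2 l id (fun t => p (θ t)) (fun t => p' (θ t))
      (fun t => ho (θ t)) (fun t => v (θ t)) contDiff_id (hp.comp hθ.contMDiff) (hv.comp hθ)

/-- It suffices to consider one lift. -/
theorem isSmooth_of_lift {k : ℕ} {x : Param k → D.U} {b : ∀ t, D.Fib (x t)}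
    (hx : ContMDiff (𝓡 k) ((𝓡 d).prod (𝓡 d)) ∞ x) {p p' : Param k → A.Triv}
    (hp : ContMDiff (𝓡 k) 𝓘(ℝ, AzumayaBundle.TrivModel N d) ∞ p)
    (hp' : ContMDiff (𝓡 k) 𝓘(ℝ, AzumayaBundle.TrivModel N d) ∞ p')
    (ho : ∀ t, D.Over (x t) (p t) (p' t))
    (h : ∀ (l : ℕ) (ψ : Param l → Param k) (v : ∀ t, V.Fib (p' (ψ t))), ContDiff ℝ ∞ ψ →
      V.SmoothAlong (fun t => p' (ψ t)) v →
        V.SmoothAlong (fun t => p (ψ t)) fun t => lift (ho (ψ t)) (b (ψ t)) (v t)) :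
    IsSmooth x b := by
  refine ⟨hx, fun l ψ q q' hq v hψ hqs hv => ?_⟩
  refine SmoothBundle.smoothAlong_of_local fun t₀ => ?_
  obtain ⟨g₀, g₀', hlt, hg₀, hg₀'⟩ := (ho (ψ t₀)).exists_rel (hq t₀)
  obtain ⟨s, g, hs, hts, hgt, hgs, hg⟩ := AzumayaBundle.exists_smooth_smul_eq
    (hp.comp hψ.contMDiff) hqs (fun t => (ho (ψ t)).fst.trans (hq t).fst.symm) hg₀
  obtain ⟨s', g', hs', hts', hgt', hgs', hg'⟩ := AzumayaBundle.exists_smooth_smul_eq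
    (hp'.comp hψ.contMDiff) hv.base (fun t => (ho (ψ t)).snd.trans (hq t).snd.symm) hg₀'
  have hcont : ContinuousAt (fun t => ‖SU.mat (g' t) - SU.mat (g t)‖) t₀ :=
    ((hgs'.continuousOn.continuousAt (hs'.mem_nhds hts')).sub
      (hgs.continuousOn.continuousAt (hs.mem_nhds hts))).norm
  -- The local smooth lifts `g`, `g'` start at elements less than `ε` apart and remain so nearby.
  -- Thus `lift_tr` applies and expresses the new lift through the given one by smooth translations.
  have hev : ∀ᶠ t in 𝓝 t₀, ‖SU.mat (g' t) - SU.mat (g t)‖ < D.ε :=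
    hcont.eventually (gt_mem_nhds (by simp only [hgt, hgt']; exact hlt))
  refine ⟨_, (inter_mem (hs.mem_nhds hts) (inter_mem (hs'.mem_nhds hts') hev)),
    fun θ hθ hmem => ?_⟩
  have hgθ : ContDiff ℝ ∞ fun t => SU.mat (g (θ t)) :=
    hgs.comp_contDiff hθ fun t => (hmem t).1
  have hgθ' : ContDiff ℝ ∞ fun t => SU.mat (g' (θ t)) :=
    hgs'.comp_contDiff hθ fun t => (hmem t).2.1
  have hgi : ContDiff ℝ ∞ fun t => SU.mat (g' (θ t))⁻¹ :=
    (starL' ℝ : MatAlg N ≃L[ℝ] MatAlg N).contDiff.comp hgθ'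
  have e1 : ∀ t, g (θ t) • p (ψ (θ t)) = q (θ t) := fun t => hg _ (hmem t).1
  have e2 : ∀ t, g' (θ t) • p' (ψ (θ t)) = q' (θ t) := fun t => hg' _ (hmem t).2.1
  have e3 : ∀ t, (g' (θ t))⁻¹ • q' (θ t) = p' (ψ (θ t)) := fun t => by rw [← e2, inv_smul_smul]
  have h1 := V.smoothAlong_tr hgi e3 (hv.comp hθ)
  have h2 := V.smoothAlong_tr hgθ e1 (h l (fun t => ψ (θ t)) _ (hψ.comp hθ) h1)
  refine SmoothBundle.smoothAlong_congr (fun t => ?_) h2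
  congr 1
  have hlt' : ‖SU.mat (g' (θ t)) - SU.mat (g (θ t))‖ < 2 * D.ε := by
    have := (hmem t).2.2
    have h3 := D.ε_pos
    simp only [Set.mem_ofPred_eq] at this
    linarith
  rw [← lift_tr (ho (ψ (θ t))) (hq (θ t)) (e1 t) (e2 t) hlt', V.tr_tr_inv (e2 t) (e3 t)]

/-- Local sections of `𝒫` through the two chosen points over `x₀` provide a smoothly varying lift,
and trivializations of `V` at its ends turn homomorphisms into matrices. These coordinates detect
smoothness because one lift suffices. -/
theorem exists_coord (x₀ : D.U) : ∃ O ∈ 𝓝 x₀, ∃ c : ∀ x, x ∈ O → (D.Fib x ≃ₗ[ℂ] Cvec (V.rank * V.rank)),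
    ∀ (k : ℕ) (x : Param k → D.U) (h : ∀ t, x t ∈ O),
      ContMDiff (𝓡 k) ((𝓡 d).prod (𝓡 d)) ∞ x → ∀ b : ∀ t, D.Fib (x t),
        (IsSmooth x b ↔ ContDiff ℝ ∞ fun t => c (x t) (h t) (b t)) := by
  obtain ⟨τ, h1, h2⟩ := AzumayaBundle.exists_localTriv_sec (D.pt x₀).1
  obtain ⟨τ', h1', h2'⟩ := AzumayaBundle.exists_localTriv_sec (D.pt x₀).2
  rw [D.pt_fst] at h1 h2
  rw [D.pt_snd] at h1' h2'
  have hc : ContinuousAt (fun x : D.U => τ.sec x.1.1) x₀ :=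
    ContinuousAt.comp (f := fun x : D.U => x.1.1) (τ.contMDiffAt_sec h1).continuousAt (by fun_prop)
  have hc' : ContinuousAt (fun x : D.U => τ'.sec x.1.2) x₀ :=
    ContinuousAt.comp (f := fun x : D.U => x.1.2) (τ'.contMDiffAt_sec h1').continuousAt (by fun_prop)
  let B := (trivializationAt (Cvec V.rank) V.Fib (D.pt x₀).1).baseSet
  let B' := (trivializationAt (Cvec V.rank) V.Fib (D.pt x₀).2).baseSet
  let O : Set D.U := {x | (x.1.1 ∈ τ.O ∧ x.1.2 ∈ τ'.O) ∧ (τ.sec x.1.1, τ'.sec x.1.2) ∈ D.W₁ ∧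
    τ.sec x.1.1 ∈ B ∧ τ'.sec x.1.2 ∈ B'}
  have hO : O ∈ 𝓝 x₀ := by
    refine Filter.Eventually.and (Filter.Eventually.and ?_ ?_) (Filter.Eventually.and ?_
      (Filter.Eventually.and ?_ ?_))
    · have : ContinuousAt (fun x : D.U => x.1.1) x₀ := by fun_prop
      exact this.eventually (τ.isOpen.mem_nhds h1)
    · have : ContinuousAt (fun x : D.U => x.1.2) x₀ := by fun_prop
      exact this.eventually (τ'.isOpen.mem_nhds h1')
    · refine (hc.prodMk hc').eventually (D.isOpen_W₁.mem_nhds ?_)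
      simp only [h2, h2']
      exact D.subset (D.pt_mem x₀)
    · refine hc.eventually (p := (· ∈ B)) ?_
      simp only [h2]
      exact V.baseSet_mem_nhds _
    · refine hc'.eventually (p := (· ∈ B')) ?_
      simp only [h2']
      exact V.baseSet_mem_nhds _
  have ho : ∀ x ∈ O, D.Over x (τ.sec x.1.1) (τ'.sec x.1.2) := fun x hx => ⟨hx.2.1, rfl, rfl⟩
  let T : ∀ x, x ∈ O → (D.Fib x ≃ₗ[ℂ] (Cvec V.rank →ₗ[ℂ] Cvec V.rank)) := fun x hx =>
    (lift (ho x hx)).trans (LinearEquiv.arrowCongr (V.coord _ hx.2.2.2) (V.coord _ hx.2.2.1))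
  have hT : ∀ x hx b w, T x hx b w = V.coord _ hx.2.2.1
    (lift (ho x hx) b ((V.coord _ hx.2.2.2).symm w)) := fun _ _ _ _ => rfl
  refine ⟨O, hO, fun x hx => (T x hx).trans (endVec _), fun k x h hx b => ?_⟩
  have hx' : ContMDiff (𝓡 k) ((𝓡 d).prod (𝓡 d)) ∞ fun t => (x t : Z × Z) :=
    contMDiff_opens_iff.1 hx
  have hp : ContMDiff (𝓡 k) 𝓘(ℝ, AzumayaBundle.TrivModel N d) ∞ fun t => τ.sec (x t).1.1 :=
    fun t => ContMDiffAt.comp t (g := τ.sec) (f := fun t => (x t).1.1)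
      (τ.contMDiffAt_sec (h t).1.1) (hx'.fst t)
  have hp' : ContMDiff (𝓡 k) 𝓘(ℝ, AzumayaBundle.TrivModel N d) ∞ fun t => τ'.sec (x t).1.2 :=
    fun t => ContMDiffAt.comp t (g := τ'.sec) (f := fun t => (x t).1.2)
      (τ'.contMDiffAt_sec (h t).1.2) (hx'.snd t)
  refine Iff.trans ?_ (contDiff_endVec_iff (T := fun t => T (x t) (h t) (b t))).symm
  constructor
  · intro hb w
    simp only [hT]
    refine ((V.smoothAlong_iff_coord fun t => (h t).2.2.1).1 (hb.2 k id _ _ (fun t => ho _ (h t)) _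
      contDiff_id hp ((V.smoothAlong_iff_coord fun t => (h t).2.2.2).2 ⟨hp', ?_⟩))).2
    simpa using contDiff_const
  · intro hb
    refine isSmooth_of_lift hx hp hp' (fun t => ho _ (h t)) fun l ψ v hψ hv => ?_
    have hv' := ((V.smoothAlong_iff_coord fun t => (h (ψ t)).2.2.2).1 hv).2
    refine (V.smoothAlong_iff_coord fun t => (h (ψ t)).2.2.1).2 ⟨hp.comp hψ.contMDiff, ?_⟩
    have h3 := contDiff_linear_apply (Φ := fun t => (T (x (ψ t)) (h (ψ t)) (b (ψ t))).restrictScalars ℝ)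
      (fun w => (hb w).comp hψ) hv'
    refine contDiff_congr h3 fun t => ?_
    rw [LinearMap.restrictScalars_apply, hT _ (h (ψ t)), LinearEquiv.symm_apply_apply]

variable (D) in
/-- The smooth families in the fibres of the descended bundle. -/
def smoothFamilies : SmoothFamilies ((𝓡 d).prod (𝓡 d)) D.Fib where
  rank := V.rank * V.rank
  Smooth := IsSmooth
  base h := h.1
  comp h hψ := h.comp hψ
  of_local := isSmooth_of_local
  coord := exists_coord

end DescentDomain

end EquivariantBundle

end

/-! ### Descent of `Hom(V)`: composition -/

noncomputable section

open TopologicalSpace (Opens)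

section

variable {B₁ B₂ B₃ X₁ X₂ X₃ : Type*} [AddCommGroup B₁] [Module ℂ B₁] [AddCommGroup B₂] [Module ℂ B₂]
  [AddCommGroup B₃] [Module ℂ B₃] [AddCommGroup X₁] [Module ℂ X₁] [AddCommGroup X₂] [Module ℂ X₂]
  [AddCommGroup X₃] [Module ℂ X₃]

/-- The composition of homomorphisms, transported along isomorphisms. -/
def compOfEquiv (e : B₁ ≃ₗ[ℂ] (X₂ →ₗ[ℂ] X₁)) (f : B₂ ≃ₗ[ℂ] (X₃ →ₗ[ℂ] X₂))
    (g : B₃ ≃ₗ[ℂ] (X₃ →ₗ[ℂ] X₁)) : B₁ →ₗ[ℂ] B₂ →ₗ[ℂ] B₃ :=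
  LinearMap.mk₂ ℂ (fun b c => g.symm (e b ∘ₗ f c))
    (fun b b' c => by rw [map_add, LinearMap.add_comp, map_add])
    (fun s b c => by rw [map_smul, LinearMap.smul_comp, map_smul])
    (fun b c c' => by rw [map_add, LinearMap.comp_add, map_add])
    (fun s b c => by rw [map_smul, LinearMap.comp_smul, map_smul])

theorem compOfEquiv_apply (e : B₁ ≃ₗ[ℂ] (X₂ →ₗ[ℂ] X₁)) (f : B₂ ≃ₗ[ℂ] (X₃ →ₗ[ℂ] X₂))
    (g : B₃ ≃ₗ[ℂ] (X₃ →ₗ[ℂ] X₁)) (b : B₁) (c : B₂) :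
    g (compOfEquiv e f g b c) = e b ∘ₗ f c := g.apply_symm_apply _

end

variable {N d : ℕ} {Z : Type u} [TopologicalSpace Z] [ChartedSpace (EuclideanSpace ℝ (Fin d)) Z]
  [NeZero N] [IsManifold (𝓡 d) ∞ Z] {A : AzumayaBundle.{u, v} N d Z}

omit [NeZero N] [IsManifold (𝓡 d) ∞ Z] in
theorem AzumayaBundle.base_surjective : Function.Surjective (Triv.base (A := A)) := fun z => by
  obtain ⟨_, φ, -⟩ := A.locTriv z
  exact ⟨⟨z, φ z⟩, rfl⟩

namespace EquivariantBundle

namespace DescentDomain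

variable {V : EquivariantBundle.{u, v, w} A} {D : V.DescentDomain}

/-- `p`, `q`, `r` are compatible points over `x`, `y`, `z`. -/
structure Over₃ {x y z : Z} (hxy : (x, y) ∈ D.U) (hyz : (y, z) ∈ D.U) (hxz : (x, z) ∈ D.U)
    (p q r : A.Triv) : Prop where
  pq : D.Over ⟨(x, y), hxy⟩ p q
  qr : D.Over ⟨(y, z), hyz⟩ q r
  pr : D.Over ⟨(x, z), hxz⟩ p r

/-- Invariance of `W` allows the second pair to start at the end `q` of the first. The composite
`(p, r)` is then only known to lie in `W₁`, which is why `Over` refers to `W₁`. -/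
theorem exists_over₃ {x y z : Z} (hxy : (x, y) ∈ D.U) (hyz : (y, z) ∈ D.U) (hxz : (x, z) ∈ D.U) :
    ∃ p q r, Over₃ hxy hyz hxz p q r := by
  obtain ⟨p, q, h, hp, hq⟩ := D.exists_mem hxy
  obtain ⟨r, h', hr⟩ := D.exists_mem_right hyz hq
  exact ⟨p, q, r, ⟨D.subset h, hp, hq⟩, ⟨D.subset h', hq, hr⟩, ⟨D.comp_mem' h h', hp, hr⟩⟩

/-- The relations for `(p, q)` and for `(q, r)` may use different elements `k`, `k'` at `q`. They
differ by a central element, which fixes `r` and is absorbed into `l`; the triangle inequality then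
bounds the remaining discrepancy. -/
theorem Over₃.exists_rel {x y z : Z} {hxy : (x, y) ∈ D.U} {hyz : (y, z) ∈ D.U}
    {hxz : (x, z) ∈ D.U} {p q r p' q' r' : A.Triv} (h : Over₃ hxy hyz hxz p q r)
    (h' : Over₃ hxy hyz hxz p' q' r') : ∃ g k l : SU N, g • p = p' ∧ k • q = q' ∧ l • r = r' ∧
      ‖SU.mat k - SU.mat g‖ < 2 * D.ε ∧ ‖SU.mat l - SU.mat k‖ < 2 * D.ε ∧
        ‖SU.mat l - SU.mat g‖ < 2 * D.ε := by
  obtain ⟨g, k, h1, hg, hk⟩ := h.pq.exists_rel h'.pq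
  obtain ⟨k', l, h2, hk', hl⟩ := h.qr.exists_rel h'.qr
  have hc : (k'⁻¹ * k) • q = q := by rw [mul_smul, hk, ← hk', inv_smul_smul]
  have hcr : (k'⁻¹ * k) • r = r :=
    AzumayaBundle.smul_eq_of_isCentral (AzumayaBundle.isCentral_of_smul_eq hc) r
  have h3 : ‖SU.mat (l * (k'⁻¹ * k)) - SU.mat k‖ < D.ε := by
    have := SU.norm_mul_sub_mul_le k' l (k'⁻¹ * k) (k'⁻¹ * k)
    rw [sub_self, norm_zero, mul_inv_cancel_left] at this
    linarith
  have h4 := D.ε_pos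
  refine ⟨g, k, l * (k'⁻¹ * k), hg, hk, by rw [mul_smul, hcr, hl], by linarith, by linarith, ?_⟩
  calc _ ≤ ‖SU.mat (l * (k'⁻¹ * k)) - SU.mat k‖ + ‖SU.mat k - SU.mat g‖ :=
        norm_sub_le_norm_sub_add_norm_sub _ _ _
    _ < 2 * D.ε := by linarith

/-- The composition maps of the descended bundle. -/
def comp {x y z : Z} (hxy : (x, y) ∈ D.U) (hyz : (y, z) ∈ D.U) (hxz : (x, z) ∈ D.U) :
    D.Fib ⟨(x, y), hxy⟩ →ₗ[ℂ] D.Fib ⟨(y, z), hyz⟩ →ₗ[ℂ] D.Fib ⟨(x, z), hxz⟩ :=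
  compOfEquiv (lift (exists_over₃ hxy hyz hxz).choose_spec.choose_spec.choose_spec.pq)
    (lift (exists_over₃ hxy hyz hxz).choose_spec.choose_spec.choose_spec.qr)
    (lift (exists_over₃ hxy hyz hxz).choose_spec.choose_spec.choose_spec.pr)

/-- For the triple used in the definition this holds by construction. It passes to any other triple
by applying `lift_tr` to each of the three pairs, with the same `g`, `k`, `l`. -/
theorem lift_comp {x y z : Z} {hxy : (x, y) ∈ D.U} {hyz : (y, z) ∈ D.U}
    {hxz : (x, z) ∈ D.U} {p q r : A.Triv} (h : Over₃ hxy hyz hxz p q r)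
    (b : D.Fib ⟨(x, y), hxy⟩) (c : D.Fib ⟨(y, z), hyz⟩) :
    lift h.pr (comp hxy hyz hxz b c) = lift h.pq b ∘ₗ lift h.qr c := by
  obtain ⟨p₀, q₀, r₀, h₀, he⟩ : ∃ p₀ q₀ r₀, ∃ h₀ : Over₃ hxy hyz hxz p₀ q₀ r₀,
      lift h₀.pr (comp hxy hyz hxz b c) = lift h₀.pq b ∘ₗ lift h₀.qr c :=
    ⟨_, _, _, (exists_over₃ hxy hyz hxz).choose_spec.choose_spec.choose_spec,
      compOfEquiv_apply _ _ _ _ _⟩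
  obtain ⟨g, k, l, hg, hk, hl, h1, h2, h3⟩ := h₀.exists_rel h
  refine LinearMap.ext fun v => ?_
  obtain ⟨w, rfl⟩ : ∃ w, V.tr l hl w = v := ⟨_, (V.trEquiv l hl).apply_symm_apply v⟩
  rw [lift_tr h₀.pr h.pr hg hl h3, he, LinearMap.comp_apply,
    LinearMap.comp_apply, lift_tr h₀.qr h.qr hk hl h2, lift_tr h₀.pq h.pq hg hk h1]

/-- Smooth sections through a compatible triple remain compatible nearby, and there the lift of the
composite is the composite of the lifts. -/
theorem isSmooth_comp {k : ℕ} {x y z : Param k → Z} (hxy : ∀ t, (x t, y t) ∈ D.U)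
    (hyz : ∀ t, (y t, z t) ∈ D.U) (hxz : ∀ t, (x t, z t) ∈ D.U)
    {b : ∀ t, D.Fib ⟨(x t, y t), hxy t⟩} {c : ∀ t, D.Fib ⟨(y t, z t), hyz t⟩}
    (hb : IsSmooth (fun t => ⟨(x t, y t), hxy t⟩) b)
    (hc : IsSmooth (fun t => ⟨(y t, z t), hyz t⟩) c) :
    IsSmooth (fun t => ⟨(x t, z t), hxz t⟩)
      fun t => comp (hxy t) (hyz t) (hxz t) (b t) (c t) := by
  have h1 := contMDiff_opens_iff.1 hb.1
  have h2 := contMDiff_opens_iff.1 hc.1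
  have hx : ContMDiff (𝓡 k) (𝓡 d) ∞ x := fun t => (h1 t).fst
  have hy : ContMDiff (𝓡 k) (𝓡 d) ∞ y := fun t => (h1 t).snd
  have hz : ContMDiff (𝓡 k) (𝓡 d) ∞ z := fun t => (h2 t).snd
  refine isSmooth_of_local fun t₀ => ?_
  obtain ⟨p₀, q₀, r₀, h₀⟩ := exists_over₃ (hxy t₀) (hyz t₀) (hxz t₀)
  obtain ⟨p, rfl, hp, hpc, sp, hsp, hps⟩ :=
    AzumayaBundle.exists_smooth_section hx h₀.pq.fst
  obtain ⟨q, rfl, hq, hqc, sq, hsq, hqs⟩ :=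
    AzumayaBundle.exists_smooth_section hy h₀.pq.snd
  obtain ⟨r, rfl, hr, hrc, sr, hsr, hrs⟩ :=
    AzumayaBundle.exists_smooth_section hz h₀.qr.snd
  have e1 : ∀ᶠ t in 𝓝 t₀, (p t, q t) ∈ D.W₁ :=
    (hpc.prodMk hqc).eventually (D.isOpen_W₁.mem_nhds h₀.pq.mem)
  have e2 : ∀ᶠ t in 𝓝 t₀, (q t, r t) ∈ D.W₁ :=
    (hqc.prodMk hrc).eventually (D.isOpen_W₁.mem_nhds h₀.qr.mem)
  have e3 : ∀ᶠ t in 𝓝 t₀, (p t, r t) ∈ D.W₁ :=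
    (hpc.prodMk hrc).eventually (D.isOpen_W₁.mem_nhds h₀.pr.mem)
  refine ⟨_, inter_mem hsp (inter_mem hsq (inter_mem hsr (inter_mem e1 (inter_mem e2 e3)))),
    fun l ψ hψ hs => ?_⟩
  have ho : ∀ t, Over₃ (hxy (ψ t)) (hyz (ψ t)) (hxz (ψ t)) (p (ψ t)) (q (ψ t)) (r (ψ t)) :=
    fun t => ⟨⟨(hs t).2.2.2.1, hp _, hq _⟩, ⟨(hs t).2.2.2.2.1, hq _, hr _⟩,
      ⟨(hs t).2.2.2.2.2, hp _, hr _⟩⟩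
  refine isSmooth_of_lift (p := fun t => p (ψ t)) (p' := fun t => r (ψ t)) ?_
    (hps l ψ hψ fun t => (hs t).1) (hrs l ψ hψ fun t => (hs t).2.2.1) (fun t => (ho t).pr)
    fun m θ v hθ hv => ?_
  · refine contMDiff_opens_iff.2 ?_
    exact (hx.comp hψ.contMDiff).prodMk (hz.comp hψ.contMDiff)
  · refine SmoothBundle.smoothAlong_congr (fun t => ?_)
      (hb.2 m (fun t => ψ (θ t)) (fun t => p (ψ (θ t))) (fun t => q (ψ (θ t)))
        (fun t => (ho (θ t)).pq) _ (hψ.comp hθ)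
        (hps m (fun t => ψ (θ t)) (hψ.comp hθ) fun t => (hs (θ t)).1)
        (hc.2 m (fun t => ψ (θ t)) (fun t => q (ψ (θ t))) (fun t => r (ψ (θ t)))
          (fun t => (ho (θ t)).qr) v (hψ.comp hθ)
          (hqs m (fun t => ψ (θ t)) (hψ.comp hθ) fun t => (hs (θ t)).2.1) hv))
    congr 1
    rw [lift_comp (ho (θ t)), LinearMap.comp_apply]

/-- Over four points a chain `p, q, r, s` can be chosen with consecutive pairs in `W`. Its outer
pair `(p, s)` lies in `W₁` by the threefold composition property, so everything lifts to the
composition of linear maps. -/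
theorem comp_assoc {x y z t : Z} (hxy : (x, y) ∈ D.U) (hyz : (y, z) ∈ D.U) (hxz : (x, z) ∈ D.U)
    (hzt : (z, t) ∈ D.U) (hxt : (x, t) ∈ D.U) (hyt : (y, t) ∈ D.U) (a : D.Fib ⟨(x, y), hxy⟩)
    (b : D.Fib ⟨(y, z), hyz⟩) (c : D.Fib ⟨(z, t), hzt⟩) :
    comp hxz hzt hxt (comp hxy hyz hxz a b) c = comp hxy hyt hxt a (comp hyz hzt hyt b c) := by
  obtain ⟨p, q, h1, hp, hq⟩ := D.exists_mem hxy
  obtain ⟨r, h2, hr⟩ := D.exists_mem_right hyz hq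
  obtain ⟨s, h3, hs⟩ := D.exists_mem_right hzt hr
  have pq : D.Over ⟨(x, y), hxy⟩ p q := ⟨D.subset h1, hp, hq⟩
  have qr : D.Over ⟨(y, z), hyz⟩ q r := ⟨D.subset h2, hq, hr⟩
  have rs : D.Over ⟨(z, t), hzt⟩ r s := ⟨D.subset h3, hr, hs⟩
  have pr : D.Over ⟨(x, z), hxz⟩ p r := ⟨D.comp_mem' h1 h2, hp, hr⟩
  have qs : D.Over ⟨(y, t), hyt⟩ q s := ⟨D.comp_mem' h2 h3, hq, hs⟩
  have ps : D.Over ⟨(x, t), hxt⟩ p s := ⟨D.comp_mem _ _ _ _ h1 h2 h3, hp, hs⟩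
  apply (lift ps).injective
  rw [lift_comp (⟨pr, rs, ps⟩ : Over₃ hxz hzt hxt p r s),
    lift_comp (⟨pq, qr, pr⟩ : Over₃ hxy hyz hxz p q r),
    lift_comp (⟨pq, qs, ps⟩ : Over₃ hxy hyt hxt p q s),
    lift_comp (⟨qr, rs, qs⟩ : Over₃ hyz hzt hyt q r s), LinearMap.comp_assoc]

/-- The descended bundle of homomorphisms. -/
def homDescent (D : V.DescentDomain) : V.HomDescent where
  U := D.U
  diag_mem z := by
    obtain ⟨p, rfl⟩ := AzumayaBundle.base_surjective (A := A) z
    exact D.base_mem (D.diag_mem p)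
  bundle := D.smoothFamilies.toBundle
  W := D.W
  isOpen_W := D.isOpen_W
  diag_mem_W := D.diag_mem
  base_mem := D.base_mem
  exists_mem_W := D.exists_mem
  O := {h | ‖SU.mat h - 1‖ < D.ε}
  O_mem := SU.mem_nhds_one_iff.2 ⟨D.ε, D.ε_pos, fun g g' h => by
    rw [Set.mem_ofPred_eq, SU.norm_mul_inv_sub_one]; exact h⟩
  related h h' h1 h2 := by
    obtain ⟨g, g', h3, h4⟩ := D.related (D.subset h) (D.subset h') h1 h2
    exact ⟨g, g', by rw [Set.mem_ofPred_eq, SU.norm_mul_inv_sub_one]; exact h3, h4⟩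
  lift h := lift (over_base h)
  lift_smooth k p p' h b v hp hb hv :=
    (D.smoothFamilies.smoothAlong_toBundle.1 hb).2 k id p p' (fun t => over_base (h t)) v
      contDiff_id hp hv
  lift_act h g g' h' hlt b v := by
    rw [Set.mem_ofPred_eq, SU.norm_mul_inv_sub_one] at hlt
    have h3 := D.ε_pos
    have := lift_tr (x := ⟨_, D.base_mem h⟩) (over_base h) (over_base h') (g := g) (g' := g') rfl rfl (by linarith) b v
    exact this
  comp := comp
  comp_smooth k x y z hxy hyz hxz b c hb hc :=
    D.smoothFamilies.smoothAlong_toBundle.2 (isSmooth_comp hxy hyz hxz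
      (D.smoothFamilies.smoothAlong_toBundle.1 hb) (D.smoothFamilies.smoothAlong_toBundle.1 hc))
  comp_assoc := comp_assoc
  lift_comp hpq hqr hpr b c := lift_comp ⟨over_base hpq, over_base hqr, over_base hpr⟩ b c

end DescentDomain

theorem nonempty_homDescent [T2Space Z] [CompactSpace Z] (V : EquivariantBundle.{u, v, w} A) :
    Nonempty V.HomDescent := by
  obtain ⟨D⟩ := V.nonempty_descentDomain
  exact ⟨D.homDescent⟩

end EquivariantBundle

end

/-! ### Arbitrary descents, and the identification with `A` on the diagonal -/

noncomputable section

open TopologicalSpace (Opens)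

variable {N d : ℕ} {Z : Type u} [TopologicalSpace Z] [ChartedSpace (EuclideanSpace ℝ (Fin d)) Z]
  [NeZero N] [IsManifold (𝓡 d) ∞ Z] {A : AzumayaBundle.{u, v} N d Z}

namespace EquivariantBundle.HomDescent

variable {V : EquivariantBundle.{u, v, w} A} (X : V.HomDescent)

/-- The isomorphism of the fibre at a point with the homomorphisms at a point of `W` above it. -/
def liftTo {z z' : Z} (hu : (z, z') ∈ X.U) {p p' : A.Triv} (h : (p, p') ∈ X.W) (h1 : p.base = z)
    (h2 : p'.base = z') : X.bundle.Fib ⟨(z, z'), hu⟩ ≃ₗ[ℂ] (V.Fib p' →ₗ[ℂ] V.Fib p) := by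
  subst h1 h2; exact X.lift h

variable {X}

theorem liftTo_tr {z z' : Z} {hu : (z, z') ∈ X.U} {p p' q q' : A.Triv} (h : (p, p') ∈ X.W)
    (h1 : p.base = z) (h2 : p'.base = z') (h' : (q, q') ∈ X.W) (h1' : q.base = z)
    (h2' : q'.base = z') {g g' : SU N} (hg : g • p = q) (hg' : g' • p' = q') (hO : g' * g⁻¹ ∈ X.O)
    (b : X.bundle.Fib ⟨(z, z'), hu⟩) (v : V.Fib p') :
    X.liftTo hu h' h1' h2' b (V.tr g' hg' v) = V.tr g hg (X.liftTo hu h h1 h2 b v) := by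
  subst h1 h2 hg hg'
  exact X.lift_act h h' hO b v

theorem liftTo_comp {x y z : Z} {hxy : (x, y) ∈ X.U} {hyz : (y, z) ∈ X.U} {hxz : (x, z) ∈ X.U}
    {p q r : A.Triv} (hpq : (p, q) ∈ X.W) (hqr : (q, r) ∈ X.W) (hpr : (p, r) ∈ X.W)
    (hp : p.base = x) (hq : q.base = y) (hr : r.base = z) (b : X.bundle.Fib ⟨(x, y), hxy⟩)
    (c : X.bundle.Fib ⟨(y, z), hyz⟩) :
    X.liftTo hxz hpr hp hr (X.comp hxy hyz hxz b c)
      = X.liftTo hxy hpq hp hq b ∘ₗ X.liftTo hyz hqr hq hr c := by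
  subst hp hq hr
  exact X.lift_comp hpq hqr hpr b c

theorem smoothAlong_liftTo {k : ℕ} {z z' : Param k → Z} {hu : ∀ t, (z t, z' t) ∈ X.U}
    {p p' : Param k → A.Triv} (h : ∀ t, (p t, p' t) ∈ X.W) (h1 : ∀ t, (p t).base = z t)
    (h2 : ∀ t, (p' t).base = z' t) (hp : ContMDiff (𝓡 k) 𝓘(ℝ, AzumayaBundle.TrivModel N d) ∞ p)
    {b : ∀ t, X.bundle.Fib ⟨(z t, z' t), hu t⟩} (hb : X.bundle.SmoothAlong _ b)
    {v : ∀ t, V.Fib (p' t)} (hv : V.SmoothAlong p' v) :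
    V.SmoothAlong p fun t => X.liftTo (hu t) (h t) (h1 t) (h2 t) (b t) (v t) := by
  obtain rfl : (fun t => (p t).base) = z := funext h1
  obtain rfl : (fun t => (p' t).base) = z' := funext h2
  exact X.lift_smooth k p p' h b v hp hb hv

/-- A converse to `lift_smooth`, valid for every descent: in frames the lifts form a smooth family
of invertible matrices. -/
theorem smoothAlong_of_liftTo {k : ℕ} {z z' : Param k → Z} {hu : ∀ t, (z t, z' t) ∈ X.U}
    {p p' : Param k → A.Triv} (h : ∀ t, (p t, p' t) ∈ X.W) (h1 : ∀ t, (p t).base = z t)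
    (h2 : ∀ t, (p' t).base = z' t) (hp : ContMDiff (𝓡 k) 𝓘(ℝ, AzumayaBundle.TrivModel N d) ∞ p)
    (hp' : ContMDiff (𝓡 k) 𝓘(ℝ, AzumayaBundle.TrivModel N d) ∞ p')
    {b : ∀ t, X.bundle.Fib ⟨(z t, z' t), hu t⟩}
    (hb : ∀ (ψ : Param k → Param k) (v : ∀ t, V.Fib (p' (ψ t))), ContDiff ℝ ∞ ψ →
      V.SmoothAlong (fun t => p' (ψ t)) v → V.SmoothAlong (fun t => p (ψ t))
        fun t => X.liftTo (hu (ψ t)) (h (ψ t)) (h1 (ψ t)) (h2 (ψ t)) (b (ψ t)) (v t)) :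
    X.bundle.SmoothAlong (fun t => ⟨(z t, z' t), hu t⟩) b := by
  have hz : ContMDiff (𝓡 k) (𝓡 d) ∞ z := by
    have := AzumayaBundle.contMDiff_base.comp hp
    exact this.congr fun t => (h1 t).symm
  have hz' : ContMDiff (𝓡 k) (𝓡 d) ∞ z' := by
    have := AzumayaBundle.contMDiff_base.comp hp'
    exact this.congr fun t => (h2 t).symm
  have hx : ContMDiff (𝓡 k) ((𝓡 d).prod (𝓡 d)) ∞ fun t => (⟨(z t, z' t), hu t⟩ : X.U) :=
    contMDiff_opens_iff.2 (hz.prodMk hz')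
  refine SmoothBundle.smoothAlong_of_local fun t₀ => ?_
  obtain ⟨s, hs, hc⟩ := X.bundle.exists_frame hx t₀
  obtain ⟨s₁, hs₁, hd⟩ := V.exists_frame hp t₀
  obtain ⟨s₂, hs₂, hd'⟩ := V.exists_frame hp' t₀
  refine ⟨_, inter_mem hs (inter_mem hs₁ hs₂), fun ψ hψ hψs => ?_⟩
  obtain ⟨c⟩ := hc k ψ hψ fun t => (hψs t).1
  obtain ⟨e⟩ := hd k ψ hψ fun t => (hψs t).2.1
  obtain ⟨e'⟩ := hd' k ψ hψ fun t => (hψs t).2.2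
  exact SmoothBundle.smoothAlong_of_equiv_hom c e e'
    (fun t => X.liftTo (hu (ψ t)) (h (ψ t)) (h1 (ψ t)) (h2 (ψ t)))
    (fun v w hv hw => smoothAlong_liftTo (z := fun t => z (ψ t)) (z' := fun t => z' (ψ t)) _ _ _
      (hp.comp hψ.contMDiff) hv hw) fun w hw => hb ψ w hψ hw

end EquivariantBundle.HomDescent

namespace RepresentingBundle

variable (V : RepresentingBundle.{u, v, w} A)

/-- The representation of the fibre of `A` at a point on the fibre of `V` at a point above it. -/
def repTo {z : Z} {p : A.Triv} (h : p.base = z) : A.Fib z ≃ₐ[ℂ] Module.End ℂ (V.Fib p) := by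
  subst h; exact V.rep p

variable {V}

theorem repTo_tr {z : Z} {p q : A.Triv} (h : p.base = z) (h' : q.base = z) {g : SU N}
    (hg : g • p = q) (a : A.Fib z) (v : V.Fib p) :
    V.repTo h' a (V.tr g hg v) = V.tr g hg (V.repTo h a v) := by
  subst h hg
  exact V.rep_act g p a v

theorem smoothAlong_repTo {k : ℕ} {z : Param k → Z} {p : Param k → A.Triv}
    (h : ∀ t, (p t).base = z t) {a : ∀ t, A.Fib (z t)} {v : ∀ t, V.Fib (p t)}
    (ha : A.SmoothAlong z a) (hv : V.SmoothAlong p v) :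
    V.SmoothAlong p fun t => V.repTo (h t) (a t) (v t) := by
  obtain rfl : (fun t => (p t).base) = z := funext h
  exact V.rep_smooth k p a v ha hv

variable (X : V.toEquivariantBundle.HomDescent)

/-- The isomorphism of `A` with the descended bundle on the diagonal. -/
def diagIso (z : Z) : A.Fib z ≃ₗ[ℂ] X.bundle.Fib ⟨(z, z), X.diag_mem z⟩ :=
  (V.repTo (AzumayaBundle.base_surjective z).choose_spec).toLinearEquiv.trans
    (X.liftTo (X.diag_mem z) (X.diag_mem_W _) (AzumayaBundle.base_surjective z).choose_spec
      (AzumayaBundle.base_surjective z).choose_spec).symm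

/-- Two diagonal pairs over `z` are related by `(g, g)`, and `g * g⁻¹ = 1` lies in `O`. Both the
lift and the representation are equivariant under this pair, so the point chosen in the definition
does not matter. -/
theorem liftTo_diagIso {z : Z} {p : A.Triv} (h : p.base = z) (a : A.Fib z) :
    X.liftTo (X.diag_mem z) (X.diag_mem_W p) h h (diagIso X z a) = V.repTo h a := by
  obtain ⟨q, hq, he⟩ : ∃ (q : A.Triv) (hq : q.base = z),
      X.liftTo (X.diag_mem z) (X.diag_mem_W q) hq hq (diagIso X z a) = V.repTo hq a :=
    ⟨_, (AzumayaBundle.base_surjective z).choose_spec, LinearEquiv.apply_symm_apply _ _⟩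
  obtain ⟨g, hg⟩ := AzumayaBundle.exists_smul_eq (p := q) (q := p) (hq.trans h.symm)
  have h1 : g * g⁻¹ ∈ X.O := by rw [mul_inv_cancel]; exact mem_of_mem_nhds X.O_mem
  refine LinearMap.ext fun v => ?_
  obtain ⟨w, rfl⟩ : ∃ w, V.tr g hg w = v := ⟨_, (V.trEquiv g hg).apply_symm_apply v⟩
  rw [X.liftTo_tr (X.diag_mem_W q) hq hq (X.diag_mem_W p) h h hg hg h1, he]
  exact (repTo_tr hq h hg a w).symm

/-- A descent of the homomorphisms of a representing bundle is an extension of `A`. -/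
def extension : V.Extension where
  toHomDescent := X
  diag := diagIso X
  diag_smooth k z a ha := by
    have hz : ContMDiff (𝓡 k) (𝓡 d) ∞ z := fun t => (Bundle.contMDiffAt_totalSpace.1 (ha t)).1
    refine SmoothBundle.smoothAlong_of_local fun t₀ => ?_
    obtain ⟨p₀, h₀⟩ := AzumayaBundle.base_surjective (A := A) (z t₀)
    obtain ⟨p, -, hp, -, s, hs, hps⟩ := AzumayaBundle.exists_smooth_section hz h₀
    refine ⟨s, hs, fun ψ hψ hψs => ?_⟩
    refine X.smoothAlong_of_liftTo (p := fun t => p (ψ t)) (fun t => X.diag_mem_W _)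
      (fun t => hp (ψ t)) (fun t => hp (ψ t)) (hps k ψ hψ hψs) (hps k ψ hψ hψs)
      fun θ v hθ hv => ?_
    simp only [liftTo_diagIso]
    have ha' : A.SmoothAlong (fun t => z (ψ (θ t))) fun t => a (ψ (θ t)) :=
      ContMDiff.comp (g := fun t => (⟨z t, a t⟩ : A.Total)) ha (hψ.comp hθ).contMDiff
    exact smoothAlong_repTo _ ha' hv
  diag_mul z a b := by
    obtain ⟨p, h⟩ := AzumayaBundle.base_surjective (A := A) z
    apply (X.liftTo (X.diag_mem z) (X.diag_mem_W p) h h).injective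
    rw [X.liftTo_comp (X.diag_mem_W p) (X.diag_mem_W p) (X.diag_mem_W p) h h h, liftTo_diagIso,
      liftTo_diagIso, liftTo_diagIso, map_mul]
    rfl
  lift_diag p a := liftTo_diagIso X rfl a

theorem nonempty_extension [T2Space Z] [CompactSpace Z] (V : RepresentingBundle.{u, v, w} A) :
    Nonempty V.Extension := by
  obtain ⟨X⟩ := V.nonempty_homDescent
  exact ⟨extension X⟩

end RepresentingBundle

end

/-! ### The line bundle of intertwiners -/

noncomputable section

open TopologicalSpace (Opens)

/-- Complex numbers as vectors of length one. -/
def cvecOne : ℂ ≃ₗ[ℂ] Cvec 1 :=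
  (LinearEquiv.funUnique (Fin 1) ℂ ℂ).symm.trans (WithLp.linearEquiv 2 ℂ (Fin 1 → ℂ)).symm

theorem contDiff_cvecOne_iff {k : ℕ} {f : Param k → ℂ} :
    ContDiff ℝ ∞ (fun t => cvecOne (f t)) ↔ ContDiff ℝ ∞ f :=
  (cvecOne.restrictScalars ℝ).toContinuousLinearEquiv.comp_contDiff_iff

variable {N d : ℕ} {Z : Type u} [TopologicalSpace Z] [ChartedSpace (EuclideanSpace ℝ (Fin d)) Z]
  [NeZero N] [IsManifold (𝓡 d) ∞ Z] {A : AzumayaBundle.{u, v} N d Z}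

theorem MatAlg.exists_apply_eq_e0 {v : Cvec N} (hv : v ≠ 0) : ∃ m : MatAlg N, m v = MatAlg.e0 N := by
  refine ⟨(inner ℂ v v)⁻¹ • MatAlg.rankOneL v (MatAlg.e0 N), ?_⟩
  rw [MatAlg.smul_apply, MatAlg.rankOneL_apply, smul_smul,
    inv_mul_cancel₀ (inner_self_ne_zero.2 hv), one_smul]

/-- The matrix `col e₀` is a minimal idempotent; this is the source of the one-dimensionality of the
intertwiners. -/
theorem MatAlg.col_mul_mul_col (m : MatAlg N) :
    MatAlg.col (MatAlg.e0 N) * m * MatAlg.col (MatAlg.e0 N)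
      = (inner ℂ (MatAlg.e0 N) (m (MatAlg.e0 N)) : ℂ) • MatAlg.col (MatAlg.e0 N) := by
  rw [mul_assoc, MatAlg.mul_col, MatAlg.mul_col, ← map_smul]
  rfl

namespace RepresentingBundle

variable (V : RepresentingBundle.{u, v, w} A)

/-- The representation of the matrix algebra on the fibres. -/
def matRep (p : A.Triv) : MatAlg N ≃ₐ[ℂ] Module.End ℂ (V.Fib p) :=
  p.iso.symm.toAlgEquiv.trans (V.rep p)

theorem matRep_apply (p : A.Triv) (m : MatAlg N) : V.matRep p m = V.rep p (p.iso.symm m) := rfl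

theorem matRep_iso (p : A.Triv) (a : A.Fib p.base) : V.matRep p (p.iso a) = V.rep p a := by
  rw [matRep_apply, StarAlgEquiv.symm_apply_apply]

theorem smoothAlong_matRep {k : ℕ} {p : Param k → A.Triv} {m : Param k → MatAlg N}
    (hm : ContDiff ℝ ∞ m) {x : ∀ t, V.Fib (p t)} (hx : V.SmoothAlong p x) :
    V.SmoothAlong p fun t => V.matRep (p t) (m t) (x t) :=
  V.rep_smooth k p _ x (AzumayaBundle.smoothAlong_iso_symm hx.base hm) hx

/-- The linear maps `ℂᴺ → V_p` which intertwine the representations of `A`. -/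
def intertwiners (p : A.Triv) : Submodule ℂ (Cvec N →ₗ[ℂ] V.Fib p) where
  carrier := {f | ∀ (m : MatAlg N) (x : Cvec N), f (m x) = V.matRep p m (f x)}
  add_mem' hf hg m x := by
    rw [LinearMap.add_apply, LinearMap.add_apply, hf, hg, map_add]
  zero_mem' m x := by rw [LinearMap.zero_apply, LinearMap.zero_apply, map_zero]
  smul_mem' c f hf m x := by rw [LinearMap.smul_apply, LinearMap.smul_apply, hf, map_smul]

/-- The fibres of the line bundle of intertwiners. -/
abbrev LineFib (p : A.Triv) : Type w := V.intertwiners p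

variable {V}

theorem intertwiner_apply {p : A.Triv} (f : V.LineFib p) (m : MatAlg N) (x : Cvec N) :
    (f : Cvec N →ₗ[ℂ] V.Fib p) (m x) = V.matRep p m ((f : Cvec N →ₗ[ℂ] V.Fib p) x) := f.2 m x

/-- Since `x = col x e₀`, the value at `e₀` determines an intertwiner. It is used below as its
coordinate and as the test of smoothness. -/
theorem intertwiner_eq {p : A.Triv} (f : V.LineFib p) (x : Cvec N) :
    (f : Cvec N →ₗ[ℂ] V.Fib p) x
      = V.matRep p (MatAlg.col x) ((f : Cvec N →ₗ[ℂ] V.Fib p) (MatAlg.e0 N)) := by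
  rw [← intertwiner_apply, MatAlg.col_e0]

theorem intertwiner_ext {p : A.Triv} {f g : V.LineFib p}
    (h : (f : Cvec N →ₗ[ℂ] V.Fib p) (MatAlg.e0 N) = (g : Cvec N →ₗ[ℂ] V.Fib p) (MatAlg.e0 N)) :
    f = g :=
  Subtype.ext (LinearMap.ext fun x => by rw [intertwiner_eq, h, ← intertwiner_eq])

/-- Some matrix carries `x` to `e₀`, so an intertwiner that vanishes at `x` vanishes at `e₀`, hence
everywhere. -/
theorem intertwiner_ne_zero {p : A.Triv} {f : V.LineFib p} (hf : f ≠ 0) {x : Cvec N} (hx : x ≠ 0) :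
    (f : Cvec N →ₗ[ℂ] V.Fib p) x ≠ 0 := by
  intro h
  obtain ⟨m, hm⟩ := MatAlg.exists_apply_eq_e0 hx
  refine hf (intertwiner_ext ?_)
  rw [← hm, intertwiner_apply, h, map_zero]
  rfl

theorem e0_ne_zero : MatAlg.e0 N ≠ 0 := fun h => by
  have := MatAlg.inner_e0 (N := N)
  rw [h, inner_zero_left] at this
  exact zero_ne_one this

variable (V)

/-- The intertwiner defined by a vector. -/
def intertwiner (p : A.Triv) (s : V.Fib p) : V.LineFib p :=
  ⟨{ toFun x := V.matRep p (MatAlg.col x) s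
     map_add' x y := by rw [map_add, map_add]; rfl
     map_smul' c x := by rw [map_smul, map_smul]; rfl },
    fun m x => by
      change V.matRep p (MatAlg.col (m x)) s = V.matRep p m (V.matRep p (MatAlg.col x) s)
      rw [← MatAlg.mul_col, map_mul]; rfl⟩

theorem intertwiner_coe (p : A.Triv) (s : V.Fib p) (x : Cvec N) :
    (V.intertwiner p s : Cvec N →ₗ[ℂ] V.Fib p) x = V.matRep p (MatAlg.col x) s := rfl

/-- Otherwise the nonzero matrix `col e₀` would act as zero on `V_p`, although the representation is
faithful. -/
theorem exists_intertwiner_ne_zero (p : A.Triv) : ∃ s, V.intertwiner p s ≠ 0 := by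
  by_contra! h
  have h1 : V.matRep p (MatAlg.col (MatAlg.e0 N)) = 0 := by
    refine LinearMap.ext fun s => ?_
    rw [← intertwiner_coe, h]; rfl
  rw [map_eq_zero_iff _ (V.matRep p).injective] at h1
  have h2 := congrArg (fun m : MatAlg N => m (MatAlg.e0 N)) h1
  simp only [MatAlg.col_e0, MatAlg.zero_apply] at h2
  exact e0_ne_zero h2

variable {V}

/-- Intertwiners are multiples of a given one, with the factor given by a linear form. -/
theorem smul_intertwiner_eq {p : A.Triv} {s : V.Fib p} {φ : V.Fib p →ₗ[ℂ] ℂ}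
    (h : φ ((V.intertwiner p s : Cvec N →ₗ[ℂ] V.Fib p) (MatAlg.e0 N)) ≠ 0) (f : V.LineFib p) :
    f = (φ ((f : Cvec N →ₗ[ℂ] V.Fib p) (MatAlg.e0 N)) *
      (φ ((V.intertwiner p s : Cvec N →ₗ[ℂ] V.Fib p) (MatAlg.e0 N)))⁻¹) • V.intertwiner p s := by
  set y := (V.intertwiner p s : Cvec N →ₗ[ℂ] V.Fib p) (MatAlg.e0 N) with hy
  set x := (f : Cvec N →ₗ[ℂ] V.Fib p) (MatAlg.e0 N) with hx
  -- As the representation is onto all endomorphisms, some matrix acts as the rank one operator that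
  -- takes `y` to `x`.
  obtain ⟨m, hm⟩ := (V.matRep p).surjective ((φ y)⁻¹ • φ.smulRight x)
  have h1 : V.matRep p m y = x := by
    rw [hm, LinearMap.smul_apply, LinearMap.smulRight_apply, smul_smul, inv_mul_cancel₀ h, one_smul]
  -- With `e = col e₀`, both `x = e x` and `y = e s` hold in the representation; hence `x = e m e
  -- s`, and `e m e = μ e`.
  have h2 : ∃ μ : ℂ, x = μ • y := by
    refine ⟨inner ℂ (MatAlg.e0 N) (m (MatAlg.e0 N)), ?_⟩
    have h3 : x = V.matRep p (MatAlg.col (MatAlg.e0 N)) x := intertwiner_eq f _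
    rw [h3, ← h1, hy, intertwiner_coe, ← Module.End.mul_apply, ← Module.End.mul_apply, ← map_mul,
      ← map_mul, MatAlg.col_mul_mul_col, map_smul, LinearMap.smul_apply]
  obtain ⟨μ, hμ⟩ := h2
  refine intertwiner_ext ?_
  rw [← hx, hμ, map_smul, smul_eq_mul, mul_assoc, mul_inv_cancel₀ h, mul_one]
  rfl

/-- Smooth families of intertwiners. -/
def LineSmooth {k : ℕ} (p : Param k → A.Triv) (f : ∀ t, V.LineFib (p t)) : Prop :=
  V.SmoothAlong p fun t => (f t : Cvec N →ₗ[ℂ] V.Fib (p t)) (MatAlg.e0 N)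

theorem LineSmooth.apply {k : ℕ} {p : Param k → A.Triv} {f : ∀ t, V.LineFib (p t)}
    (hf : LineSmooth p f) {x : Param k → Cvec N} (hx : ContDiff ℝ ∞ x) :
    V.SmoothAlong p fun t => (f t : Cvec N →ₗ[ℂ] V.Fib (p t)) (x t) := by
  refine SmoothBundle.smoothAlong_congr
    (fun t => congrArg (TotalSpace.mk (p t)) (intertwiner_eq (f t) (x t)).symm)
    (V.smoothAlong_matRep ?_ hf)
  exact ((LinearMap.toContinuousLinearMap (MatAlg.col (N := N))).restrictScalars ℝ).contDiff.comp hx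

/-- A vector with nonzero intertwiner at `p₀` is extended with constant coordinates. Its intertwiner
stays nonzero nearby, as detected by a fixed linear form `φ`, and `φ (f e₀)` is then a coordinate on
the intertwiners. -/
theorem exists_line_coord (p₀ : A.Triv) : ∃ O ∈ 𝓝 p₀, ∃ c : ∀ p, p ∈ O → (V.LineFib p ≃ₗ[ℂ] Cvec 1),
    ∀ (k : ℕ) (p : Param k → A.Triv) (h : ∀ t, p t ∈ O),
      ContMDiff (𝓡 k) 𝓘(ℝ, AzumayaBundle.TrivModel N d) ∞ p → ∀ f : ∀ t, V.LineFib (p t),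
        (LineSmooth p f ↔ ContDiff ℝ ∞ fun t => c (p t) (h t) (f t)) := by
  obtain ⟨s₀, hs₀⟩ := V.exists_intertwiner_ne_zero p₀
  set B := (trivializationAt (Cvec V.rank) V.Fib p₀).baseSet with hB
  have hB₀ : B ∈ 𝓝 p₀ := V.baseSet_mem_nhds p₀
  let s : ∀ p, p ∈ B → V.Fib p := fun p h =>
    (V.coord p₀ h).symm (V.coord p₀ (mem_of_mem_nhds hB₀) s₀)
  let y : ∀ p, p ∈ B → Cvec V.rank := fun p h =>
    V.coord p₀ h ((V.intertwiner p (s p h) : Cvec N →ₗ[ℂ] V.Fib p) (MatAlg.e0 N))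
  have hy : ∀ (k : ℕ) (p : Param k → A.Triv) (h : ∀ t, p t ∈ B),
      ContMDiff (𝓡 k) 𝓘(ℝ, AzumayaBundle.TrivModel N d) ∞ p → ContDiff ℝ ∞ fun t => y (p t) (h t) := by
    intro k p h hp
    refine ((V.smoothAlong_iff_coord h).1 (V.smoothAlong_matRep contDiff_const
      ((V.smoothAlong_iff_coord h).2 ⟨hp, ?_⟩))).2
    simpa [s] using contDiff_const
  have hy₀ : y p₀ (mem_of_mem_nhds hB₀) ≠ 0 := by
    simp only [y, s, LinearEquiv.symm_apply_apply]
    rw [LinearEquiv.map_ne_zero_iff]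
    exact intertwiner_ne_zero hs₀ e0_ne_zero
  -- The inner product with the value at `p₀` itself, hence nonzero on that value.
  let φ : Cvec V.rank →ₗ[ℂ] ℂ := (innerSL ℂ (y p₀ (mem_of_mem_nhds hB₀)) : Cvec V.rank →L[ℂ] ℂ)
  have hφ : ContDiff ℝ ∞ φ :=
    ((innerSL ℂ (y p₀ (mem_of_mem_nhds hB₀)) : Cvec V.rank →L[ℂ] ℂ).restrictScalars ℝ).contDiff
  let O : Set A.Triv := {p | ∃ h : p ∈ B, φ (y p h) ≠ 0}
  have hO : O ∈ 𝓝 p₀ := by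
    obtain ⟨k, q, ρ, h1, h2, h3, h4⟩ :=
      exists_plot (I := 𝓘(ℝ, AzumayaBundle.TrivModel N d)) p₀ hB₀
    have h5 : ContinuousAt (fun p => φ (y (q (ρ p)) (h2 _))) p₀ :=
      ContinuousAt.comp (g := fun t => φ (y (q t) (h2 _)))
        (hφ.comp (hy k q h2 h1)).continuous.continuousAt h3.continuousAt
    have h6 : φ (y (q (ρ p₀)) (h2 _)) ≠ 0 := by
      have : ∀ p (h : p ∈ B), p = p₀ → φ (y p h) ≠ 0 := by
        rintro _ _ rfl
        exact inner_self_ne_zero.2 hy₀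
      exact this _ _ h4.self_of_nhds
    filter_upwards [h4, h5.eventually_ne h6] with p hp hne
    have : ∀ p' (h : p' ∈ B), p' = p → φ (y p' h) ≠ 0 → p ∈ O := by
      rintro _ h rfl h'
      exact ⟨h, h'⟩
    exact this _ _ hp hne
  have hne : ∀ p (h : p ∈ O), φ (y p h.1) ≠ 0 := fun p h => h.2
  let ev : ∀ p, p ∈ B → (V.LineFib p →ₗ[ℂ] ℂ) := fun p h =>
    φ ∘ₗ (V.coord p₀ h : V.Fib p →ₗ[ℂ] Cvec V.rank) ∘ₗ
      (LinearMap.applyₗ (MatAlg.e0 N)) ∘ₗ (V.intertwiners p).subtype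
  have hev : ∀ p (h : p ∈ B) (f : V.LineFib p), ev p h f
      = φ (V.coord p₀ h ((f : Cvec N →ₗ[ℂ] V.Fib p) (MatAlg.e0 N))) := fun _ _ _ => rfl
  have hf : ∀ p (h : p ∈ O) (f : V.LineFib p),
      f = (ev p h.1 f * (φ (y p h.1))⁻¹) • V.intertwiner p (s p h.1) := fun p h f =>
    smul_intertwiner_eq (φ := φ ∘ₗ (V.coord p₀ h.1 : V.Fib p →ₗ[ℂ] Cvec V.rank)) (hne p h) f
  let c : ∀ p, p ∈ O → (V.LineFib p ≃ₗ[ℂ] ℂ) := fun p h => LinearEquiv.ofBijective (ev p h.1) (by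
    refine ⟨(injective_iff_map_eq_zero _).2 fun f h0 => ?_, fun z => ?_⟩
    · rw [hf p h f, h0, zero_mul, zero_smul]
    · refine ⟨(z * (φ (y p h.1))⁻¹) • V.intertwiner p (s p h.1), ?_⟩
      rw [map_smul, smul_eq_mul, mul_assoc]
      exact (congrArg (z * ·) (inv_mul_cancel₀ (hne p h))).trans (mul_one z))
  have hc : ∀ p (h : p ∈ O) f, c p h f = ev p h.1 f := fun _ _ _ => rfl
  refine ⟨O, hO, fun p h => (c p h).trans cvecOne, fun k p h hp f => ?_⟩
  refine Iff.trans ?_ (contDiff_cvecOne_iff (f := fun t => c (p t) (h t) (f t))).symm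
  simp only [hc, hev]
  refine (V.smoothAlong_iff_coord fun t => (h t).1).trans ⟨fun h1 => hφ.comp h1.2,
    fun h1 => ⟨hp, ?_⟩⟩
  have h2 := hy k p (fun t => (h t).1) hp
  have h3 : ContDiff ℝ ∞ fun t => (φ (y (p t) (h t).1))⁻¹ :=
    (hφ.comp h2).inv fun t => hne _ (h t)
  refine contDiff_congr ((h1.mul h3).smul h2) fun t => ?_
  conv_lhs => rw [hf (p t) (h t) (f t)]
  rw [Submodule.coe_smul, LinearMap.smul_apply, map_smul]
  rfl

variable (V) in
/-- The smooth families of intertwiners. -/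
def lineFamilies : SmoothFamilies 𝓘(ℝ, AzumayaBundle.TrivModel N d) V.LineFib where
  rank := 1
  Smooth := LineSmooth
  base h := SmoothBundle.SmoothAlong.base h
  comp h hψ := SmoothBundle.SmoothAlong.comp h hψ
  of_local h := SmoothBundle.smoothAlong_of_local fun t₀ => by
    obtain ⟨s, hs, h⟩ := h t₀
    exact ⟨s, hs, fun ψ hψ hψs => h _ ψ hψ hψs⟩
  coord := exists_line_coord

end RepresentingBundle

end

/-! ### The equivariant structure of the line bundle and the factorization of `V` -/

noncomputable section

open TopologicalSpace (Opens)

variable {N d : ℕ} {Z : Type u} [TopologicalSpace Z] [ChartedSpace (EuclideanSpace ℝ (Fin d)) Z]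
  [NeZero N] [IsManifold (𝓡 d) ∞ Z] {A : AzumayaBundle.{u, v} N d Z}

namespace RepresentingBundle

variable (V : RepresentingBundle.{u, v, w} A)

theorem matRep_smul (g : SU N) (p : A.Triv) (m : MatAlg N) (x : V.Fib p) :
    V.matRep (g • p) m (V.act g p x)
      = V.act g p (V.matRep p (star (SU.mat g) * m * SU.mat g) x) := by
  rw [matRep_apply, AzumayaBundle.smul_iso_symm_apply]
  exact V.rep_act g p _ x

/-- The action of `SU(N)` on intertwiners. -/
def lineAct (g : SU N) (p : A.Triv) : V.LineFib p →ₗ[ℂ] V.LineFib (g • p) where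
  toFun f := ⟨V.act g p ∘ₗ (f : Cvec N →ₗ[ℂ] V.Fib p) ∘ₗ MatAlg.toEnd N (SU.mat g⁻¹), fun m x => by
    change V.act g p ((f : Cvec N →ₗ[ℂ] V.Fib p) (SU.mat g⁻¹ (m x)))
      = V.matRep (g • p) m (V.act g p ((f : Cvec N →ₗ[ℂ] V.Fib p) (SU.mat g⁻¹ x)))
    rw [matRep_smul, ← intertwiner_apply, ← MatAlg.mul_apply, ← MatAlg.mul_apply, SU.mat_inv,
      mul_assoc _ (SU.mat g), SU.mul_star_self, mul_one]⟩
  map_add' f f' := Subtype.ext (LinearMap.ext fun x => map_add (V.act g p) _ _)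
  map_smul' c f := Subtype.ext (LinearMap.ext fun x => map_smul (V.act g p) _ _)

variable {V}

theorem lineAct_apply (g : SU N) (p : A.Triv) (f : V.LineFib p) (x : Cvec N) :
    (V.lineAct g p f : Cvec N →ₗ[ℂ] V.Fib (g • p)) x
      = V.act g p ((f : Cvec N →ₗ[ℂ] V.Fib p) (SU.mat g⁻¹ x)) := rfl

theorem line_mk_eq {F : Type*} {p q : A.Triv} (h : p = q) {f : V.LineFib p} {f' : V.LineFib q}
    (hf : ∀ x, (⟨p, (f : Cvec N →ₗ[ℂ] V.Fib p) x⟩ : TotalSpace (Cvec V.rank) V.Fib)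
      = ⟨q, (f' : Cvec N →ₗ[ℂ] V.Fib q) x⟩) :
    (⟨p, f⟩ : TotalSpace F V.LineFib) = ⟨q, f'⟩ := by
  subst h
  congr 1
  exact Subtype.ext (LinearMap.ext fun x => EquivariantBundle.mk_inj (hf x))

theorem lineAct_one {F : Type*} (p : A.Triv) (f : V.LineFib p) :
    (⟨(1 : SU N) • p, V.lineAct 1 p f⟩ : TotalSpace F V.LineFib) = ⟨p, f⟩ := by
  refine line_mk_eq (one_smul _ p) fun x => ?_
  rw [lineAct_apply, inv_one, SU.mat_one]
  exact V.act_one p _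

theorem lineAct_mul {F : Type*} (g h : SU N) (p : A.Triv) (f : V.LineFib p) :
    (⟨(g * h) • p, V.lineAct (g * h) p f⟩ : TotalSpace F V.LineFib)
      = ⟨g • h • p, V.lineAct g (h • p) (V.lineAct h p f)⟩ := by
  refine line_mk_eq (mul_smul g h p) fun x => ?_
  rw [lineAct_apply, lineAct_apply, lineAct_apply, mul_inv_rev, SU.mat_mul]
  exact V.act_mul g h p _

theorem lineAct_center {F : Type*} (c : SU N) (ζ : ℂ) (hc : SU.mat c = ζ • 1) (p : A.Triv) :
    ∃ χ : ℂ, ∀ f : V.LineFib p,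
      (⟨c • p, V.lineAct c p f⟩ : TotalSpace F V.LineFib) = ⟨p, χ • f⟩ := by
  obtain ⟨χ, hχ⟩ := V.act_center c ζ hc p
  -- The action on intertwiners is by conjugation: `V` contributes `χ`, and the inverse of `c` on
  -- `ℂᴺ` contributes the conjugate of `ζ`.
  refine ⟨χ * star ζ, fun f => line_mk_eq
    (AzumayaBundle.smul_eq_of_isCentral ⟨ζ, hc⟩ p) fun x => ?_⟩
  rw [lineAct_apply]
  refine (hχ _).trans (congrArg (TotalSpace.mk p) ?_)
  rw [SU.mat_inv, hc, star_smul, star_one, MatAlg.smul_apply, MatAlg.one_apply, map_smul,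
    smul_smul]
  rfl

theorem LineSmooth.act {k : ℕ} {g : Param k → SU N} {p : Param k → A.Triv}
    {f : ∀ t, V.LineFib (p t)} (hg : ContDiff ℝ ∞ fun t => SU.mat (g t)) (hf : LineSmooth p f) :
    LineSmooth (fun t => g t • p t) fun t => V.lineAct (g t) (p t) (f t) := by
  have h2 : ContDiff ℝ ∞ fun t => SU.mat (g t)⁻¹ :=
    (starL' ℝ : MatAlg N ≃L[ℝ] MatAlg N).contDiff.comp hg
  exact V.act_smooth _ g p _ hg (hf.apply (MatAlg.contDiff_apply h2 contDiff_const))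

variable (V)

/-- The line bundle of intertwiners of the standard bundle and a representing bundle. -/
def line : EquivariantLineBundle.{u, v, w} A where
  toSmoothBundle := V.lineFamilies.toBundle
  act := V.lineAct
  act_one := lineAct_one
  act_mul := lineAct_mul
  act_smooth _ _ _ _ hg hf := V.lineFamilies.smoothAlong_toBundle.2
    (LineSmooth.act hg (V.lineFamilies.smoothAlong_toBundle.1 hf))
  act_center := lineAct_center
  rank_eq_one := rfl

variable {V}

theorem line_smoothAlong_iff {k : ℕ} {p : Param k → A.Triv} {f : ∀ t, V.LineFib (p t)} :
    V.line.SmoothAlong p f ↔ LineSmooth p f := V.lineFamilies.smoothAlong_toBundle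

variable (V)

/-- The evaluation of intertwiners. -/
def lineEval (p : A.Triv) : V.LineFib p ⊗[ℂ] Cvec N →ₗ[ℂ] V.Fib p :=
  TensorProduct.lift (V.intertwiners p).subtype

theorem lineEval_tmul (p : A.Triv) (f : V.LineFib p) (x : Cvec N) :
    V.lineEval p (f ⊗ₜ x) = (f : Cvec N →ₗ[ℂ] V.Fib p) x := rfl

/-- As all intertwiners are multiples of one `f₀ ≠ 0`, every tensor has the form `f₀ ⊗ y`.
Injectivity of evaluation is then injectivity of `f₀`; surjectivity holds because matrices act
through all endomorphisms of `V_p`. -/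
theorem lineEval_bijective (p : A.Triv) : Function.Bijective (V.lineEval p) := by
  obtain ⟨s, hs⟩ := V.exists_intertwiner_ne_zero p
  have h0 := intertwiner_ne_zero hs e0_ne_zero
  set f₀ := V.intertwiner p s with hf₀
  obtain ⟨φ, hφ⟩ : ∃ φ : V.Fib p →ₗ[ℂ] ℂ, φ ((f₀ : Cvec N →ₗ[ℂ] V.Fib p) (MatAlg.e0 N)) ≠ 0 :=
    not_forall.1 (mt (Module.forall_dual_apply_eq_zero_iff ℂ _).1 h0)
  have h1 : ∀ x : V.LineFib p ⊗[ℂ] Cvec N, ∃ y : Cvec N, x = f₀ ⊗ₜ y := by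
    intro x
    induction x using TensorProduct.induction_on with
    | zero => exact ⟨0, (TensorProduct.tmul_zero _ _).symm⟩
    | tmul f y => exact ⟨_, (congrArg (· ⊗ₜ[ℂ] y) (smul_intertwiner_eq hφ f)).trans
        (TensorProduct.smul_tmul _ _ _)⟩
    | add x x' h h' =>
      obtain ⟨y, rfl⟩ := h
      obtain ⟨y', rfl⟩ := h'
      exact ⟨y + y', (TensorProduct.tmul_add _ _ _).symm⟩
  refine ⟨(injective_iff_map_eq_zero _).2 fun x hx => ?_, fun z => ?_⟩
  · obtain ⟨y, rfl⟩ := h1 x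
    rw [lineEval_tmul] at hx
    obtain rfl : y = 0 := by
      by_contra hy
      exact intertwiner_ne_zero hs hy hx
    exact TensorProduct.tmul_zero _ _
  · obtain ⟨m, hm⟩ := (V.matRep p).surjective
      ((φ ((f₀ : Cvec N →ₗ[ℂ] V.Fib p) (MatAlg.e0 N)))⁻¹ • φ.smulRight z)
    refine ⟨f₀ ⊗ₜ m (MatAlg.e0 N), ?_⟩
    rw [lineEval_tmul, intertwiner_apply, hm, LinearMap.smul_apply, LinearMap.smulRight_apply,
      smul_smul, inv_mul_cancel₀ hφ, one_smul]

theorem lineEval_act (g : SU N) (p : A.Triv) (f : V.LineFib p) (x : Cvec N) :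
    V.lineEval (g • p) (V.lineAct g p f ⊗ₜ SU.mat g x) = V.act g p (V.lineEval p (f ⊗ₜ x)) := by
  rw [lineEval_tmul, lineEval_tmul, lineAct_apply, ← MatAlg.mul_apply, SU.mat_inv, SU.star_mul_self,
    MatAlg.one_apply]

theorem lineEval_rep (p : A.Triv) (a : A.Fib p.base) (f : V.LineFib p) (x : Cvec N) :
    V.lineEval p (f ⊗ₜ p.iso a x) = V.rep p a (V.lineEval p (f ⊗ₜ x)) := by
  rw [lineEval_tmul, lineEval_tmul, intertwiner_apply, matRep_iso]

/-- Representing bundles are tensor products of the standard one with line bundles. -/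
def lineFactorization : V.Factorization V.line where
  iso p := LinearEquiv.ofBijective (V.lineEval p) (V.lineEval_bijective p)
  smooth _ _ _ _ hf hx := (line_smoothAlong_iff.1 hf).apply (smoothAlong_trivial_iff.1 hx).2
  act := V.lineEval_act
  rep := V.lineEval_rep

end RepresentingBundle

end

/-! ### Comparison of the extension with the tensor product -/

noncomputable section

open TopologicalSpace (Opens)

section

variable {B₁ B₂ X₁ X₂ Y₁ Y₂ T₁ T₂ : Type*} [AddCommGroup B₁] [Module ℂ B₁] [AddCommGroup B₂]
  [Module ℂ B₂] [AddCommGroup X₁] [Module ℂ X₁] [AddCommGroup X₂] [Module ℂ X₂]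
  [AddCommGroup Y₁] [Module ℂ Y₁] [AddCommGroup Y₂] [Module ℂ Y₂] [AddCommGroup T₁] [Module ℂ T₁]
  [AddCommGroup T₂] [Module ℂ T₂] [Module.Finite ℂ X₂]
  [Module.Finite ℂ Y₂]

/-- The homomorphisms of tensor products as tensor products of homomorphisms, transported along
isomorphisms. -/
def tensorHomEquiv (f : B₁ ≃ₗ[ℂ] (X₂ →ₗ[ℂ] X₁)) (g : B₂ ≃ₗ[ℂ] (Y₂ →ₗ[ℂ] Y₁))
    (h₁ : (Y₁ ⊗[ℂ] X₁) ≃ₗ[ℂ] T₁) (h₂ : (Y₂ ⊗[ℂ] X₂) ≃ₗ[ℂ] T₂) :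
    (B₁ ⊗[ℂ] B₂) ≃ₗ[ℂ] (T₂ →ₗ[ℂ] T₁) :=
  (TensorProduct.congr f g).trans ((TensorProduct.comm ℂ _ _).trans
    ((homTensorHomEquiv ℂ Y₂ X₂ Y₁ X₁).trans (LinearEquiv.arrowCongr h₂ h₁)))

theorem tensorHomEquiv_apply (f : B₁ ≃ₗ[ℂ] (X₂ →ₗ[ℂ] X₁)) (g : B₂ ≃ₗ[ℂ] (Y₂ →ₗ[ℂ] Y₁))
    (h₁ : (Y₁ ⊗[ℂ] X₁) ≃ₗ[ℂ] T₁) (h₂ : (Y₂ ⊗[ℂ] X₂) ≃ₗ[ℂ] T₂) (a : B₁) (l : B₂) (s : Y₂)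
    (x : X₂) : tensorHomEquiv f g h₁ h₂ (a ⊗ₜ l) (h₂ (s ⊗ₜ x)) = h₁ (g l s ⊗ₜ f a x) := by
  simp [tensorHomEquiv, LinearEquiv.arrowCongr_apply, homTensorHomEquiv_apply]

end

instance {E H : Type*} [NormedAddCommGroup E] [NormedSpace ℝ E] [TopologicalSpace H]
    {I : ModelWithCorners ℝ E H} {M : Type*} [TopologicalSpace M] [ChartedSpace H M]
    (V : SmoothBundle I M) (x : M) : Module.Finite ℂ (V.Fib x) :=
  Module.Finite.equiv (V.coord x (FiberBundle.mem_baseSet_trivializationAt' x)).symm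

variable {N d : ℕ} {Z : Type u} [TopologicalSpace Z] [ChartedSpace (EuclideanSpace ℝ (Fin d)) Z]
  [NeZero N] [IsManifold (𝓡 d) ∞ Z] {A : AzumayaBundle.{u, v} N d Z}

namespace RepresentingBundle.Factorization

variable {V : RepresentingBundle.{u, v, w} A} {L : EquivariantLineBundle.{u, v, w} A}
  (e : V.Factorization L)

theorem iso_tr {p q : A.Triv} {g : SU N} (hg : g • p = q) (s : L.Fib p) (x : A.standard.Fib p) :
    e.iso q (L.tr g hg s ⊗ₜ A.standard.tr g hg x) = V.tr g hg (e.iso p (s ⊗ₜ x)) := by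
  subst hg
  exact e.act g p s x

theorem hom_ext {p : A.Triv} {T : Type*} [AddCommGroup T] [Module ℂ T] {f g : V.Fib p →ₗ[ℂ] T}
    (h : ∀ s x, f (e.iso p (s ⊗ₜ x)) = g (e.iso p (s ⊗ₜ x))) : f = g := by
  have h1 : f ∘ₗ (e.iso p : (L.Fib p ⊗[ℂ] A.standard.Fib p) →ₗ[ℂ] V.Fib p)
      = g ∘ₗ (e.iso p : (L.Fib p ⊗[ℂ] A.standard.Fib p) →ₗ[ℂ] V.Fib p) :=
    TensorProduct.ext' h
  refine LinearMap.ext fun y => ?_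
  have := LinearMap.congr_fun h1 ((e.iso p).symm y)
  simpa using this

/-- Locally, smooth families in `V = L ⊗ E` are of the form `s ⊗ x`, for a fixed smooth family `s`
in `L`. -/
theorem exists_tmul {k : ℕ} {p : Param k → A.Triv}
    (hp : ContMDiff (𝓡 k) 𝓘(ℝ, AzumayaBundle.TrivModel N d) ∞ p) (t₀ : Param k) :
    ∃ S ∈ 𝓝 t₀, ∀ (l : ℕ) (ψ : Param l → Param k) (y : ∀ t, V.Fib (p (ψ t))), ContDiff ℝ ∞ ψ →
      (∀ t, ψ t ∈ S) → V.SmoothAlong (fun t => p (ψ t)) y →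
        ∃ (s : ∀ t, L.Fib (p (ψ t))) (x : ∀ t, A.standard.Fib (p (ψ t))),
          L.SmoothAlong _ s ∧ A.standard.SmoothAlong _ x ∧ ∀ t, e.iso _ (s t ⊗ₜ x t) = y t := by
  obtain ⟨S₁, hS₁, h1⟩ := L.exists_frame hp t₀
  obtain ⟨S₂, hS₂, h2⟩ := A.standard.exists_frame hp t₀
  obtain ⟨S₃, hS₃, h3⟩ := V.exists_frame hp t₀
  refine ⟨_, inter_mem hS₁ (inter_mem hS₂ hS₃), fun l ψ y hψ hs hy => ?_⟩
  obtain ⟨c₁⟩ := h1 l ψ hψ fun t => (hs t).1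
  obtain ⟨c₂⟩ := h2 l ψ hψ fun t => (hs t).2.1
  obtain ⟨c₃⟩ := h3 l ψ hψ fun t => (hs t).2.2
  -- In rank one a constant coordinate vector gives a nowhere vanishing family `s` in `L`, and
  -- tensoring with it identifies `E` with `V` along the family.
  obtain ⟨j⟩ : Nonempty (ℂ ≃ₗ[ℂ] Cvec L.rank) := by rw [L.rank_eq_one]; exact ⟨cvecOne⟩
  have hs : L.SmoothAlong (fun t => p (ψ t)) fun t => (c₁.coord t).symm (j 1) := by
    rw [c₁.smooth_iff]
    simpa using contDiff_const
  let Φ : ∀ t, A.standard.Fib (p (ψ t)) ≃ₗ[ℂ] V.Fib (p (ψ t)) := fun t =>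
    (TensorProduct.lid ℂ _).symm.trans ((TensorProduct.congr (j.trans (c₁.coord t).symm)
      (LinearEquiv.refl ℂ _)).trans (e.iso (p (ψ t))))
  have hΦ : ∀ t x, Φ t x = e.iso _ ((c₁.coord t).symm (j 1) ⊗ₜ x) := fun t x => rfl
  refine ⟨_, fun t => (Φ t).symm (y t), hs, ?_, fun t => ?_⟩
  · refine SmoothBundle.smoothAlong_of_equiv c₂ c₃ Φ (fun x hx => ?_) ?_
    · exact e.smooth l _ _ x hs hx
    · simpa only [LinearEquiv.apply_symm_apply] using hy
  · rw [← hΦ, LinearEquiv.apply_symm_apply]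

/-- Neighbourhoods of the diagonal on which descents of the homomorphisms of `V`, `E` and `L` are
comparable. -/
structure TensorDomain (X : V.toEquivariantBundle.HomDescent)
    (Y : A.standard.toEquivariantBundle.HomDescent) (D : L.toEquivariantBundle.HomDescent) where
  W : Set (A.Triv × A.Triv)
  W₁ : Set (A.Triv × A.Triv)
  isOpen_W : IsOpen W
  isOpen_W₁ : IsOpen W₁
  diag_mem : ∀ p, (p, p) ∈ W
  smul_mem : ∀ (g : SU N) (p p' : A.Triv), (p, p') ∈ W → (g • p, g • p') ∈ W
  comp_mem : ∀ a b c, (a, b) ∈ W → (b, c) ∈ W → (a, c) ∈ W₁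
  mem_X : ∀ {p p'}, (p, p') ∈ W₁ → (p, p') ∈ X.W
  mem_Y : ∀ {p p'}, (p, p') ∈ W₁ → (p, p') ∈ Y.W
  mem_D : ∀ {p p'}, (p, p') ∈ W₁ → (p, p') ∈ D.W
  related : ∀ {p p' q q' : A.Triv}, (p, p') ∈ W₁ → (q, q') ∈ W₁ → p.base = q.base →
    p'.base = q'.base → ∃ g g' : SU N, g • p = q ∧ g' • p' = q' ∧ g' * g⁻¹ ∈ X.O ∧
      g' * g⁻¹ ∈ Y.O ∧ g' * g⁻¹ ∈ D.O

variable {X : V.toEquivariantBundle.HomDescent} {Y : A.standard.toEquivariantBundle.HomDescent}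
  {D : L.toEquivariantBundle.HomDescent}

variable (X Y D) in
theorem nonempty_tensorDomain [T2Space Z] [CompactSpace Z] : Nonempty (TensorDomain X Y D) := by
  -- A single `ε` serves the neighbourhoods of the identity of all three descents, so that one pair
  -- `(g, g')` can be used for all of them.
  obtain ⟨ε, hε, hO⟩ := SU.mem_nhds_one_iff.1 (inter_mem X.O_mem (inter_mem Y.O_mem D.O_mem))
  have h0 : X.W ∩ (Y.W ∩ D.W) ∈ 𝓝ˢ (diagonal A.Triv) := by
    refine (X.isOpen_W.inter (Y.isOpen_W.inter D.isOpen_W)).mem_nhdsSet.2 ?_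
    rintro ⟨p, p'⟩ h
    obtain rfl : p = p' := h
    exact ⟨X.diag_mem_W p, Y.diag_mem_W p, D.diag_mem_W p⟩
  obtain ⟨W₁, h1o, h1d, h1s, -, h1r⟩ := AzumayaBundle.exists_related_nhds h0 hε
  obtain ⟨W', ho, hd, -, hc⟩ := exists_open_comp_subset
    (h1o.mem_nhdsSet.2 (by rintro ⟨p, p'⟩ h; obtain rfl : p = p' := h; exact h1d p))
  refine ⟨⟨_, W₁, AzumayaBundle.isOpen_forall_smul_mem ho, h1o, fun p g => hd _,
    fun g p p' h k => ?_, fun a b c h h' => ?_, fun h => (h1s h).1, fun h => (h1s h).2.1,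
    fun h => (h1s h).2.2, fun h h' h1 h2 => ?_⟩⟩
  · simpa only [mul_smul] using h (k * g)
  -- Only twofold composites are needed here; the chain of three is padded with `(a, a)`.
  · exact hc a a b c (hd a) (by simpa using h 1) (by simpa using h' 1)
  · obtain ⟨g, g', hlt, hg, hg'⟩ := h1r _ _ _ _ h h' h1 h2
    obtain ⟨h3, h4, h5⟩ := hO g g' hlt
    exact ⟨g, g', hg, hg', h3, h4, h5⟩

namespace TensorDomain

variable (R : TensorDomain X Y D)

theorem subset {p p' : A.Triv} (h : (p, p') ∈ R.W) : (p, p') ∈ R.W₁ :=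
  R.comp_mem _ _ _ (R.diag_mem p) h

/-- The image in `Z × Z`. -/
def U : Opens (Z × Z) :=
  ⟨(fun p : A.Triv × A.Triv => (p.1.base, p.2.base)) '' R.W,
    AzumayaBundle.isOpen_image_base R.isOpen_W⟩

theorem base_mem {p p' : A.Triv} (h : (p, p') ∈ R.W) : (p.base, p'.base) ∈ R.U := ⟨_, h, rfl⟩

theorem exists_mem {z z' : Z} (h : (z, z') ∈ R.U) :
    ∃ p p' : A.Triv, (p, p') ∈ R.W ∧ p.base = z ∧ p'.base = z' := by
  obtain ⟨⟨p, p'⟩, h1, h2⟩ := h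
  obtain ⟨h3, h4⟩ := Prod.mk.inj h2
  exact ⟨p, p', h1, h3, h4⟩

theorem exists_mem_right {z z' : Z} (h : (z, z') ∈ R.U) {p : A.Triv} (hp : p.base = z) :
    ∃ p' : A.Triv, (p, p') ∈ R.W ∧ p'.base = z' := by
  obtain ⟨q, q', h1, h2, h3⟩ := R.exists_mem h
  obtain ⟨g, rfl⟩ := AzumayaBundle.exists_smul_eq (p := q) (q := p) (h2.trans hp.symm)
  exact ⟨g • q', R.smul_mem g _ _ h1, h3⟩

theorem le_X : R.U ≤ X.U := by
  rintro _ ⟨⟨p, p'⟩, h, rfl⟩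
  exact X.base_mem (R.mem_X (R.subset h))

theorem le_Y : R.U ≤ Y.U := by
  rintro _ ⟨⟨p, p'⟩, h, rfl⟩
  exact Y.base_mem (R.mem_Y (R.subset h))

theorem le_D : R.U ≤ D.U := by
  rintro _ ⟨⟨p, p'⟩, h, rfl⟩
  exact D.base_mem (R.mem_D (R.subset h))

/-- `(p, p')` is a point of the larger neighbourhood over `(z, z')`. -/
structure Over (z z' : Z) (p p' : A.Triv) : Prop where
  mem : (p, p') ∈ R.W₁
  fst : p.base = z
  snd : p'.base = z'

theorem exists_over {z z' : Z} (h : (z, z') ∈ R.U) :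
    ∃ p : A.Triv × A.Triv, R.Over z z' p.1 p.2 := by
  obtain ⟨p, p', h1, h2, h3⟩ := R.exists_mem h
  exact ⟨(p, p'), R.subset h1, h2, h3⟩

/-- The isomorphism with the tensor product. -/
def iso (u : Z × Z) (h : u ∈ R.U) :
    (Y.bundle.Fib ⟨u, R.le_Y h⟩ ⊗[ℂ] D.bundle.Fib ⟨u, R.le_D h⟩) ≃ₗ[ℂ]
      X.bundle.Fib ⟨u, R.le_X h⟩ :=
  have ho := (R.exists_over (z := u.1) (z' := u.2) h).choose_spec
  (tensorHomEquiv (Y.liftTo (R.le_Y h) (R.mem_Y ho.mem) ho.fst ho.snd)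
    (D.liftTo (R.le_D h) (R.mem_D ho.mem) ho.fst ho.snd) (e.iso _) (e.iso _)).trans
    (X.liftTo (R.le_X h) (R.mem_X ho.mem) ho.fst ho.snd).symm

variable {R}

/-- At the pair chosen in the definition this is `tensorHomEquiv_apply`. Another pair is reached by
some `(g, g')` with which the three lifts and the factorization are all compatible, so the
isomorphism is independent of the choice. -/
theorem liftTo_iso {z z' : Z} (h : (z, z') ∈ R.U) {p p' : A.Triv} (ho : R.Over z z' p p')
    (a : Y.bundle.Fib ⟨(z, z'), R.le_Y h⟩) (l : D.bundle.Fib ⟨(z, z'), R.le_D h⟩) (s : L.Fib p')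
    (x : A.standard.Fib p') :
    X.liftTo (R.le_X h) (R.mem_X ho.mem) ho.fst ho.snd (R.iso e (z, z') h (a ⊗ₜ l))
        (e.iso p' (s ⊗ₜ x))
      = e.iso p (D.liftTo (R.le_D h) (R.mem_D ho.mem) ho.fst ho.snd l s ⊗ₜ
          Y.liftTo (R.le_Y h) (R.mem_Y ho.mem) ho.fst ho.snd a x) := by
  obtain ⟨q, q', hq, he⟩ : ∃ q q', ∃ hq : R.Over z z' q q', ∀ s x,
      X.liftTo (R.le_X h) (R.mem_X hq.mem) hq.fst hq.snd (R.iso e (z, z') h (a ⊗ₜ l))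
        (e.iso q' (s ⊗ₜ x))
      = e.iso q (D.liftTo (R.le_D h) (R.mem_D hq.mem) hq.fst hq.snd l s ⊗ₜ
          Y.liftTo (R.le_Y h) (R.mem_Y hq.mem) hq.fst hq.snd a x) := by
    refine ⟨_, _, (R.exists_over h).choose_spec, fun s x => ?_⟩
    rw [iso, LinearEquiv.trans_apply, LinearEquiv.apply_symm_apply, tensorHomEquiv_apply]
  obtain ⟨g, g', hg, hg', hX, hY, hD⟩ :=
    R.related hq.mem ho.mem (hq.fst.trans ho.fst.symm) (hq.snd.trans ho.snd.symm)
  obtain ⟨s, rfl⟩ : ∃ s', L.tr g' hg' s' = s := ⟨_, (L.trEquiv g' hg').apply_symm_apply s⟩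
  obtain ⟨x, rfl⟩ : ∃ x', A.standard.tr g' hg' x' = x :=
    ⟨_, (A.standard.trEquiv g' hg').apply_symm_apply x⟩
  rw [e.iso_tr, X.liftTo_tr (R.mem_X hq.mem) hq.fst hq.snd (R.mem_X ho.mem) ho.fst ho.snd hg hg' hX,
    he, ← e.iso_tr, D.liftTo_tr (R.mem_D hq.mem) hq.fst hq.snd (R.mem_D ho.mem) ho.fst ho.snd hg hg' hD,
    Y.liftTo_tr (R.mem_Y hq.mem) hq.fst hq.snd (R.mem_Y ho.mem) ho.fst ho.snd hg hg' hY]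

/-- On a compatible triple of points, both sides lift to homomorphisms of `L ⊗ E`. They agree on
elementary tensors because tensor products of maps are composed factor by factor. -/
theorem iso_comp {x y z : Z} (hxy : (x, y) ∈ R.U) (hyz : (y, z) ∈ R.U) (hxz : (x, z) ∈ R.U)
    (a : Y.bundle.Fib ⟨(x, y), R.le_Y hxy⟩) (b : Y.bundle.Fib ⟨(y, z), R.le_Y hyz⟩)
    (l : D.bundle.Fib ⟨(x, y), R.le_D hxy⟩) (m : D.bundle.Fib ⟨(y, z), R.le_D hyz⟩) :
    R.iso e (x, z) hxz (Y.comp (R.le_Y hxy) (R.le_Y hyz) (R.le_Y hxz) a b ⊗ₜ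
        D.comp (R.le_D hxy) (R.le_D hyz) (R.le_D hxz) l m)
      = X.comp (R.le_X hxy) (R.le_X hyz) (R.le_X hxz) (R.iso e (x, y) hxy (a ⊗ₜ l))
          (R.iso e (y, z) hyz (b ⊗ₜ m)) := by
  obtain ⟨p, q, h, hp, hq⟩ := R.exists_mem hxy
  obtain ⟨r, h', hr⟩ := R.exists_mem_right hyz hq
  have pq : R.Over x y p q := ⟨R.subset h, hp, hq⟩
  have qr : R.Over y z q r := ⟨R.subset h', hq, hr⟩
  have pr : R.Over x z p r := ⟨R.comp_mem _ _ _ h h', hp, hr⟩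
  apply (X.liftTo (R.le_X hxz) (R.mem_X pr.mem) hp hr).injective
  refine e.hom_ext fun s v => ?_
  rw [liftTo_iso e hxz pr, X.liftTo_comp (R.mem_X pq.mem) (R.mem_X qr.mem) (R.mem_X pr.mem) hp hq hr,
    Y.liftTo_comp (R.mem_Y pq.mem) (R.mem_Y qr.mem) (R.mem_Y pr.mem) hp hq hr,
    D.liftTo_comp (R.mem_D pq.mem) (R.mem_D qr.mem) (R.mem_D pr.mem) hp hq hr,
    LinearMap.comp_apply, LinearMap.comp_apply, LinearMap.comp_apply, liftTo_iso e hyz qr,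
    liftTo_iso e hxy pq]

/-- Smoothness in the bundle of `X` is tested by applying lifts to smooth families of `V`. Locally
these have the form `s ⊗ x` with `s` and `x` smooth, and on such families the lift is a tensor
product of the smooth lifts for `D` and `Y`. -/
theorem smoothAlong_iso {k : ℕ} {z z' : Param k → Z} (h : ∀ t, (z t, z' t) ∈ R.U)
    {a : ∀ t, Y.bundle.Fib ⟨(z t, z' t), R.le_Y (h t)⟩}
    {l : ∀ t, D.bundle.Fib ⟨(z t, z' t), R.le_D (h t)⟩} (ha : Y.bundle.SmoothAlong _ a)
    (hl : D.bundle.SmoothAlong _ l) :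
    X.bundle.SmoothAlong (fun t => ⟨(z t, z' t), R.le_X (h t)⟩)
      fun t => R.iso e (z t, z' t) (h t) (a t ⊗ₜ l t) := by
  have hx := contMDiff_opens_iff.1 ha.base
  have hz : ContMDiff (𝓡 k) (𝓡 d) ∞ z := fun t => (hx t).fst
  have hz' : ContMDiff (𝓡 k) (𝓡 d) ∞ z' := fun t => (hx t).snd
  refine SmoothBundle.smoothAlong_of_local fun t₀ => ?_
  obtain ⟨⟨p₀, p₀'⟩, h₀⟩ := R.exists_over (h t₀)
  obtain ⟨p, rfl, hp, hpc, S, hS, hpS⟩ := AzumayaBundle.exists_smooth_section hz h₀.fst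
  obtain ⟨p', rfl, hp', hpc', S', hS', hpS'⟩ := AzumayaBundle.exists_smooth_section hz' h₀.snd
  have hW : ∀ᶠ t in 𝓝 t₀, (p t, p' t) ∈ R.W₁ :=
    (hpc.prodMk hpc').eventually (R.isOpen_W₁.mem_nhds h₀.mem)
  refine ⟨_, inter_mem hS (inter_mem hS' hW), fun ψ hψ hs => ?_⟩
  have ho : ∀ t, R.Over (z (ψ t)) (z' (ψ t)) (p (ψ t)) (p' (ψ t)) := fun t =>
    ⟨(hs t).2.2, hp _, hp' _⟩
  have h1 := hpS k ψ hψ fun t => (hs t).1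
  have h2 := hpS' k ψ hψ fun t => (hs t).2.1
  refine X.smoothAlong_of_liftTo (fun t => R.mem_X (ho t).mem) (fun t => (ho t).fst)
    (fun t => (ho t).snd) h1 h2 fun θ y hθ hy => ?_
  refine SmoothBundle.smoothAlong_of_local fun t₁ => ?_
  obtain ⟨T, hT, hTy⟩ := e.exists_tmul hy.base t₁
  refine ⟨T, hT, fun η hη hηT => ?_⟩
  obtain ⟨s, x, hs, hx, he⟩ := hTy k η _ hη hηT (hy.comp hη)
  have hζ : ContDiff ℝ ∞ fun t => ψ (θ (η t)) := hψ.comp (hθ.comp hη)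
  have h3 : ContMDiff (𝓡 k) 𝓘(ℝ, AzumayaBundle.TrivModel N d) ∞ fun t => p (ψ (θ (η t))) :=
    h1.comp (hθ.comp hη).contMDiff
  refine SmoothBundle.smoothAlong_congr (fun t => ?_) (e.smooth k (fun t => p (ψ (θ (η t)))) _ _
    (D.smoothAlong_liftTo (fun t => R.mem_D (ho (θ (η t))).mem) (fun t => (ho (θ (η t))).fst)
      (fun t => (ho (θ (η t))).snd) h3 (hl.comp hζ) hs)
    (Y.smoothAlong_liftTo (fun t => R.mem_Y (ho (θ (η t))).mem) (fun t => (ho (θ (η t))).fst)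
      (fun t => (ho (θ (η t))).snd) h3 (ha.comp hζ) hx))
  congr 1
  rw [← he t, liftTo_iso e (h _) (ho _)]

end TensorDomain

/-- The extension given by `L ⊗ E` as a tensor product. -/
def tensorIso {X : V.Extension} {Y : A.standard.Extension} {D : L.toEquivariantBundle.HomDescent}
    (R : TensorDomain X.toHomDescent Y.toHomDescent D) : e.TensorIso X Y D where
  U := R.U
  diag_mem z := by
    obtain ⟨p, rfl⟩ := AzumayaBundle.base_surjective (A := A) z
    exact R.base_mem (R.diag_mem p)
  le_X := R.le_X
  le_Y := R.le_Y
  le_D := R.le_D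
  iso := R.iso e
  smooth _ _ h _ _ ha hl := TensorDomain.smoothAlong_iso e h ha hl
  map_comp := TensorDomain.iso_comp e
  W := R.W
  isOpen_W := R.isOpen_W
  diag_mem_W := R.diag_mem
  base_mem := R.base_mem
  exists_mem_W := R.exists_mem
  W_X _ h := R.mem_X (R.subset h)
  W_Y _ h := R.mem_Y (R.subset h)
  W_D _ h := R.mem_D (R.subset h)
  lift_iso h a l s x := TensorDomain.liftTo_iso e (R.base_mem h) ⟨R.subset h, rfl, rfl⟩ a l s x

end RepresentingBundle.Factorization

end

theorem mainTheorem9 {N d : ℕ} [NeZero N] {Z : Type u} [TopologicalSpace Z] [T2Space Z]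
    [CompactSpace Z] [ChartedSpace (EuclideanSpace ℝ (Fin d)) Z] [IsManifold (𝓡 d) ∞ Z]
    (A : AzumayaBundle.{u, v} N d Z) (V : RepresentingBundle.{u, v, w} A) :
    Nonempty V.Extension ∧
      (∃ L : EquivariantLineBundle.{u, v, w} A, Nonempty (V.Factorization L)) ∧
      ∀ (L : EquivariantLineBundle.{u, v, w} A) (e : V.Factorization L),
        Nonempty A.standard.Extension ∧ Nonempty L.toEquivariantBundle.HomDescent ∧
          ∀ (X : V.Extension) (Y : A.standard.Extension) (D : L.toEquivariantBundle.HomDescent),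
            Nonempty (e.TensorIso X Y D) := by
  refine ⟨V.nonempty_extension, ⟨V.line, ⟨V.lineFactorization⟩⟩, fun L e =>
    ⟨A.standard.nonempty_extension, L.nonempty_homDescent, fun X Y D => ?_⟩⟩
  obtain ⟨R⟩ := RepresentingBundle.Factorization.nonempty_tensorDomain X.toHomDescent
    Y.toHomDescent D
  exact ⟨e.tensorIso R⟩
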